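/- Let $a_1>a_2>0>a_3$ and, for $a_3<z<a_2$, let $$x_z(\alpha,\beta)=\Big(\sqrt{a_1-z}\,\tfrac{\cos\beta}{\cos\alpha},\ \sqrt{a_2-z}\,\tfrac{\sin\beta}{\cos\alpha},\ \sqrt{z-a_3}\,\tan\alpha\Big),\qquad \alpha\in(-\tfrac{\pi}{2},\tfrac{\pi}{2}),\ \beta\in\mathbb R,$$ be the one-sheeted hyperboloids confocal to $x_0$. Put $H=\frac{\cos^2\beta}{a_1}+\frac{\sin^2\beta}{a_2}-\frac{\sin^2\alpha}{a_3}$, $\hat N=-2\,\partial_z x_z|_{z=0}$, $N_{x_0}=\hat N/|\hat N|$, $r_j=\sqrt{1-z/a_j}$. All functions are smooth. A *deformation* of $x_0$ in coordinates $(u,v)\in U\subset\mathbb R^2$ ($U$ open) consists of functions $\alpha,\beta$ on $U$ with nonvanishing Jacobian, $\alpha\in(-\frac\pi2,\frac\pi2)$, and a map $x:U\to\mathbb R^3$ with $|dx|^2=|d(x_0(\alpha,\beta))|^2$. The system $(u,v)$ is *common conjugate* if the second fundamental forms $\bar h$ of $x_0(\alpha,\beta)$ and $\tilde h$ of $x$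 (for a unit normal $N$) have no $du\,dv$ term and $\alpha_u^2-\beta_u^2>0$. Put $$\lambda=\mathrm{sgn}(\alpha_u)\sqrt{\alpha_u^2-\beta_u^2},\quad \mu=\mathrm{sgn}(\beta_v)\sqrt{\beta_v^2-\alpha_v^2},\quad \tanh\theta=\beta_u/\alpha_u .$$ For $s=\pm1$ the common conjugate system is called *isothermic-conjugate of sign $s$* if $\mu^2-\lambda^2=sH$ and $\tilde h=\frac{\lambda\mu}{\cos\alpha\sqrt H}(du^2-dv^2)$. 1. Let $U=I\times J$ be a product of open intervals, $(u,v)$ common conjugate, and $\tilde h_{11}^2\ne\bar h_{11}^2$ everywhere on $U$. Then there are a sign $s$ and orientation-preserving smooth changes of the variable $u$ alone and of the variable $v$ alone after which $(u,v)$ is isothermic-conjugate of sign $s$ (for $N$ or $-N$). If $s=1$ then $|\tilde h_{11}|>|\bar h_{11}|$ on $U$, and if $s=-1$ then $|\tilde h_{11}|<|\bar h_{11}|$ on $U$. 2. If $(u,v)$ is isothermic-conjugate of sign $s$, then $\theta,\lambda,\mu$ are smooth and, with $\mathbf C=\cosh\theta$, $\mathbf S=\sinh\theta$, $$\alpha_u=\lambda\mathbf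 C,\ \ \alpha_v=\mu\mathbf S,\ \ \beta_u=\lambda\mathbf S,\ \ \beta_v=\mu\mathbf C,\ \ \lambda_v=\mu\theta_u,\ \ \mu_u=\lambda\theta_v,$$ $$\lambda_u=-\tfrac s2(H_\alpha\mathbf C+H_\beta\mathbf S)+\mu\theta_v,\quad \mu_v=\tfrac s2(H_\alpha\mathbf S+H_\beta\mathbf C)+\lambda\theta_u,\quad \mu^2-\lambda^2=sH,$$ $$\theta_{vv}-\theta_{uu}=\tfrac s2(H_{\alpha\alpha}+H_{\beta\beta})\,\mathbf C\,\mathbf S .$$ In particular, for $s=1$ one has the modified sinh-Gordon equation $\theta_{vv}-\theta_{uu}=\frac12(H_{\alpha\alpha}+H_{\beta\beta})\cosh\theta\sinh\theta$. 3. Let $a_3<z<0$, let $U$ be connected, let $x^0$ be a deformation of $x_0^0:=x_0(\alpha_0,\beta_0)$ for which $(u,v)$ is isothermic-conjugate of sign $1$ with normal $N^0$, and let $x^1$ be a Bäcklund transform of it, i.e. a deformation of $x_0^1:=x_0(\alpha_1,\beta_1)$ on $U$ such that, with $x_z^j=x_z(\alpha_j,\beta_j)$ and $\hat N^j=\hat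 N(\alpha_j,\beta_j)$, $$(x_z^1-x_0^0)^T\hat N^0=(x_z^0-x_0^1)^T\hat N^1=0,\qquad x^1=x^0+\cos^2\alpha_0\big(-x^0_{\alpha_0}(x^0_{z\alpha_0})^T+x^0_{\beta_0}(x^0_{z\beta_0})^T\big)\hat N^1 .$$ Then, for a suitable unit normal of $x^1$, $(u,v)$ is isothermic-conjugate of sign $1$ for $x^1$; hence $\alpha_1,\beta_1,\lambda_1,\mu_1,\theta_1$ satisfy all equations of part 2 with $s=1$. Moreover there are constants $\epsilon_1,\epsilon_1'\in\{1,-1\}$ such that $$(dN^0)^T(x^1-x^0)=\epsilon_1\,N_{x_0}(\alpha_0,\beta_0)^T\big(x^1_{z\beta_1}d\alpha_1+x^1_{z\alpha_1}d\beta_1\big),$$ $$\sin\alpha_0\cos\alpha_1-r_3\cos\alpha_0\sin\alpha_1=\epsilon_1'\sqrt{-z}\,(\mathbf C_0\lambda_1+\epsilon_1\mathbf S_0\mu_1),$$ $$-r_1\sin\beta_0\cos\beta_1+r_2\cos\beta_0\sin\beta_1=-\epsilon_1'\sqrt{-z}\,(\mathbf S_0\lambda_1+\epsilon_1\mathbf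 C_0\mu_1),$$ the last two equations also hold with the indices $0,1$ of $\alpha,\beta,\lambda,\mu,\mathbf C,\mathbf S$ exchanged and $\epsilon_1'$ replaced by $-\epsilon_1'$, and $$\theta_{0u}+\epsilon_1\theta_{1v}=\tfrac{\epsilon_1'}{\sqrt{-z}}\big[(\sin\alpha_0\sin\alpha_1+r_3\cos\alpha_0\cos\alpha_1)\mathbf S_0\mathbf C_1-(r_1\sin\beta_0\sin\beta_1+r_2\cos\beta_0\cos\beta_1)\mathbf C_0\mathbf S_1\big],$$ $$\theta_{0v}+\epsilon_1\theta_{1u}=\tfrac{-\epsilon_1\epsilon_1'}{\sqrt{-z}}\big[(\sin\alpha_0\sin\alpha_1+r_3\cos\alpha_0\cos\alpha_1)\mathbf C_0\mathbf S_1-(r_1\sin\beta_0\sin\beta_1+r_2\cos\beta_0\cos\beta_1)\mathbf S_0\mathbf C_1\big].$$ -/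

import Mathlib

open scoped ContDiff

noncomputable section

namespace QuadricDeformation

/-- Euclidean three-space. -/
abbrev E3 := EuclideanSpace ℝ (Fin 3)

/-- Partial derivative with respect to the first variable `u`. -/
def pu {E : Type*} [NormedAddCommGroup E] [NormedSpace ℝ E] (f : ℝ × ℝ → E) (p : ℝ × ℝ) : E :=
  fderiv ℝ f p (1, 0)

/-- Partial derivative with respect to the second variable `v`. -/
def pv {E : Type*} [NormedAddCommGroup E] [NormedSpace ℝ E] (f : ℝ × ℝ → E) (p : ℝ × ℝ) : E :=
  fderiv ℝ f p (0, 1)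

/-- The parameters `a₁ > a₂ > 0 > a₃` of a real hyperboloid of one sheet
`x² / a₁ + y² / a₂ + w² / a₃ = 1`. -/
structure OneSheetedHyperboloid where
  a₁ : ℝ
  a₂ : ℝ
  a₃ : ℝ
  a₂_lt_a₁ : a₂ < a₁
  a₂_pos : 0 < a₂
  a₃_neg : a₃ < 0

namespace OneSheetedHyperboloid

variable (Q : OneSheetedHyperboloid)

/-- The parametrized confocal family `x_z(α, β)`; the hyperboloid itself is `z = 0`. -/
def X (z α β : ℝ) : E3 :=
  !₂[√(Q.a₁ - z) * Real.cos β / Real.cos α,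
     √(Q.a₂ - z) * Real.sin β / Real.cos α,
     √(z - Q.a₃) * Real.tan α]

/-- `∂ x_z / ∂ α`. -/
def Xα (z α β : ℝ) : E3 := deriv (fun t => Q.X z t β) α

/-- `∂ x_z / ∂ β`. -/
def Xβ (z α β : ℝ) : E3 := deriv (fun t => Q.X z α t) β

/-- The normal vector `-2 ∂_z x_z` at `z = 0`. -/
def Nhat (α β : ℝ) : E3 := (-2 : ℝ) • deriv (fun z => Q.X z α β) 0

/-- The unit normal of the hyperboloid. -/
def N₀ (α β : ℝ) : E3 := ‖Q.Nhat α β‖⁻¹ • Q.Nhat α β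

/-- The function `H`. -/
def H (α β : ℝ) : ℝ :=
  Real.cos β ^ 2 / Q.a₁ + Real.sin β ^ 2 / Q.a₂ - Real.sin α ^ 2 / Q.a₃

/-- `∂ H / ∂ α`. -/
def Hα (α β : ℝ) : ℝ := deriv (fun t => Q.H t β) α

/-- `∂ H / ∂ β`. -/
def Hβ (α β : ℝ) : ℝ := deriv (fun t => Q.H α t) β

/-- `∂² H / ∂ α²`. -/
def Hαα (α β : ℝ) : ℝ := deriv (fun t => Q.Hα t β) α

/-- `∂² H / ∂ β²`. -/
def Hββ (α β : ℝ) : ℝ := deriv (fun t => Q.Hβ α t) β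

/-- `r₁ = √(1 - z / a₁)`. -/
def r₁ (z : ℝ) : ℝ := √(1 - z / Q.a₁)

/-- `r₂ = √(1 - z / a₂)`. -/
def r₂ (z : ℝ) : ℝ := √(1 - z / Q.a₂)

/-- `r₃ = √(1 - z / a₃)`. -/
def r₃ (z : ℝ) : ℝ := √(1 - z / Q.a₃)

end OneSheetedHyperboloid

/-- The Jacobian `α_u β_v - α_v β_u`. -/
def jac (α β : ℝ × ℝ → ℝ) (p : ℝ × ℝ) : ℝ := pu α p * pv β p - pv α p * pu β p

/-- The hyperboloid referred to the coordinates `(u, v)` through `α = α(u, v)`, `β = β(u, v)`. -/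
def onQuadric (Q : OneSheetedHyperboloid) (α β : ℝ × ℝ → ℝ) (p : ℝ × ℝ) : E3 :=
  Q.X 0 (α p) (β p)

/-- The unit normal of the hyperboloid referred to `(u, v)`. -/
def quadricNormal (Q : OneSheetedHyperboloid) (α β : ℝ × ℝ → ℝ) (p : ℝ × ℝ) : E3 :=
  Q.N₀ (α p) (β p)

/-- `x` is a real deformation of the region of the hyperboloid described by `(α, β)`, both being
referred to the coordinates `(u, v) ∈ U`: `(α, β)` is a local diffeomorphism into the chart of the
hyperboloid and `|dx|² = |dx₀(α, β)|²`. -/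
structure IsDeformation (Q : OneSheetedHyperboloid) (U : Set (ℝ × ℝ)) (α β : ℝ × ℝ → ℝ)
    (x : ℝ × ℝ → E3) : Prop where
  smooth_α : ContDiffOn ℝ ∞ α U
  smooth_β : ContDiffOn ℝ ∞ β U
  smooth_x : ContDiffOn ℝ ∞ x U
  chart : ∀ p ∈ U, α p ∈ Set.Ioo (-(Real.pi / 2)) (Real.pi / 2)
  jac_ne_zero : ∀ p ∈ U, jac α β p ≠ 0
  metric_uu : ∀ p ∈ U, inner ℝ (pu x p) (pu x p) =
    inner ℝ (pu (onQuadric Q α β) p) (pu (onQuadric Q α β) p)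
  metric_uv : ∀ p ∈ U, inner ℝ (pu x p) (pv x p) =
    inner ℝ (pu (onQuadric Q α β) p) (pv (onQuadric Q α β) p)
  metric_vv : ∀ p ∈ U, inner ℝ (pv x p) (pv x p) =
    inner ℝ (pv (onQuadric Q α β) p) (pv (onQuadric Q α β) p)

/-- `N` is a smooth unit normal field along `x`. -/
structure IsUnitNormal (U : Set (ℝ × ℝ)) (x N : ℝ × ℝ → E3) : Prop where
  smooth : ContDiffOn ℝ ∞ N U
  norm_eq_one : ∀ p ∈ U, ‖N p‖ = 1
  orth_u : ∀ p ∈ U, inner ℝ (N p) (pu x p) = 0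
  orth_v : ∀ p ∈ U, inner ℝ (N p) (pv x p) = 0

/-- Coefficient of `du²` in the second fundamental form of `x` with respect to the normal `N`. -/
def h₁₁ (x N : ℝ × ℝ → E3) (p : ℝ × ℝ) : ℝ := inner ℝ (N p) (pu (pu x) p)

/-- Coefficient of `du dv` (halved) in the second fundamental form. -/
def h₁₂ (x N : ℝ × ℝ → E3) (p : ℝ × ℝ) : ℝ := inner ℝ (N p) (pu (pv x) p)

/-- Coefficient of `dv²` in the second fundamental form. -/
def h₂₂ (x N : ℝ × ℝ → E3) (p : ℝ × ℝ) : ℝ := inner ℝ (N p) (pv (pv x) p)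

/-- `(u, v)` is a conjugate system common to the deformation `x` (with unit normal `N`) and to the
hyperboloid, the coordinate `u` being the one with `α_u² - β_u² > 0`. -/
structure IsCommonConjugate (Q : OneSheetedHyperboloid) (U : Set (ℝ × ℝ)) (α β : ℝ × ℝ → ℝ)
    (x N : ℝ × ℝ → E3) : Prop where
  deformation : IsDeformation Q U α β x
  normal : IsUnitNormal U x N
  conj_quadric : ∀ p ∈ U, h₁₂ (onQuadric Q α β) (quadricNormal Q α β) p = 0
  conj_x : ∀ p ∈ U, h₁₂ x N p = 0
  pos : ∀ p ∈ U, 0 < pu α p ^ 2 - pu β p ^ 2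

/-- `λ = sgn(α_u) √(α_u² - β_u²)`. -/
def lam (α β : ℝ × ℝ → ℝ) (p : ℝ × ℝ) : ℝ :=
  Real.sign (pu α p) * √(pu α p ^ 2 - pu β p ^ 2)

/-- `μ = sgn(β_v) √(β_v² - α_v²)`. -/
def mu (α β : ℝ × ℝ → ℝ) (p : ℝ × ℝ) : ℝ :=
  Real.sign (pv β p) * √(pv β p ^ 2 - pv α p ^ 2)

/-- The hyperbolic angle `θ` between the conjugate systems `(α, β)` and `(u, v)`:
`tanh θ = β_u / α_u`. -/
def theta (α β : ℝ × ℝ → ℝ) (p : ℝ × ℝ) : ℝ := Real.artanh (pu β p / pu α p)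

/-- `(u, v)` is the normalized isothermic-conjugate system of the deformation `x`: it is a common
conjugate system, the second fundamental form of `x` is
`λ μ (du² - dv²) / (cos α √H)`, and `μ² - λ² = s H`, where `s = ± 1`. -/
structure IsIsothermicConjugate (Q : OneSheetedHyperboloid) (s : ℝ) (U : Set (ℝ × ℝ))
    (α β : ℝ × ℝ → ℝ) (x N : ℝ × ℝ → E3) : Prop where
  common : IsCommonConjugate Q U α β x N
  form_uu : ∀ p ∈ U, h₁₁ x N p =
    lam α β p * mu α β p / (Real.cos (α p) * √(Q.H (α p) (β p)))
  form_vv : ∀ p ∈ U, h₂₂ x N p =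
    -(lam α β p * mu α β p / (Real.cos (α p) * √(Q.H (α p) (β p))))
  normalized : ∀ p ∈ U, mu α β p ^ 2 - lam α β p ^ 2 = s * Q.H (α p) (β p)

/-- The first-order differential system in `α, β, λ, μ` with the angle `θ`
(and the sign `s = ± 1`). -/
structure SolvesSystem (Q : OneSheetedHyperboloid) (s : ℝ) (U : Set (ℝ × ℝ))
    (α β l m θ : ℝ × ℝ → ℝ) : Prop where
  α_u : ∀ p ∈ U, pu α p = Real.cosh (θ p) * l p
  α_v : ∀ p ∈ U, pv α p = Real.sinh (θ p) * m p
  β_u : ∀ p ∈ U, pu β p = Real.sinh (θ p) * l p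
  β_v : ∀ p ∈ U, pv β p = Real.cosh (θ p) * m p
  l_u : ∀ p ∈ U, pu l p =
    s * (-(1 / 2) * Q.Hα (α p) (β p) * Real.cosh (θ p)
      - 1 / 2 * Q.Hβ (α p) (β p) * Real.sinh (θ p)) + m p * pv θ p
  l_v : ∀ p ∈ U, pv l p = m p * pu θ p
  m_u : ∀ p ∈ U, pu m p = l p * pv θ p
  m_v : ∀ p ∈ U, pv m p =
    s * (1 / 2 * Q.Hα (α p) (β p) * Real.sinh (θ p)
      + 1 / 2 * Q.Hβ (α p) (β p) * Real.cosh (θ p)) + l p * pu θ p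
  first_integral : ∀ p ∈ U, m p ^ 2 - l p ^ 2 = s * Q.H (α p) (β p)

/-- The modified sinh-Gordon equation
`θ_vv - θ_uu = s (H_αα + H_ββ) cosh θ sinh θ / 2` along `(α, β)`. -/
def ModifiedSinhGordon (Q : OneSheetedHyperboloid) (s : ℝ) (U : Set (ℝ × ℝ))
    (α β θ : ℝ × ℝ → ℝ) : Prop :=
  ∀ p ∈ U, pv (pv θ) p - pu (pu θ) p =
    s * (1 / 2 * (Q.Hαα (α p) (β p) + Q.Hββ (α p) (β p)) * Real.cosh (θ p) * Real.sinh (θ p))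

/-- `θ`, `λ`, `μ` are smooth, solve the system, and `θ` solves the modified sinh-Gordon equation. -/
structure AngleEquations (Q : OneSheetedHyperboloid) (s : ℝ) (U : Set (ℝ × ℝ))
    (α β : ℝ × ℝ → ℝ) : Prop where
  smooth_theta : ContDiffOn ℝ ∞ (theta α β) U
  smooth_lam : ContDiffOn ℝ ∞ (lam α β) U
  smooth_mu : ContDiffOn ℝ ∞ (mu α β) U
  system : SolvesSystem Q s U α β (lam α β) (mu α β) (theta α β)
  equation : ModifiedSinhGordon Q s U α β (theta α β)

/-- Derivative `x_α` of a surface `x` given in the coordinates `(u, v)` (chain rule: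
`x_u = α_u x_α + β_u x_β`, `x_v = α_v x_α + β_v x_β`). -/
def dα (α β : ℝ × ℝ → ℝ) (x : ℝ × ℝ → E3) (p : ℝ × ℝ) : E3 :=
  (jac α β p)⁻¹ • (pv β p • pu x p - pu β p • pv x p)

/-- Derivative `x_β` of a surface `x` given in the coordinates `(u, v)`. -/
def dβ (α β : ℝ × ℝ → ℝ) (x : ℝ × ℝ → E3) (p : ℝ × ℝ) : E3 :=
  (jac α β p)⁻¹ • (pu α p • pv x p - pv α p • pu x p)

/-- The symmetric tangency configuration: `x_z(α₁, β₁)` lies in the tangent plane of the hyperboloid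
at `x₀(α₀, β₀)`, and the same with the two points exchanged. -/
def Tangency (Q : OneSheetedHyperboloid) (z α₀ β₀ α₁ β₁ : ℝ) : Prop :=
  inner ℝ (Q.X z α₁ β₁ - Q.X 0 α₀ β₀) (Q.Nhat α₀ β₀) = 0 ∧
  inner ℝ (Q.X z α₀ β₀ - Q.X 0 α₁ β₁) (Q.Nhat α₁ β₁) = 0

/-- `x₁` (a deformation of the region of the hyperboloid described by `(α₁, β₁)`) is a
Bäcklund transform, with parameter `z`, of the deformation `x₀` of the region described by
`(α₀, β₀)`. -/
structure IsBacklundTransform (Q : OneSheetedHyperboloid) (z : ℝ) (U : Set (ℝ × ℝ))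
    (α₀ β₀ : ℝ × ℝ → ℝ) (x₀ : ℝ × ℝ → E3) (α₁ β₁ : ℝ × ℝ → ℝ) (x₁ : ℝ × ℝ → E3) : Prop where
  leaf : IsDeformation Q U α₁ β₁ x₁
  tangency : ∀ p ∈ U, Tangency Q z (α₀ p) (β₀ p) (α₁ p) (β₁ p)
  position : ∀ p ∈ U, x₁ p = x₀ p + Real.cos (α₀ p) ^ 2 •
    (-(inner ℝ (Q.Xα z (α₀ p) (β₀ p)) (Q.Nhat (α₁ p) (β₁ p))) • dα α₀ β₀ x₀ p
      + inner ℝ (Q.Xβ z (α₀ p) (β₀ p)) (Q.Nhat (α₁ p) (β₁ p)) • dβ α₀ β₀ x₀ p)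

/-- The sign `ε` is that of the ruling family of the transformation:
`(dN⁰)ᵀ (x¹ - x⁰) = ε (N₀⁰)ᵀ (x_{zβ₁} dα₁ + x_{zα₁} dβ₁)`. -/
def RulingSign (Q : OneSheetedHyperboloid) (z ε : ℝ) (U : Set (ℝ × ℝ))
    (α₀ β₀ : ℝ × ℝ → ℝ) (x₀ N₀ : ℝ × ℝ → E3) (α₁ β₁ : ℝ × ℝ → ℝ) (x₁ : ℝ × ℝ → E3) : Prop :=
  ∀ p ∈ U,
    inner ℝ (pu N₀ p) (x₁ p - x₀ p) = ε * inner ℝ (quadricNormal Q α₀ β₀ p)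
      (pu α₁ p • Q.Xβ z (α₁ p) (β₁ p) + pu β₁ p • Q.Xα z (α₁ p) (β₁ p)) ∧
    inner ℝ (pv N₀ p) (x₁ p - x₀ p) = ε * inner ℝ (quadricNormal Q α₀ β₀ p)
      (pv α₁ p • Q.Xβ z (α₁ p) (β₁ p) + pv β₁ p • Q.Xα z (α₁ p) (β₁ p))

/-- The algebraic relations of the Bäcklund transformation between
`(α₀, β₀)` and `(α₁, β₁, λ₁, μ₁)`, in one direction. -/
def AlgebraicRelations (Q : OneSheetedHyperboloid) (z ε ε' : ℝ) (U : Set (ℝ × ℝ))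
    (α₀ β₀ α₁ β₁ : ℝ × ℝ → ℝ) : Prop :=
  ∀ p ∈ U,
    Real.sin (α₀ p) * Real.cos (α₁ p) - Q.r₃ z * Real.cos (α₀ p) * Real.sin (α₁ p) =
      ε' * √(-z) * (Real.cosh (theta α₀ β₀ p) * lam α₁ β₁ p
        + ε * Real.sinh (theta α₀ β₀ p) * mu α₁ β₁ p) ∧
    -(Q.r₁ z * Real.sin (β₀ p) * Real.cos (β₁ p)) + Q.r₂ z * Real.cos (β₀ p) * Real.sin (β₁ p) =
      -(ε' * √(-z) * (Real.sinh (theta α₀ β₀ p) * lam α₁ β₁ p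
        + ε * Real.cosh (theta α₀ β₀ p) * mu α₁ β₁ p))

/-- The first-order Bäcklund relations between two solutions `θ₀`, `θ₁`. -/
def BacklundRelations (Q : OneSheetedHyperboloid) (z ε ε' : ℝ) (U : Set (ℝ × ℝ))
    (α₀ β₀ θ₀ α₁ β₁ θ₁ : ℝ × ℝ → ℝ) : Prop :=
  ∀ p ∈ U,
    pu θ₀ p + ε * pv θ₁ p = ε' / √(-z) *
      ((Real.sin (α₀ p) * Real.sin (α₁ p) + Q.r₃ z * Real.cos (α₀ p) * Real.cos (α₁ p))
          * Real.sinh (θ₀ p) * Real.cosh (θ₁ p)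
        - (Q.r₁ z * Real.sin (β₀ p) * Real.sin (β₁ p)
            + Q.r₂ z * Real.cos (β₀ p) * Real.cos (β₁ p))
          * Real.cosh (θ₀ p) * Real.sinh (θ₁ p)) ∧
    pv θ₀ p + ε * pu θ₁ p = -(ε * ε') / √(-z) *
      ((Real.sin (α₀ p) * Real.sin (α₁ p) + Q.r₃ z * Real.cos (α₀ p) * Real.cos (α₁ p))
          * Real.cosh (θ₀ p) * Real.sinh (θ₁ p)
        - (Q.r₁ z * Real.sin (β₀ p) * Real.sin (β₁ p)
            + Q.r₂ z * Real.cos (β₀ p) * Real.cos (β₁ p))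
          * Real.sinh (θ₀ p) * Real.cosh (θ₁ p))

end QuadricDeformation

end

open QuadricDeformation

/-!
A deformation is compared with the quadric through what their common first fundamental form
determines, and the confocal quadrics enter through a few algebraic identities.

*Angle equations.* In a conjugate system `α_u α_v = β_u β_v`, so `tanh θ = β_u / α_u = α_v / β_v`
and `dα`, `dβ` are `λ du`, `μ dv` rotated hyperbolically by `θ`. Their integrability gives
`λ_v = μ θ_u` and `μ_u = λ θ_v` (`IsConjugateChart.compatibility`). Differentiating
`μ² - λ² = s H` gives the remaining equations of first order, and the symmetry of the second
derivatives of `λ` the equation of second order (`IsConjugateChart.angleEquations`).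

*Normalization.* Isometric surfaces sharing a conjugate system have Codazzi equations with the same
coefficients and the same product `h₁₁ h₂₂`. Hence `(h̃₁₁² - h̄₁₁²) cos² α / (α_u² - β_u²)` depends
on `u` alone, and the analogous quotient on `v` alone
(`IsCommonConjugate.separation_deriv_eq_zero`). They have opposite constant signs, and changes of
each variable make them `s` and `-s`, which with the Gauss equation is the required normalization
(`normalization_identities`).

*Bäcklund transformation.* In the tangency configuration the differential of the tangency equation
is `T_α dα₀ + T_β dβ₀` plus the same with the points exchanged, and `T_β² - T_α² = -z H` with `H` at
the other point. The segment `x₁ - x₀` is the tangential displacement of `x₀` that carries the point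
of the quadric to the confocal point, so the tangential components of `dx₁` along `x₀` are known. By
the comparison of the metrics of `x₁`, of the quadric and of the confocal, the normal component is,
up to a sign `ε`, that of the confocal with `dα₁` and `dβ₁` exchanged
(`IsTransform.inner_normal_mul`). It is also given by the second fundamental form of `x₀`. With the
tangency equation this determines `dα₁, dβ₁` up to the sign `ε`: `(u, v)` is conjugate on the second
quadric (`IsTransform.leaf_metric`) and the components `legU`, `legV` of the configuration along
`u`, `v` are `±√(-z) λ₁`, `±√(-z) μ₁` (`IsTransform.exists_leafRelations`); this contains the
algebraic relations and the normalization of the transform, and its derivatives are the relations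
between the angles (`backlundRelations_of_leaf`). The system is conjugate on `x₁` because a
conjugate system of a quadric is conjugate on all confocal ones with the same coefficients, so that
the defect of the equation for `x₁` is normal to `x₀` and to `x₁` at once, and these normals differ
(`IsTransform.mixed`). The second fundamental form of `x₁` follows from Ivory's theorem, by which
the transformation is symmetric (`IsTransform.symm`, `IsTransform.exists_isIsothermicConjugate`).
-/

noncomputable section

namespace QuadricDeformation

/-! ### Partial derivatives in the plane -/

section Calculus

variable {E F : Type*} [NormedAddCommGroup E] [NormedSpace ℝ E]
  [NormedAddCommGroup F] [InnerProductSpace ℝ F]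
  {U : Set (ℝ × ℝ)} {p : ℝ × ℝ}

theorem contDiffOn_pu {f : ℝ × ℝ → E} (hf : ContDiffOn ℝ ∞ f U) (hU : IsOpen U) :
    ContDiffOn ℝ ∞ (pu f) U :=
  (hf.fderiv_of_isOpen hU le_rfl).clm_apply contDiffOn_const

theorem contDiffOn_pv {f : ℝ × ℝ → E} (hf : ContDiffOn ℝ ∞ f U) (hU : IsOpen U) :
    ContDiffOn ℝ ∞ (pv f) U :=
  (hf.fderiv_of_isOpen hU le_rfl).clm_apply contDiffOn_const

theorem differentiableAt_of_contDiffOn {f : ℝ × ℝ → E} (hf : ContDiffOn ℝ ∞ f U) (hU : IsOpen U)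
    (hp : p ∈ U) : DifferentiableAt ℝ f p :=
  (hf.contDiffAt (hU.mem_nhds hp)).differentiableAt (by simp)

theorem pu_congr {f g : ℝ × ℝ → E} (hU : IsOpen U) (h : ∀ q ∈ U, f q = g q) (hp : p ∈ U) :
    pu f p = pu g p := by
  have : f =ᶠ[nhds p] g := Filter.eventuallyEq_of_mem (hU.mem_nhds hp) h
  simp only [pu, this.fderiv_eq]

theorem pv_congr {f g : ℝ × ℝ → E} (hU : IsOpen U) (h : ∀ q ∈ U, f q = g q) (hp : p ∈ U) :
    pv f p = pv g p := by
  have : f =ᶠ[nhds p] g := Filter.eventuallyEq_of_mem (hU.mem_nhds hp) h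
  simp only [pv, this.fderiv_eq]

theorem pv_pu_eq_pu_pv {f : ℝ × ℝ → E} (hf : ContDiffOn ℝ ∞ f U) (hU : IsOpen U)
    (hp : p ∈ U) : pv (pu f) p = pu (pv f) p := by
  have hfp : ContDiffAt ℝ ∞ f p := hf.contDiffAt (hU.mem_nhds hp)
  have hs : IsSymmSndFDerivAt ℝ f p := hfp.isSymmSndFDerivAt
    (by simpa using (mod_cast le_top : ((2 : ℕ∞) : WithTop ℕ∞) ≤ ((⊤ : ℕ∞) : WithTop ℕ∞)))
  have hd : DifferentiableAt ℝ (fderiv ℝ f) p :=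
    differentiableAt_of_contDiffOn (hf.fderiv_of_isOpen hU le_rfl) hU hp
  have key : ∀ v w : ℝ × ℝ,
      fderiv ℝ (fun q => fderiv ℝ f q v) p w = fderiv ℝ (fderiv ℝ f) p w v := by
    intro v w
    rw [fderiv_clm_apply hd (differentiableAt_const v)]
    simp
  change fderiv ℝ (fun q => fderiv ℝ f q (1, 0)) p (0, 1) =
    fderiv ℝ (fun q => fderiv ℝ f q (0, 1)) p (1, 0)
  rw [key, key]
  exact hs _ _

/-- `f` is differentiable at `p` with partial derivatives `a` and `b`. The rules below compute both
partial derivatives of an explicit expression at once. -/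
structure HasPD (f : ℝ × ℝ → E) (a b : E) (p : ℝ × ℝ) : Prop where
  diff : DifferentiableAt ℝ f p
  u : pu f p = a
  v : pv f p = b

theorem HasPD.of_differentiableAt {f : ℝ × ℝ → E} (h : DifferentiableAt ℝ f p) :
    HasPD f (pu f p) (pv f p) p := ⟨h, rfl, rfl⟩

theorem HasPD.of_contDiffOn {f : ℝ × ℝ → E} (hf : ContDiffOn ℝ ∞ f U) (hU : IsOpen U)
    (hp : p ∈ U) : HasPD f (pu f p) (pv f p) p :=
  .of_differentiableAt (differentiableAt_of_contDiffOn hf hU hp)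

theorem HasPD.congr {f : ℝ × ℝ → E} {a b a' b' : E} (h : HasPD f a b p) (ha : a = a')
    (hb : b = b') : HasPD f a' b' p := ha ▸ hb ▸ h

theorem HasPD.const (c : E) : HasPD (fun _ => c) 0 0 p :=
  ⟨differentiableAt_const c, by simp [pu], by simp [pv]⟩

theorem HasPD.add {f g : ℝ × ℝ → E} {a b a' b' : E} (hf : HasPD f a b p) (hg : HasPD g a' b' p) :
    HasPD (fun q => f q + g q) (a + a') (b + b') p := by
  refine ⟨hf.diff.add hg.diff, ?_, ?_⟩
  · rw [← hf.u, ← hg.u]; simp [pu, fderiv_fun_add hf.diff hg.diff]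
  · rw [← hf.v, ← hg.v]; simp [pv, fderiv_fun_add hf.diff hg.diff]

theorem HasPD.neg {f : ℝ × ℝ → E} {a b : E} (hf : HasPD f a b p) :
    HasPD (fun q => - f q) (-a) (-b) p := by
  refine ⟨hf.diff.neg, ?_, ?_⟩
  · rw [← hf.u]; simp [pu, fderiv_fun_neg]
  · rw [← hf.v]; simp [pv, fderiv_fun_neg]

theorem HasPD.sub {f g : ℝ × ℝ → E} {a b a' b' : E} (hf : HasPD f a b p) (hg : HasPD g a' b' p) :
    HasPD (fun q => f q - g q) (a - a') (b - b') p := by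
  simpa only [sub_eq_add_neg] using hf.add hg.neg

theorem HasPD.smul {f : ℝ × ℝ → ℝ} {g : ℝ × ℝ → E} {a b : ℝ} {a' b' : E} (hf : HasPD f a b p)
    (hg : HasPD g a' b' p) :
    HasPD (fun q => f q • g q) (a • g p + f p • a') (b • g p + f p • b') p := by
  refine ⟨hf.diff.smul hg.diff, ?_, ?_⟩
  · rw [← hf.u, ← hg.u]; simp [pu, fderiv_fun_smul hf.diff hg.diff, add_comm]
  · rw [← hf.v, ← hg.v]; simp [pv, fderiv_fun_smul hf.diff hg.diff, add_comm]

theorem HasPD.mul {f g : ℝ × ℝ → ℝ} {a b a' b' : ℝ} (hf : HasPD f a b p)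
    (hg : HasPD g a' b' p) :
    HasPD (fun q => f q * g q) (a * g p + f p * a') (b * g p + f p * b') p := by
  simpa only [smul_eq_mul] using hf.smul hg

theorem HasPD.inner {f g : ℝ × ℝ → F} {a b a' b' : F} (hf : HasPD f a b p)
    (hg : HasPD g a' b' p) :
    HasPD (fun q => (inner ℝ (f q) (g q) : ℝ)) (inner ℝ a (g p) + inner ℝ (f p) a')
      (inner ℝ b (g p) + inner ℝ (f p) b') p := by
  refine ⟨hf.diff.inner ℝ hg.diff, ?_, ?_⟩
  · rw [← hf.u, ← hg.u]
    simp [pu, fderiv_inner_apply ℝ hf.diff hg.diff, add_comm]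
  · rw [← hf.v, ← hg.v]
    simp [pv, fderiv_inner_apply ℝ hf.diff hg.diff, add_comm]

theorem HasPD.comp {φ : ℝ → E} {φ' : E} {f : ℝ × ℝ → ℝ} {a b : ℝ} (hf : HasPD f a b p)
    (hφ : HasDerivAt φ φ' (f p)) :
    HasPD (fun q => φ (f q)) (a • φ') (b • φ') p := by
  have h := hφ.hasFDerivAt.comp p hf.diff.hasFDerivAt
  refine ⟨h.differentiableAt, ?_, ?_⟩
  · rw [← hf.u]
    change fderiv ℝ (φ ∘ f) p _ = _
    rw [h.fderiv]; simp [pu]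
  · rw [← hf.v]
    change fderiv ℝ (φ ∘ f) p _ = _
    rw [h.fderiv]; simp [pv]

theorem HasPD.sin {f : ℝ × ℝ → ℝ} {a b : ℝ} (hf : HasPD f a b p) :
    HasPD (fun q => Real.sin (f q)) (a * Real.cos (f p)) (b * Real.cos (f p)) p := by
  simpa using hf.comp (Real.hasDerivAt_sin _)

theorem HasPD.cos {f : ℝ × ℝ → ℝ} {a b : ℝ} (hf : HasPD f a b p) :
    HasPD (fun q => Real.cos (f q)) (-(a * Real.sin (f p))) (-(b * Real.sin (f p))) p := by
  simpa using hf.comp (Real.hasDerivAt_cos _)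

theorem HasPD.cosh {f : ℝ × ℝ → ℝ} {a b : ℝ} (hf : HasPD f a b p) :
    HasPD (fun q => Real.cosh (f q)) (a * Real.sinh (f p)) (b * Real.sinh (f p)) p := by
  simpa using hf.comp (Real.hasDerivAt_cosh _)

theorem HasPD.sinh {f : ℝ × ℝ → ℝ} {a b : ℝ} (hf : HasPD f a b p) :
    HasPD (fun q => Real.sinh (f q)) (a * Real.cosh (f p)) (b * Real.cosh (f p)) p := by
  simpa using hf.comp (Real.hasDerivAt_sinh _)

theorem HasPD.sq {f : ℝ × ℝ → ℝ} {a b : ℝ} (hf : HasPD f a b p) :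
    HasPD (fun q => f q ^ 2) (2 * f p * a) (2 * f p * b) p := by
  simp only [pow_two]
  exact (hf.mul hf).congr (by ring) (by ring)

theorem HasPD.inv {f : ℝ × ℝ → ℝ} {a b : ℝ} (hf : HasPD f a b p) (h0 : f p ≠ 0) :
    HasPD (fun q => (f q)⁻¹) (-(a / f p ^ 2)) (-(b / f p ^ 2)) p := by
  have := hf.comp (hasDerivAt_inv h0)
  refine this.congr ?_ ?_ <;> simp [div_eq_mul_inv]

theorem HasPD.div {f g : ℝ × ℝ → ℝ} {a b a' b' : ℝ} (hf : HasPD f a b p)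
    (hg : HasPD g a' b' p) (h0 : g p ≠ 0) :
    HasPD (fun q => f q / g q) ((a * g p - f p * a') / g p ^ 2)
      ((b * g p - f p * b') / g p ^ 2) p := by
  simp only [div_eq_mul_inv (f _)]
  refine (hf.mul (hg.inv h0)).congr ?_ ?_ <;> field_simp <;> ring

theorem HasPD.euclidean {f : ℝ × ℝ → E3} {a b : E3}
    (h : ∀ i, HasPD (fun q => f q i) (a i) (b i) p) : HasPD f a b p := by
  have hd : DifferentiableAt ℝ f p := differentiableAt_euclidean.2 fun i => (h i).diff
  have key : ∀ (i : Fin 3) (w : ℝ × ℝ), fderiv ℝ f p w i = fderiv ℝ (fun q => f q i) p w := by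
    intro i w
    have h1 := ((EuclideanSpace.proj i : E3 →L[ℝ] ℝ).hasFDerivAt (x := f p)).comp p hd.hasFDerivAt
    change _ = fderiv ℝ ((EuclideanSpace.proj i : E3 →L[ℝ] ℝ) ∘ f) p w
    rw [h1.fderiv]
    rfl
  refine ⟨hd, ?_, ?_⟩
  · ext i; rw [← (h i).u]; exact key i _
  · ext i; rw [← (h i).v]; exact key i _

/-- Two functions that agree on an open set have the same partial derivatives there. -/
theorem HasPD.unique_of_eqOn {f g : ℝ × ℝ → E} {a b a' b' : E} (hU : IsOpen U) (hp : p ∈ U)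
    (hf : HasPD f a b p) (hg : HasPD g a' b' p) (h : ∀ q ∈ U, f q = g q) : a = a' ∧ b = b' := by
  rw [← hf.u, ← hg.u, ← hf.v, ← hg.v]
  exact ⟨pu_congr hU h hp, pv_congr hU h hp⟩

/-- A continuous function on a connected set whose square is `1` is constant. -/
theorem exists_sign_of_sq_eq_one {f : ℝ × ℝ → ℝ} (hU : IsPreconnected U)
    (hf : ContinuousOn f U) (hsq : ∀ p ∈ U, f p ^ 2 = 1) :
    ∃ ε : ℝ, (ε = 1 ∨ ε = -1) ∧ ∀ p ∈ U, f p = ε := by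
  rcases hU.eq_one_or_eq_neg_one_of_sq_eq hf (fun p hp => by simpa using hsq p hp) with h | h
  · exact ⟨1, Or.inl rfl, fun p hp => by simpa using h hp⟩
  · exact ⟨-1, Or.inr rfl, fun p hp => by simpa using h hp⟩

end Calculus

/-! ### Surfaces with the same first fundamental form -/

section Surfaces

variable {U : Set (ℝ × ℝ)} {p : ℝ × ℝ} {x y N M : ℝ × ℝ → E3}

theorem eq_of_inner_frame {e f n w w' : E3} (hn : ‖n‖ = 1) (he : inner ℝ n e = 0)
    (hf : inner ℝ n f = 0) (hG : inner ℝ e e * inner ℝ f f - inner ℝ e f ^ 2 ≠ 0)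
    (h1 : inner ℝ w e = inner ℝ w' e) (h2 : inner ℝ w f = inner ℝ w' f)
    (h3 : inner ℝ w n = inner ℝ w' n) : w = w' := by
  have hn1 : inner ℝ n n = (1 : ℝ) := by rw [real_inner_self_eq_norm_sq, hn]; norm_num
  have hli : LinearIndependent ℝ ![e, f, n] := by
    rw [Fintype.linearIndependent_iff]
    intro g hg
    simp only [Fin.sum_univ_three, Matrix.cons_val_zero, Matrix.cons_val_one, Matrix.cons_val] at hg
    have hc : g 2 = 0 := by
      have := congrArg (fun w => inner ℝ n w) hg
      simpa only [inner_add_right, real_inner_smul_right, he, hf, hn1, mul_zero, zero_add, mul_one,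
        inner_zero_right] using this
    have h1 := congrArg (fun w => inner ℝ e w) hg
    have h2 := congrArg (fun w => inner ℝ f w) hg
    simp only [inner_add_right, real_inner_smul_right, hc, zero_mul, inner_zero_right, add_zero,
      real_inner_comm e f] at h1 h2
    have ha : g 0 = 0 := by
      have : g 0 * (inner ℝ e e * inner ℝ f f - inner ℝ e f ^ 2) = 0 := by
        linear_combination inner ℝ f f * h1 - inner ℝ e f * h2
      exact (mul_eq_zero.1 this).resolve_right hG
    have hb : g 1 = 0 := by
      have : g 1 * (inner ℝ e e * inner ℝ f f - inner ℝ e f ^ 2) = 0 := by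
        linear_combination inner ℝ e e * h2 - inner ℝ e f * h1
      exact (mul_eq_zero.1 this).resolve_right hG
    intro i
    fin_cases i <;> assumption
  refine InnerProductSpace.ext_inner_right_basis
    (basisOfLinearIndependentOfCardEqFinrank hli (by simp)) fun i => ?_
  fin_cases i <;> simpa

/-- The inner product, in the plane with Gram coefficients `E, F, G`, of the vectors whose products
with the basis are `(a, b)` and `(c, d)`. -/
def gramForm (E F G a b c d : ℝ) : ℝ :=
  (G * (a * c) - F * (a * d + b * c) + E * (b * d)) / (E * G - F ^ 2)

/-- An inner product in space, split along a plane and its unit normal. The tangential part only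
involves products with the basis of the plane: this is how quantities are carried from a surface to
an isometric one. -/
theorem inner_eq_frame {e f n : E3} (hn : ‖n‖ = 1) (he : inner ℝ n e = 0)
    (hf : inner ℝ n f = 0) (hG : inner ℝ e e * inner ℝ f f - inner ℝ e f ^ 2 ≠ 0) (w w' : E3) :
    inner ℝ w w' = gramForm (inner ℝ e e) (inner ℝ e f) (inner ℝ f f)
      (inner ℝ w e) (inner ℝ w f) (inner ℝ w' e) (inner ℝ w' f) +
      inner ℝ n w * inner ℝ n w' := by
  have hn1 : inner ℝ n n = (1 : ℝ) := by rw [real_inner_self_eq_norm_sq, hn]; norm_num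
  have key : w = ((inner ℝ f f * inner ℝ w e - inner ℝ e f * inner ℝ w f) /
        (inner ℝ e e * inner ℝ f f - inner ℝ e f ^ 2)) • e +
      ((inner ℝ e e * inner ℝ w f - inner ℝ e f * inner ℝ w e) /
        (inner ℝ e e * inner ℝ f f - inner ℝ e f ^ 2)) • f + inner ℝ n w • n := by
    apply eq_of_inner_frame hn he hf hG <;>
    simp only [inner_add_left, real_inner_smul_left, he, hf, hn1, real_inner_comm n e,
      real_inner_comm n f, real_inner_comm e f, real_inner_comm n w, mul_zero, add_zero, zero_add,
      mul_one] <;>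
    rw [div_mul_eq_mul_div, div_mul_eq_mul_div, ← add_div, eq_div_iff hG] <;> ring
  conv_lhs => rw [key]
  simp only [inner_add_left, real_inner_smul_left, real_inner_comm w' e, real_inner_comm w' f,
    gramForm]
  field_simp
  ring

/-- `x` and `y` are surfaces with the same first fundamental form. -/
structure SameMetric (U : Set (ℝ × ℝ)) (x y : ℝ × ℝ → E3) : Prop where
  smooth_left : ContDiffOn ℝ ∞ x U
  smooth_right : ContDiffOn ℝ ∞ y U
  uu : ∀ p ∈ U, (inner ℝ (pu x p) (pu x p) : ℝ) = inner ℝ (pu y p) (pu y p)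
  uv : ∀ p ∈ U, (inner ℝ (pu x p) (pv x p) : ℝ) = inner ℝ (pu y p) (pv y p)
  vv : ∀ p ∈ U, (inner ℝ (pv x p) (pv x p) : ℝ) = inner ℝ (pv y p) (pv y p)

/-- `x` is an immersion: the Gram determinant of `x_u, x_v` does not vanish. -/
def IsRegular (U : Set (ℝ × ℝ)) (x : ℝ × ℝ → E3) : Prop :=
  ∀ p ∈ U, (inner ℝ (pu x p) (pu x p) * inner ℝ (pv x p) (pv x p) -
    inner ℝ (pu x p) (pv x p) ^ 2 : ℝ) ≠ 0

theorem SameMetric.isRegular (h : SameMetric U x y) (hy : IsRegular U y) : IsRegular U x := by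
  intro p hp
  rw [h.uu p hp, h.uv p hp, h.vv p hp]
  exact hy p hp

section Derivatives

theorem hasPD_pu {E : Type*} [NormedAddCommGroup E] [NormedSpace ℝ E] {x : ℝ × ℝ → E}
    (hx : ContDiffOn ℝ ∞ x U) (hU : IsOpen U) (hp : p ∈ U) :
    HasPD (pu x) (pu (pu x) p) (pu (pv x) p) p :=
  (HasPD.of_contDiffOn (contDiffOn_pu hx hU) hU hp).congr rfl (pv_pu_eq_pu_pv hx hU hp)

theorem hasPD_pv {E : Type*} [NormedAddCommGroup E] [NormedSpace ℝ E] {x : ℝ × ℝ → E}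
    (hx : ContDiffOn ℝ ∞ x U) (hU : IsOpen U) (hp : p ∈ U) :
    HasPD (pv x) (pu (pv x) p) (pv (pv x) p) p :=
  HasPD.of_contDiffOn (contDiffOn_pv hx hU) hU hp

/-- The products of second with first derivatives are determined by the first fundamental form. -/
theorem SameMetric.christoffel (h : SameMetric U x y) (hU : IsOpen U) (hp : p ∈ U) :
    (inner ℝ (pu (pu x) p) (pu x p) : ℝ) = inner ℝ (pu (pu y) p) (pu y p) ∧
    (inner ℝ (pu (pu x) p) (pv x p) : ℝ) = inner ℝ (pu (pu y) p) (pv y p) ∧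
    (inner ℝ (pu (pv x) p) (pu x p) : ℝ) = inner ℝ (pu (pv y) p) (pu y p) ∧
    (inner ℝ (pu (pv x) p) (pv x p) : ℝ) = inner ℝ (pu (pv y) p) (pv y p) ∧
    (inner ℝ (pv (pv x) p) (pu x p) : ℝ) = inner ℝ (pv (pv y) p) (pu y p) ∧
    (inner ℝ (pv (pv x) p) (pv x p) : ℝ) = inner ℝ (pv (pv y) p) (pv y p) := by
  have xu := hasPD_pu h.smooth_left hU hp
  have xv := hasPD_pv h.smooth_left hU hp
  have yu := hasPD_pu h.smooth_right hU hp
  have yv := hasPD_pv h.smooth_right hU hp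
  obtain ⟨e1, e2⟩ := HasPD.unique_of_eqOn hU hp (xu.inner xu) (yu.inner yu) h.uu
  obtain ⟨e3, e4⟩ := HasPD.unique_of_eqOn hU hp (xu.inner xv) (yu.inner yv) h.uv
  obtain ⟨e5, e6⟩ := HasPD.unique_of_eqOn hU hp (xv.inner xv) (yv.inner yv) h.vv
  simp only [real_inner_comm _ (pu x p), real_inner_comm _ (pv x p), real_inner_comm _ (pu y p),
    real_inner_comm _ (pv y p)] at e1 e2 e3 e4 e5 e6 ⊢
  refine ⟨?_, ?_, ?_, ?_, ?_, ?_⟩ <;> linarith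

/-- The Weingarten relations. -/
theorem IsUnitNormal.weingarten (hN : IsUnitNormal U x N) (hx : ContDiffOn ℝ ∞ x U)
    (hU : IsOpen U) (hp : p ∈ U) :
    inner ℝ (pu N p) (pu x p) = -h₁₁ x N p ∧ inner ℝ (pu N p) (pv x p) = -h₁₂ x N p ∧
    inner ℝ (pv N p) (pu x p) = -h₁₂ x N p ∧ inner ℝ (pv N p) (pv x p) = -h₂₂ x N p ∧
    (inner ℝ (N p) (pu N p) : ℝ) = 0 ∧ (inner ℝ (N p) (pv N p) : ℝ) = 0 := by
  have xu := hasPD_pu hx hU hp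
  have xv := hasPD_pv hx hU hp
  have n := HasPD.of_contDiffOn hN.smooth hU hp
  obtain ⟨e1, e2⟩ := HasPD.unique_of_eqOn hU hp (n.inner xu) (HasPD.const 0) hN.orth_u
  obtain ⟨e3, e4⟩ := HasPD.unique_of_eqOn hU hp (n.inner xv) (HasPD.const 0) hN.orth_v
  obtain ⟨e5, e6⟩ := HasPD.unique_of_eqOn hU hp (n.inner n) (HasPD.const (1 : ℝ)) (fun q hq => by
    rw [real_inner_self_eq_norm_sq, hN.norm_eq_one q hq]; norm_num)
  rw [real_inner_comm] at e5 e6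
  simp only [h₁₁, h₁₂, h₂₂]
  refine ⟨?_, ?_, ?_, ?_, ?_, ?_⟩ <;> linarith

end Derivatives

/-- **Theorema egregium**: the determinants of the second fundamental forms of two surfaces with the
same first fundamental form agree. -/
theorem SameMetric.gauss (h : SameMetric U x y) (hU : IsOpen U) (hy : IsRegular U y)
    (hN : IsUnitNormal U x N) (hM : IsUnitNormal U y M) (hp : p ∈ U) :
    h₁₁ x N p * h₂₂ x N p - h₁₂ x N p ^ 2 = h₁₁ y M p * h₂₂ y M p - h₁₂ y M p ^ 2 := by
  have curv : ∀ {w : ℝ × ℝ → E3}, ContDiffOn ℝ ∞ w U →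
      pv (fun q => (inner ℝ (pu (pu w) q) (pv w q) : ℝ)) p -
        pu (fun q => (inner ℝ (pu (pv w) q) (pv w q) : ℝ)) p =
      inner ℝ (pu (pu w) p) (pv (pv w) p) - inner ℝ (pu (pv w) p) (pu (pv w) p) := by
    intro w hw
    have wv := hasPD_pv hw hU hp
    have wuu := HasPD.of_contDiffOn (contDiffOn_pu (contDiffOn_pu hw hU) hU) hU hp
    have wuv := HasPD.of_contDiffOn (contDiffOn_pu (contDiffOn_pv hw hU) hU) hU hp
    have e : pv (pu (pu w)) p = pu (pu (pv w)) p := by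
      rw [pv_pu_eq_pu_pv (contDiffOn_pu hw hU) hU hp]
      exact pu_congr hU (fun q hq => pv_pu_eq_pu_pv hw hU hq) hp
    rw [(wuu.inner wv).v, (wuv.inner wv).u, e]
    ring
  have e1 := curv h.smooth_left
  rw [pv_congr hU (fun q hq => (h.christoffel hU hq).2.1) hp,
    pu_congr hU (fun q hq => (h.christoffel hU hq).2.2.2.1) hp, curv h.smooth_right] at e1
  obtain ⟨c1, c2, c3, c4, c5, c6⟩ := h.christoffel hU hp
  have hx := h.isRegular hy
  have fx := fun w w' => inner_eq_frame (hN.norm_eq_one p hp) (hN.orth_u p hp) (hN.orth_v p hp)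
    (hx p hp) w w'
  have fy := fun w w' => inner_eq_frame (hM.norm_eq_one p hp) (hM.orth_u p hp) (hM.orth_v p hp)
    (hy p hp) w w'
  rw [fx (pu (pu x) p) (pv (pv x) p), fx (pu (pv x) p) (pu (pv x) p),
    fy (pu (pu y) p) (pv (pv y) p), fy (pu (pv y) p) (pu (pv y) p), c1, c2, c3, c4, c5, c6,
    h.uu p hp, h.uv p hp, h.vv p hp] at e1
  simp only [h₁₁, h₁₂, h₂₂]
  linarith

/-- In a conjugate system the mixed second derivative has the same expression in the basis of the
tangent plane for all surfaces with the same first fundamental form. -/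
theorem SameMetric.mixed (h : SameMetric U x y) (hU : IsOpen U) (hy : IsRegular U y)
    (hN : IsUnitNormal U x N) (hp : p ∈ U) (h0 : h₁₂ x N p = 0) {a b : ℝ}
    (hab : pu (pv y) p = a • pu y p + b • pv y p) :
    pu (pv x) p = a • pu x p + b • pv x p := by
  obtain ⟨c1, c2, c3, c4, c5, c6⟩ := h.christoffel hU hp
  have vu := h.uv p hp
  have n1 := hN.orth_u p hp
  have n2 := hN.orth_v p hp
  rw [h₁₂] at h0
  apply eq_of_inner_frame (hN.norm_eq_one p hp) n1 n2 (h.isRegular hy p hp)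
  · rw [c3, hab]
    simp only [inner_add_left, real_inner_smul_left, h.uu p hp, real_inner_comm (pu x p) (pv x p),
      real_inner_comm (pu y p) (pv y p), vu]
  · rw [c4, hab]
    simp only [inner_add_left, real_inner_smul_left, h.vv p hp, vu]
  · rw [real_inner_comm, h0, real_inner_comm]
    simp [inner_add_right, real_inner_smul_right, n1, n2]

/-- The Codazzi equations in a conjugate system. The last terms are Christoffel symbols, written in
a form that only involves the first fundamental form. -/
theorem IsUnitNormal.codazzi (hN : IsUnitNormal U x N) (hx : ContDiffOn ℝ ∞ x U) (hU : IsOpen U)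
    (hr : IsRegular U x) (hp : p ∈ U) (h0 : ∀ q ∈ U, h₁₂ x N q = 0) {a b : ℝ}
    (hab : pu (pv x) p = a • pu x p + b • pv x p) :
    pv (h₁₁ x N) p = a * h₁₁ x N p - h₂₂ x N p *
      gramForm (inner ℝ (pu x p) (pu x p)) (inner ℝ (pu x p) (pv x p)) (inner ℝ (pv x p) (pv x p))
        0 1 (inner ℝ (pu (pu x) p) (pu x p)) (inner ℝ (pu (pu x) p) (pv x p)) ∧
    pu (h₂₂ x N) p = b * h₂₂ x N p - h₁₁ x N p *
      gramForm (inner ℝ (pu x p) (pu x p)) (inner ℝ (pu x p) (pv x p)) (inner ℝ (pv x p) (pv x p))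
        1 0 (inner ℝ (pv (pv x) p) (pu x p)) (inner ℝ (pv (pv x) p) (pv x p)) := by
  obtain ⟨w1, w2, w3, w4, w5, w6⟩ := hN.weingarten hx hU hp
  rw [h0 p hp] at w2 w3
  have n := HasPD.of_contDiffOn hN.smooth hU hp
  have xuu := HasPD.of_contDiffOn (contDiffOn_pu (contDiffOn_pu hx hU) hU) hU hp
  have xuv := HasPD.of_contDiffOn (contDiffOn_pu (contDiffOn_pv hx hU) hU) hU hp
  have xvv := HasPD.of_contDiffOn (contDiffOn_pv (contDiffOn_pv hx hU) hU) hU hp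
  have s1 : pv (pu (pu x)) p = pu (pu (pv x)) p := by
    rw [pv_pu_eq_pu_pv (contDiffOn_pu hx hU) hU hp]
    exact pu_congr hU (fun q hq => pv_pu_eq_pu_pv hx hU hq) hp
  have s2 : pu (pv (pv x)) p = pv (pu (pv x)) p :=
    (pv_pu_eq_pu_pv (contDiffOn_pv hx hU) hU hp).symm
  obtain ⟨e1, e2⟩ := HasPD.unique_of_eqOn hU hp (n.inner xuv) (HasPD.const 0) h0
  have f := fun w w' => inner_eq_frame (hN.norm_eq_one p hp) (hN.orth_u p hp) (hN.orth_v p hp)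
    (hr p hp) w w'
  constructor
  · have : pv (h₁₁ x N) p = _ := (n.inner xuu).v
    rw [this, s1]
    rw [hab] at e1
    simp only [inner_add_right, real_inner_smul_right, w1, w2] at e1
    rw [f (pv N p) (pu (pu x) p), w3, w4, w6]
    simp only [gramForm]
    simp at e1 ⊢
    linear_combination e1
  · have : pu (h₂₂ x N) p = _ := (n.inner xvv).u
    rw [this, s2]
    rw [hab] at e2
    simp only [inner_add_right, real_inner_smul_right, w3, w4] at e2
    rw [f (pu N p) (pv (pv x) p), w1, w2, w5]
    simp only [gramForm]
    simp at e2 ⊢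
    linear_combination e2

end Surfaces

/-! ### Vectors given by their coordinates -/

theorem HasPD.congr_of_eqOn {E : Type*} [NormedAddCommGroup E] [NormedSpace ℝ E]
    {U : Set (ℝ × ℝ)} {p : ℝ × ℝ} {f g : ℝ × ℝ → E} {a b : E} (h : HasPD g a b p)
    (hU : IsOpen U) (hp : p ∈ U) (hfg : ∀ q ∈ U, f q = g q) : HasPD f a b p := by
  have e : f =ᶠ[nhds p] g := Filter.eventuallyEq_of_mem (hU.mem_nhds hp) hfg
  exact ⟨h.diff.congr_of_eventuallyEq e, by rw [← h.u]; exact pu_congr hU hfg hp,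
    by rw [← h.v]; exact pv_congr hU hfg hp⟩

theorem HasPD.vec3 {p : ℝ × ℝ} {f₁ f₂ f₃ : ℝ × ℝ → ℝ} {a₁ a₂ a₃ b₁ b₂ b₃ : ℝ}
    (h₁ : HasPD f₁ a₁ b₁ p) (h₂ : HasPD f₂ a₂ b₂ p) (h₃ : HasPD f₃ a₃ b₃ p) :
    HasPD (fun q => (!₂[f₁ q, f₂ q, f₃ q] : E3)) !₂[a₁, a₂, a₃] !₂[b₁, b₂, b₃] p := by
  apply HasPD.euclidean
  intro i
  fin_cases i
  exacts [h₁, h₂, h₃]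

theorem inner_vec3 (a b c a' b' c' : ℝ) :
    inner ℝ (!₂[a, b, c] : E3) !₂[a', b', c'] = a * a' + b * b' + c * c' := by
  simp [PiLp.inner_apply, Fin.sum_univ_three, mul_comm]

theorem smul_vec3 (t a b c : ℝ) : t • (!₂[a, b, c] : E3) = !₂[t * a, t * b, t * c] := by
  ext i; fin_cases i <;> simp

theorem add_vec3 (a b c a' b' c' : ℝ) :
    (!₂[a, b, c] : E3) + !₂[a', b', c'] = !₂[a + a', b + b', c + c'] := by
  ext i; fin_cases i <;> simp

theorem sub_vec3 (a b c a' b' c' : ℝ) :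
    (!₂[a, b, c] : E3) - !₂[a', b', c'] = !₂[a - a', b - b', c - c'] := by
  ext i; fin_cases i <;> simp

theorem hasDerivAt_vec3 {t : ℝ} {f₁ f₂ f₃ : ℝ → ℝ} {a₁ a₂ a₃ : ℝ}
    (h₁ : HasDerivAt f₁ a₁ t) (h₂ : HasDerivAt f₂ a₂ t) (h₃ : HasDerivAt f₃ a₃ t) :
    HasDerivAt (fun q => (!₂[f₁ q, f₂ q, f₃ q] : E3)) !₂[a₁, a₂, a₃] t := by
  have e : (fun q => (!₂[f₁ q, f₂ q, f₃ q] : E3)) = fun q =>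
      f₁ q • (!₂[1, 0, 0] : E3) + f₂ q • (!₂[0, 1, 0] : E3) + f₃ q • (!₂[0, 0, 1] : E3) := by
    funext q; ext i; fin_cases i <;> simp
  rw [e]
  have := ((h₁.smul_const (!₂[1, 0, 0] : E3)).add (h₂.smul_const (!₂[0, 1, 0] : E3))).add
    (h₃.smul_const (!₂[0, 0, 1] : E3))
  exact this.congr_deriv (by ext i; fin_cases i <;> simp)

theorem contDiffOn_vec3 {U : Set (ℝ × ℝ)} {f₁ f₂ f₃ : ℝ × ℝ → ℝ} (h₁ : ContDiffOn ℝ ∞ f₁ U)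
    (h₂ : ContDiffOn ℝ ∞ f₂ U) (h₃ : ContDiffOn ℝ ∞ f₃ U) :
    ContDiffOn ℝ ∞ (fun q => (!₂[f₁ q, f₂ q, f₃ q] : E3)) U := by
  rw [contDiffOn_euclidean]
  intro i
  fin_cases i
  exacts [h₁, h₂, h₃]

/-! ### The confocal hyperboloids -/

namespace OneSheetedHyperboloid

variable (Q : OneSheetedHyperboloid) {z α β : ℝ}

theorem a₁_pos : 0 < Q.a₁ := Q.a₂_pos.trans Q.a₂_lt_a₁

theorem H_pos (α β : ℝ) : 0 < Q.H α β := by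
  have h1 := Q.a₁_pos
  have h2 := Q.a₂_pos
  have h3 : 0 < -Q.a₃ := neg_pos.2 Q.a₃_neg
  have e : Q.H α β = Real.cos β ^ 2 / Q.a₁ + Real.sin β ^ 2 / Q.a₂ + Real.sin α ^ 2 / -Q.a₃ := by
    rw [H, div_neg]; ring
  rw [e]
  by_cases hs : Real.sin β = 0
  · have : 0 < Real.cos β ^ 2 := by nlinarith [Real.sin_sq_add_cos_sq β]
    positivity
  · positivity

theorem r₁_zero : Q.r₁ 0 = 1 := by simp [r₁]
theorem r₂_zero : Q.r₂ 0 = 1 := by simp [r₂]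
theorem r₃_zero : Q.r₃ 0 = 1 := by simp [r₃]

theorem r₁_sq (hz : z ≤ 0) : Q.r₁ z ^ 2 = 1 - z / Q.a₁ := by
  rw [r₁, Real.sq_sqrt]
  have : z / Q.a₁ ≤ 0 := div_nonpos_of_nonpos_of_nonneg hz Q.a₁_pos.le
  linarith

theorem r₂_sq (hz : z ≤ 0) : Q.r₂ z ^ 2 = 1 - z / Q.a₂ := by
  rw [r₂, Real.sq_sqrt]
  have : z / Q.a₂ ≤ 0 := div_nonpos_of_nonpos_of_nonneg hz Q.a₂_pos.le
  linarith

theorem r₃_sq (hz : Q.a₃ ≤ z) : Q.r₃ z ^ 2 = 1 - z / Q.a₃ := by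
  rw [r₃, Real.sq_sqrt]
  have : z / Q.a₃ ≤ 1 := (div_le_one_of_neg Q.a₃_neg).2 hz
  linarith

/-- The half axis `√a₁`. -/
def k₁ : ℝ := √Q.a₁
/-- The half axis `√a₂`. -/
def k₂ : ℝ := √Q.a₂
/-- The imaginary half axis `√(-a₃)`. -/
def k₃ : ℝ := √(-Q.a₃)

theorem k₁_pos : 0 < Q.k₁ := Real.sqrt_pos.2 Q.a₁_pos
theorem k₂_pos : 0 < Q.k₂ := Real.sqrt_pos.2 Q.a₂_pos
theorem k₃_pos : 0 < Q.k₃ := Real.sqrt_pos.2 (neg_pos.2 Q.a₃_neg)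
theorem k₁_sq : Q.k₁ ^ 2 = Q.a₁ := Real.sq_sqrt Q.a₁_pos.le
theorem k₂_sq : Q.k₂ ^ 2 = Q.a₂ := Real.sq_sqrt Q.a₂_pos.le
theorem k₃_sq : Q.k₃ ^ 2 = -Q.a₃ := Real.sq_sqrt (neg_pos.2 Q.a₃_neg).le

theorem H_eq (α β : ℝ) : Q.H α β = Real.cos β ^ 2 / Q.k₁ ^ 2 + Real.sin β ^ 2 / Q.k₂ ^ 2 +
    Real.sin α ^ 2 / Q.k₃ ^ 2 := by
  rw [H, Q.k₁_sq, Q.k₂_sq, Q.k₃_sq, div_neg]; ring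

theorem X_eq (z α β : ℝ) : Q.X z α β = !₂[Q.k₁ * Q.r₁ z * (Real.cos β / Real.cos α),
    Q.k₂ * Q.r₂ z * (Real.sin β / Real.cos α), Q.k₃ * Q.r₃ z * (Real.sin α / Real.cos α)] := by
  have e1 : √(Q.a₁ - z) = Q.k₁ * Q.r₁ z := by
    rw [k₁, r₁, ← Real.sqrt_mul Q.a₁_pos.le, mul_sub, mul_div_cancel₀ _ Q.a₁_pos.ne', mul_one]
  have e2 : √(Q.a₂ - z) = Q.k₂ * Q.r₂ z := by
    rw [k₂, r₂, ← Real.sqrt_mul Q.a₂_pos.le, mul_sub, mul_div_cancel₀ _ Q.a₂_pos.ne', mul_one]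
  have e3 : √(z - Q.a₃) = Q.k₃ * Q.r₃ z := by
    rw [k₃, r₃, ← Real.sqrt_mul (neg_pos.2 Q.a₃_neg).le, mul_sub, neg_mul,
      neg_mul, mul_div_cancel₀ _ Q.a₃_neg.ne, mul_one]
    congr 1; ring
  rw [X, e1, e2, e3, Real.tan_eq_sin_div_cos, mul_div_assoc, mul_div_assoc]

theorem Xα_eq (hc : Real.cos α ≠ 0) : Q.Xα z α β =
    !₂[Q.k₁ * Q.r₁ z * (Real.cos β * Real.sin α / Real.cos α ^ 2),
      Q.k₂ * Q.r₂ z * (Real.sin β * Real.sin α / Real.cos α ^ 2),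
      Q.k₃ * Q.r₃ z * (1 / Real.cos α ^ 2)] := by
  have hcos := Real.hasDerivAt_cos α
  have h := hasDerivAt_vec3
    (((hasDerivAt_const α (Real.cos β)).div hcos hc).const_mul (Q.k₁ * Q.r₁ z))
    (((hasDerivAt_const α (Real.sin β)).div hcos hc).const_mul (Q.k₂ * Q.r₂ z))
    (((Real.hasDerivAt_sin α).div hcos hc).const_mul (Q.k₃ * Q.r₃ z))
  have e : (fun t => Q.X z t β) = _ := funext fun t => Q.X_eq z t β
  rw [Xα, e]
  refine h.deriv.trans ?_
  have e3 : Real.cos α * Real.cos α - Real.sin α * -Real.sin α = 1 := by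
    linear_combination Real.sin_sq_add_cos_sq α
  rw [e3]
  simp

theorem Xβ_eq (z α β : ℝ) : Q.Xβ z α β =
    !₂[Q.k₁ * Q.r₁ z * (-Real.sin β / Real.cos α),
      Q.k₂ * Q.r₂ z * (Real.cos β / Real.cos α), 0] := by
  have h := hasDerivAt_vec3
    (((Real.hasDerivAt_cos β).div_const (Real.cos α)).const_mul (Q.k₁ * Q.r₁ z))
    (((Real.hasDerivAt_sin β).div_const (Real.cos α)).const_mul (Q.k₂ * Q.r₂ z))
    (hasDerivAt_const β (Q.k₃ * Q.r₃ z * (Real.sin α / Real.cos α)))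
  have e : (fun t => Q.X z α t) = _ := funext fun t => Q.X_eq z α t
  rw [Xβ, e]
  exact h.deriv

/-- `∂² x_z / ∂ β²`. -/
def Xββ (z α β : ℝ) : E3 :=
  !₂[Q.k₁ * Q.r₁ z * (-Real.cos β / Real.cos α), Q.k₂ * Q.r₂ z * (-Real.sin β / Real.cos α), 0]

/-- The normal vector is half the gradient of the equation of the quadric. -/
theorem Nhat_eq (α β : ℝ) : Q.Nhat α β = !₂[Real.cos β / Real.cos α / Q.k₁,
    Real.sin β / Real.cos α / Q.k₂, -(Real.sin α / Real.cos α) / Q.k₃] := by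
  have h1 := Q.k₁_pos.ne'
  have h2 := Q.k₂_pos.ne'
  have h3 := Q.k₃_pos.ne'
  have d1 : HasDerivAt (fun z : ℝ => √(Q.a₁ - z)) (-1 / (2 * Q.k₁)) 0 := by
    have := ((hasDerivAt_id (0 : ℝ)).const_sub Q.a₁).sqrt (by simpa using Q.a₁_pos.ne')
    simpa [k₁] using this
  have d2 : HasDerivAt (fun z : ℝ => √(Q.a₂ - z)) (-1 / (2 * Q.k₂)) 0 := by
    have := ((hasDerivAt_id (0 : ℝ)).const_sub Q.a₂).sqrt (by simpa using Q.a₂_pos.ne')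
    simpa [k₂] using this
  have d3 : HasDerivAt (fun z : ℝ => √(z - Q.a₃)) (1 / (2 * Q.k₃)) 0 := by
    have := ((hasDerivAt_id (0 : ℝ)).sub_const Q.a₃).sqrt (by simpa using Q.a₃_neg.ne)
    simpa [k₃] using this
  have h := hasDerivAt_vec3 ((d1.mul_const (Real.cos β)).div_const (Real.cos α))
    ((d2.mul_const (Real.sin β)).div_const (Real.cos α)) (d3.mul_const (Real.tan α))
  have e : deriv (fun z => Q.X z α β) 0 = _ := h.deriv
  rw [Nhat, e, smul_vec3, Real.tan_eq_sin_div_cos]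
  congr 1
  ext i
  fin_cases i <;> simp <;> field_simp

theorem inner_Nhat_Xα (hc : Real.cos α ≠ 0) : inner ℝ (Q.Nhat α β) (Q.Xα 0 α β) = (0 : ℝ) := by
  have h1 := Q.k₁_pos.ne'
  have h2 := Q.k₂_pos.ne'
  have h3 := Q.k₃_pos.ne'
  rw [Q.Nhat_eq, Q.Xα_eq hc, inner_vec3, r₁_zero, r₂_zero, r₃_zero]
  field_simp
  linear_combination Real.sin α * Real.sin_sq_add_cos_sq β

theorem inner_Nhat_Xβ : inner ℝ (Q.Nhat α β) (Q.Xβ 0 α β) = (0 : ℝ) := by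
  have h1 := Q.k₁_pos.ne'
  have h2 := Q.k₂_pos.ne'
  rw [Q.Nhat_eq, Q.Xβ_eq, inner_vec3, r₁_zero, r₂_zero]
  field_simp
  ring

theorem inner_Nhat_Xββ (hc : Real.cos α ≠ 0) :
    inner ℝ (Q.Nhat α β) (Q.Xββ 0 α β) = -(1 / Real.cos α ^ 2) := by
  have h1 := Q.k₁_pos.ne'
  have h2 := Q.k₂_pos.ne'
  rw [Q.Nhat_eq, Xββ, inner_vec3, r₁_zero, r₂_zero]
  field_simp
  linear_combination -Real.sin_sq_add_cos_sq β

theorem norm_Nhat (hc : 0 < Real.cos α) : ‖Q.Nhat α β‖ = √(Q.H α β) / Real.cos α := by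
  have h1 := Q.k₁_pos.ne'
  have h2 := Q.k₂_pos.ne'
  have h3 := Q.k₃_pos.ne'
  have e : inner ℝ (Q.Nhat α β) (Q.Nhat α β) = Q.H α β / Real.cos α ^ 2 := by
    rw [Q.Nhat_eq, inner_vec3, H_eq]
    field_simp
  rw [norm_eq_sqrt_real_inner, e, Real.sqrt_div (Q.H_pos α β).le, Real.sqrt_sq hc.le]

theorem N₀_eq (hc : 0 < Real.cos α) :
    Q.N₀ α β = (Real.cos α / √(Q.H α β)) • Q.Nhat α β := by
  rw [N₀, Q.norm_Nhat hc, inv_div]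

theorem norm_N₀ (hc : 0 < Real.cos α) : ‖Q.N₀ α β‖ = 1 := by
  have hH := Real.sqrt_pos.2 (Q.H_pos α β)
  have : ‖Q.Nhat α β‖ ≠ 0 := by
    rw [Q.norm_Nhat hc]; positivity
  rw [N₀, norm_smul, norm_inv, norm_norm, inv_mul_cancel₀ this]

/-- The parametrization of the hyperboloid is an immersion. -/
theorem gram_pos (hc : 0 < Real.cos α) :
    0 < inner ℝ (Q.Xα 0 α β) (Q.Xα 0 α β) * inner ℝ (Q.Xβ 0 α β) (Q.Xβ 0 α β) -
      inner ℝ (Q.Xα 0 α β) (Q.Xβ 0 α β) ^ 2 := by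
  have h1 := Q.k₁_pos
  have h2 := Q.k₂_pos
  have h3 := Q.k₃_pos
  have e : inner ℝ (Q.Xα 0 α β) (Q.Xα 0 α β) * inner ℝ (Q.Xβ 0 α β) (Q.Xβ 0 α β) -
      inner ℝ (Q.Xα 0 α β) (Q.Xβ 0 α β) ^ 2 =
      ((Q.k₂ * Q.k₃) ^ 2 * Real.cos β ^ 2 + (Q.k₁ * Q.k₃) ^ 2 * Real.sin β ^ 2 +
        (Q.k₁ * Q.k₂ * Real.sin α) ^ 2) / Real.cos α ^ 6 := by
    rw [Q.Xα_eq hc.ne', Q.Xβ_eq, inner_vec3, inner_vec3, inner_vec3, r₁_zero, r₂_zero, r₃_zero]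
    field_simp
    have := Real.sin_sq_add_cos_sq β
    linear_combination (Q.k₁ * Q.k₂ * Real.sin α) ^ 2 *
      (Real.sin β ^ 2 + Real.cos β ^ 2 + 1) * this
  rw [e]
  apply div_pos _ (by positivity)
  by_cases hs : Real.sin β = 0
  · have : 0 < Real.cos β ^ 2 := by nlinarith [Real.sin_sq_add_cos_sq β]
    positivity
  · positivity

theorem Hα_eq (α β : ℝ) : Q.Hα α β = -(2 * Real.sin α * Real.cos α) / Q.a₃ := by
  have h := (((Real.hasDerivAt_sin α).pow 2).div_const Q.a₃).const_sub
    (Real.cos β ^ 2 / Q.a₁ + Real.sin β ^ 2 / Q.a₂)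
  have e : deriv (fun t => Q.H t β) α = _ := h.deriv
  rw [Hα, e]
  simp [neg_div]

theorem Hβ_eq (α β : ℝ) :
    Q.Hβ α β = -(2 * Real.sin β * Real.cos β) / Q.a₁ + 2 * Real.sin β * Real.cos β / Q.a₂ := by
  have h := ((((Real.hasDerivAt_cos β).pow 2).div_const Q.a₁).add
    (((Real.hasDerivAt_sin β).pow 2).div_const Q.a₂)).sub_const (Real.sin α ^ 2 / Q.a₃)
  have e : deriv (fun t => Q.H α t) β = _ := h.deriv
  rw [Hβ, e]
  simp
  ring

theorem hasDerivAt_Hα (α β : ℝ) : HasDerivAt (fun t => Q.Hα t β) (Q.Hαα α β) α := by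
  have e : (fun t => Q.Hα t β) = fun t => -(2 * Real.sin t * Real.cos t) / Q.a₃ :=
    funext fun t => Q.Hα_eq t β
  rw [Hαα, hasDerivAt_deriv_iff, e]
  fun_prop

theorem hasDerivAt_Hβ (α β : ℝ) : HasDerivAt (fun t => Q.Hβ α t) (Q.Hββ α β) β := by
  have e : (fun t => Q.Hβ α t) = fun t => -(2 * Real.sin t * Real.cos t) / Q.a₁ +
      2 * Real.sin t * Real.cos t / Q.a₂ := funext fun t => Q.Hβ_eq α t
  rw [Hββ, hasDerivAt_deriv_iff, e]
  fun_prop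

end OneSheetedHyperboloid

/-! ### The hyperboloids referred to the coordinates `(u, v)` -/

/-- Smooth functions `α, β` on `U` with values in the chart of the hyperboloid. -/
structure IsChart (U : Set (ℝ × ℝ)) (α β : ℝ × ℝ → ℝ) : Prop where
  smooth_α : ContDiffOn ℝ ∞ α U
  smooth_β : ContDiffOn ℝ ∞ β U
  cos_pos : ∀ p ∈ U, 0 < Real.cos (α p)

section Chart

variable {Q : OneSheetedHyperboloid} {U : Set (ℝ × ℝ)} {p : ℝ × ℝ} {α β : ℝ × ℝ → ℝ}
  {x : ℝ × ℝ → E3} {z : ℝ}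

theorem IsDeformation.isChart (h : IsDeformation Q U α β x) : IsChart U α β :=
  ⟨h.smooth_α, h.smooth_β, fun p hp => Real.cos_pos_of_mem_Ioo (h.chart p hp)⟩

theorem IsChart.hasPD_α (h : IsChart U α β) (hU : IsOpen U) (hp : p ∈ U) :
    HasPD α (pu α p) (pv α p) p := HasPD.of_contDiffOn h.smooth_α hU hp

theorem IsChart.hasPD_β (h : IsChart U α β) (hU : IsOpen U) (hp : p ∈ U) :
    HasPD β (pu β p) (pv β p) p := HasPD.of_contDiffOn h.smooth_β hU hp

theorem IsChart.hasPD_H (h : IsChart U α β) (hU : IsOpen U) (hp : p ∈ U) :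
    HasPD (fun q => Q.H (α q) (β q))
      (Q.Hα (α p) (β p) * pu α p + Q.Hβ (α p) (β p) * pu β p)
      (Q.Hα (α p) (β p) * pv α p + Q.Hβ (α p) (β p) * pv β p) p := by
  have hα := h.hasPD_α hU hp
  have hβ := h.hasPD_β hU hp
  have := ((hβ.cos.sq.mul (HasPD.const Q.a₁⁻¹)).add (hβ.sin.sq.mul (HasPD.const Q.a₂⁻¹))).sub
    (hα.sin.sq.mul (HasPD.const Q.a₃⁻¹))
  simp only [OneSheetedHyperboloid.H, Q.Hα_eq, Q.Hβ_eq, div_eq_mul_inv]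
  exact this.congr (by ring) (by ring)

theorem IsChart.hasPD_Hα (h : IsChart U α β) (hU : IsOpen U) (hp : p ∈ U) :
    HasPD (fun q => Q.Hα (α q) (β q)) (Q.Hαα (α p) (β p) * pu α p)
      (Q.Hαα (α p) (β p) * pv α p) p := by
  have e : (fun q => Q.Hα (α q) (β q)) = fun q => Q.Hα (α q) (β p) := by
    -- `H` is a function of `α` plus a function of `β`
    funext q; simp only [Q.Hα_eq]
  rw [e]
  exact ((h.hasPD_α hU hp).comp (Q.hasDerivAt_Hα (α p) (β p))).congr (mul_comm _ _) (mul_comm _ _)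

theorem IsChart.hasPD_Hβ (h : IsChart U α β) (hU : IsOpen U) (hp : p ∈ U) :
    HasPD (fun q => Q.Hβ (α q) (β q)) (Q.Hββ (α p) (β p) * pu β p)
      (Q.Hββ (α p) (β p) * pv β p) p := by
  have e : (fun q => Q.Hβ (α q) (β q)) = fun q => Q.Hβ (α p) (β q) := by
    funext q; simp only [Q.Hβ_eq]
  rw [e]
  exact ((h.hasPD_β hU hp).comp (Q.hasDerivAt_Hβ (α p) (β p))).congr (mul_comm _ _) (mul_comm _ _)

theorem IsChart.contDiffOn_X (h : IsChart U α β) :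
    ContDiffOn ℝ ∞ (fun q => Q.X z (α q) (β q)) U := by
  have hc : ∀ q ∈ U, Real.cos (α q) ≠ 0 := fun q hq => (h.cos_pos q hq).ne'
  have cα := h.smooth_α.cos
  have sα := h.smooth_α.sin
  have cβ := h.smooth_β.cos
  have sβ := h.smooth_β.sin
  simp only [Q.X_eq]
  exact contDiffOn_vec3 (contDiffOn_const.mul (cβ.div cα hc)) (contDiffOn_const.mul (sβ.div cα hc))
    (contDiffOn_const.mul (sα.div cα hc))

theorem IsChart.contDiffOn_Nhat (h : IsChart U α β) :
    ContDiffOn ℝ ∞ (fun q => Q.Nhat (α q) (β q)) U := by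
  have hc : ∀ q ∈ U, Real.cos (α q) ≠ 0 := fun q hq => (h.cos_pos q hq).ne'
  have cα := h.smooth_α.cos
  have sα := h.smooth_α.sin
  have cβ := h.smooth_β.cos
  have sβ := h.smooth_β.sin
  simp only [Q.Nhat_eq]
  exact contDiffOn_vec3 ((cβ.div cα hc).div_const _) ((sβ.div cα hc).div_const _)
    ((sα.div cα hc).neg.div_const _)

theorem IsChart.hasPD_X (h : IsChart U α β) (hU : IsOpen U) (hp : p ∈ U) :
    HasPD (fun q => Q.X z (α q) (β q))
      (pu α p • Q.Xα z (α p) (β p) + pu β p • Q.Xβ z (α p) (β p))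
      (pv α p • Q.Xα z (α p) (β p) + pv β p • Q.Xβ z (α p) (β p)) p := by
  have hα := h.hasPD_α hU hp
  have hβ := h.hasPD_β hU hp
  have hc : Real.cos (α p) ≠ 0 := (h.cos_pos p hp).ne'
  simp only [Q.X_eq, Q.Xα_eq hc, Q.Xβ_eq]
  refine (HasPD.vec3 ((HasPD.const (Q.k₁ * Q.r₁ z)).mul (hβ.cos.div hα.cos hc))
    ((HasPD.const (Q.k₂ * Q.r₂ z)).mul (hβ.sin.div hα.cos hc))
    ((HasPD.const (Q.k₃ * Q.r₃ z)).mul (hα.sin.div hα.cos hc))).congr ?_ ?_ <;>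
  · simp only [smul_vec3, add_vec3]
    congr 1
    have e3 := Real.sin_sq_add_cos_sq (α p)
    ext i
    fin_cases i <;> simp <;> field_simp <;> first
      | ring1
      | linear_combination (Q.k₃ * Q.r₃ z * pu α p) * e3
      | linear_combination (Q.k₃ * Q.r₃ z * pv α p) * e3

theorem IsChart.hasPD_Xα (h : IsChart U α β) (hU : IsOpen U) (hp : p ∈ U) :
    HasPD (fun q => Q.Xα z (α q) (β q))
      (pu α p • ((2 * Real.tan (α p)) • Q.Xα z (α p) (β p) - Q.Xββ z (α p) (β p)) +
        pu β p • (Real.tan (α p) • Q.Xβ z (α p) (β p)))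
      (pv α p • ((2 * Real.tan (α p)) • Q.Xα z (α p) (β p) - Q.Xββ z (α p) (β p)) +
        pv β p • (Real.tan (α p) • Q.Xβ z (α p) (β p))) p := by
  have hα := h.hasPD_α hU hp
  have hβ := h.hasPD_β hU hp
  have hc : Real.cos (α p) ≠ 0 := (h.cos_pos p hp).ne'
  have hc2 : Real.cos (α p) ^ 2 ≠ 0 := pow_ne_zero 2 hc
  refine HasPD.congr_of_eqOn ?_ hU hp fun q hq => Q.Xα_eq (h.cos_pos q hq).ne'
  refine (HasPD.vec3 ((HasPD.const (Q.k₁ * Q.r₁ z)).mul ((hβ.cos.mul hα.sin).div hα.cos.sq hc2))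
    ((HasPD.const (Q.k₂ * Q.r₂ z)).mul ((hβ.sin.mul hα.sin).div hα.cos.sq hc2))
    ((HasPD.const (Q.k₃ * Q.r₃ z)).mul ((HasPD.const 1).div hα.cos.sq hc2))).congr ?_ ?_ <;>
  · simp only [Q.Xα_eq hc, Q.Xβ_eq, OneSheetedHyperboloid.Xββ, smul_vec3, add_vec3, sub_vec3,
      Real.tan_eq_sin_div_cos]
    congr 1
    ext i
    fin_cases i <;> simp <;> field_simp <;> ring

theorem IsChart.hasPD_Xβ (h : IsChart U α β) (hU : IsOpen U) (hp : p ∈ U) :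
    HasPD (fun q => Q.Xβ z (α q) (β q))
      (pu α p • (Real.tan (α p) • Q.Xβ z (α p) (β p)) + pu β p • Q.Xββ z (α p) (β p))
      (pv α p • (Real.tan (α p) • Q.Xβ z (α p) (β p)) + pv β p • Q.Xββ z (α p) (β p)) p := by
  have hα := h.hasPD_α hU hp
  have hβ := h.hasPD_β hU hp
  have hc : Real.cos (α p) ≠ 0 := (h.cos_pos p hp).ne'
  simp only [Q.Xβ_eq]
  refine (HasPD.vec3 ((HasPD.const (Q.k₁ * Q.r₁ z)).mul (hβ.sin.neg.div hα.cos hc))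
    ((HasPD.const (Q.k₂ * Q.r₂ z)).mul (hβ.cos.div hα.cos hc))
    (HasPD.const 0)).congr ?_ ?_ <;>
  · simp only [OneSheetedHyperboloid.Xββ, smul_vec3, add_vec3, Real.tan_eq_sin_div_cos]
    congr 1
    ext i
    fin_cases i <;> simp <;> field_simp <;> ring

end Chart

/-! ### Conjugate systems of the hyperboloids -/

section ChartGeometry

variable {Q : OneSheetedHyperboloid} {U : Set (ℝ × ℝ)} {p : ℝ × ℝ} {α β : ℝ × ℝ → ℝ}
  {x N : ℝ × ℝ → E3} {z : ℝ}

theorem IsDeformation.sameMetric (h : IsDeformation Q U α β x) :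
    SameMetric U x (onQuadric Q α β) :=
  ⟨h.smooth_x, h.isChart.contDiffOn_X, h.metric_uu, h.metric_uv, h.metric_vv⟩

theorem IsChart.isRegular (h : IsChart U α β) (hU : IsOpen U) (hj : ∀ p ∈ U, jac α β p ≠ 0) :
    IsRegular U (onQuadric Q α β) := by
  intro p hp
  have e := h.hasPD_X (Q := Q) (z := 0) hU hp
  have g := Q.gram_pos (β := β p) (h.cos_pos p hp)
  have eu : pu (onQuadric Q α β) p = _ := e.u
  have ev : pv (onQuadric Q α β) p = _ := e.v
  have key := mul_ne_zero (pow_ne_zero 2 (hj p hp)) g.ne'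
  rw [eu, ev]
  simp only [inner_add_left, inner_add_right, real_inner_smul_left, real_inner_smul_right,
    real_inner_comm (Q.Xα 0 (α p) (β p)) (Q.Xβ 0 (α p) (β p))]
  intro h0
  apply key
  rw [jac]
  linear_combination h0

theorem IsChart.isUnitNormal (h : IsChart U α β) (hU : IsOpen U) :
    IsUnitNormal U (onQuadric Q α β) (quadricNormal Q α β) where
  smooth := by
    have hH : ContDiffOn ℝ ∞ (fun q => Q.H (α q) (β q)) U := by
      unfold OneSheetedHyperboloid.H
      exact (((h.smooth_β.cos.pow 2).div_const _).add ((h.smooth_β.sin.pow 2).div_const _)).sub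
        ((h.smooth_α.sin.pow 2).div_const _)
    have hs : ContDiffOn ℝ ∞ (fun q => √(Q.H (α q) (β q))) U :=
      hH.sqrt fun q _ => (Q.H_pos _ _).ne'
    refine ((h.smooth_α.cos.div hs fun q _ => (Real.sqrt_pos.2 (Q.H_pos _ _)).ne').smul
      (h.contDiffOn_Nhat (Q := Q))).congr fun q hq => ?_
    exact Q.N₀_eq (h.cos_pos q hq)
  norm_eq_one p hp := Q.norm_N₀ (h.cos_pos p hp)
  orth_u p hp := by
    have eu : pu (onQuadric Q α β) p = _ := (h.hasPD_X (Q := Q) (z := 0) hU hp).u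
    rw [eu, quadricNormal, Q.N₀_eq (h.cos_pos p hp)]
    simp only [inner_add_right, real_inner_smul_left, real_inner_smul_right,
      Q.inner_Nhat_Xα (h.cos_pos p hp).ne', Q.inner_Nhat_Xβ]
    ring
  orth_v p hp := by
    have ev : pv (onQuadric Q α β) p = _ := (h.hasPD_X (Q := Q) (z := 0) hU hp).v
    rw [ev, quadricNormal, Q.N₀_eq (h.cos_pos p hp)]
    simp only [inner_add_right, real_inner_smul_left, real_inner_smul_right,
      Q.inner_Nhat_Xα (h.cos_pos p hp).ne', Q.inner_Nhat_Xβ]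
    ring

/-- Derivatives of the combination `f X_α + g X_β`, from `X_αα + X_ββ = 2 tan α X_α` and
`X_αβ = tan α X_β`. -/
theorem IsChart.hasPD_comb (h : IsChart U α β) (hU : IsOpen U) (hp : p ∈ U) {f g : ℝ × ℝ → ℝ}
    (hf : ContDiffOn ℝ ∞ f U) (hg : ContDiffOn ℝ ∞ g U) :
    HasPD (fun q => f q • Q.Xα z (α q) (β q) + g q • Q.Xβ z (α q) (β q))
      ((pu f p + 2 * Real.tan (α p) * (f p * pu α p)) • Q.Xα z (α p) (β p) +
        (pu g p + Real.tan (α p) * (f p * pu β p + g p * pu α p)) • Q.Xβ z (α p) (β p) +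
        (g p * pu β p - f p * pu α p) • Q.Xββ z (α p) (β p))
      ((pv f p + 2 * Real.tan (α p) * (f p * pv α p)) • Q.Xα z (α p) (β p) +
        (pv g p + Real.tan (α p) * (f p * pv β p + g p * pv α p)) • Q.Xβ z (α p) (β p) +
        (g p * pv β p - f p * pv α p) • Q.Xββ z (α p) (β p)) p := by
  refine (((HasPD.of_contDiffOn hf hU hp).smul (h.hasPD_Xα hU hp)).add
    ((HasPD.of_contDiffOn hg hU hp).smul (h.hasPD_Xβ hU hp))).congr ?_ ?_ <;> module

theorem IsChart.hasPD_pu_X (h : IsChart U α β) (hU : IsOpen U) (hp : p ∈ U) :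
    HasPD (pu fun q => Q.X z (α q) (β q))
      ((pu (pu α) p + 2 * Real.tan (α p) * (pu α p * pu α p)) • Q.Xα z (α p) (β p) +
        (pu (pu β) p + Real.tan (α p) * (pu α p * pu β p + pu β p * pu α p)) •
          Q.Xβ z (α p) (β p) +
        (pu β p * pu β p - pu α p * pu α p) • Q.Xββ z (α p) (β p))
      ((pv (pu α) p + 2 * Real.tan (α p) * (pu α p * pv α p)) • Q.Xα z (α p) (β p) +
        (pv (pu β) p + Real.tan (α p) * (pu α p * pv β p + pu β p * pv α p)) •
          Q.Xβ z (α p) (β p) +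
        (pu β p * pv β p - pu α p * pv α p) • Q.Xββ z (α p) (β p)) p :=
  (h.hasPD_comb hU hp (contDiffOn_pu h.smooth_α hU) (contDiffOn_pu h.smooth_β hU)).congr_of_eqOn
    hU hp fun _ hq => (h.hasPD_X hU hq).u

theorem IsChart.hasPD_pv_X (h : IsChart U α β) (hU : IsOpen U) (hp : p ∈ U) :
    HasPD (pv fun q => Q.X z (α q) (β q))
      ((pu (pv α) p + 2 * Real.tan (α p) * (pv α p * pu α p)) • Q.Xα z (α p) (β p) +
        (pu (pv β) p + Real.tan (α p) * (pv α p * pu β p + pv β p * pu α p)) •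
          Q.Xβ z (α p) (β p) +
        (pv β p * pu β p - pv α p * pu α p) • Q.Xββ z (α p) (β p))
      ((pv (pv α) p + 2 * Real.tan (α p) * (pv α p * pv α p)) • Q.Xα z (α p) (β p) +
        (pv (pv β) p + Real.tan (α p) * (pv α p * pv β p + pv β p * pv α p)) •
          Q.Xβ z (α p) (β p) +
        (pv β p * pv β p - pv α p * pv α p) • Q.Xββ z (α p) (β p)) p :=
  (h.hasPD_comb hU hp (contDiffOn_pv h.smooth_α hU) (contDiffOn_pv h.smooth_β hU)).congr_of_eqOn
    hU hp fun _ hq => (h.hasPD_X hU hq).v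

theorem inner_N₀_comb {a b : ℝ} (hc : 0 < Real.cos a) (f g k : ℝ) :
    inner ℝ (Q.N₀ a b) (f • Q.Xα 0 a b + g • Q.Xβ 0 a b + k • Q.Xββ 0 a b) =
      -(k / (Real.cos a * √(Q.H a b))) := by
  have hH := (Real.sqrt_pos.2 (Q.H_pos a b)).ne'
  rw [Q.N₀_eq hc]
  simp only [inner_add_right, real_inner_smul_left, real_inner_smul_right,
    Q.inner_Nhat_Xα hc.ne', Q.inner_Nhat_Xβ, Q.inner_Nhat_Xββ hc.ne']
  have := hc.ne'
  field_simp
  ring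

/-- The second fundamental form of the hyperboloid is `(dα² - dβ²) / (cos α √H)`. -/
theorem IsChart.second_form (h : IsChart U α β) (hU : IsOpen U) (hp : p ∈ U) :
    h₁₁ (onQuadric Q α β) (quadricNormal Q α β) p =
      (pu α p ^ 2 - pu β p ^ 2) / (Real.cos (α p) * √(Q.H (α p) (β p))) ∧
    h₁₂ (onQuadric Q α β) (quadricNormal Q α β) p =
      (pu α p * pv α p - pu β p * pv β p) / (Real.cos (α p) * √(Q.H (α p) (β p))) ∧
    h₂₂ (onQuadric Q α β) (quadricNormal Q α β) p =
      -((pv β p ^ 2 - pv α p ^ 2) / (Real.cos (α p) * √(Q.H (α p) (β p)))) := by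
  have e1 : pu (pu (onQuadric Q α β)) p = _ := (h.hasPD_pu_X (Q := Q) (z := 0) hU hp).u
  have e2 : pu (pv (onQuadric Q α β)) p = _ := (h.hasPD_pv_X (Q := Q) (z := 0) hU hp).u
  have e3 : pv (pv (onQuadric Q α β)) p = _ := (h.hasPD_pv_X (Q := Q) (z := 0) hU hp).v
  simp only [h₁₁, h₁₂, h₂₂, e1, e2, e3, quadricNormal, inner_N₀_comb (h.cos_pos p hp)]
  refine ⟨?_, ?_, ?_⟩ <;> ring

/-- The coefficient of `x_u` in the mixed derivative `x_uv`, for a conjugate system of the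
hyperboloid. It does not depend on the semiaxes. -/
def mixedU (α β : ℝ × ℝ → ℝ) (p : ℝ × ℝ) : ℝ :=
  ((pu (pv α) p + 2 * Real.tan (α p) * (pv α p * pu α p)) * pv β p -
    (pu (pv β) p + Real.tan (α p) * (pv α p * pu β p + pv β p * pu α p)) * pv α p) / jac α β p

/-- The coefficient of `x_v` in the mixed derivative `x_uv`, for a conjugate system of the
hyperboloid. -/
def mixedV (α β : ℝ × ℝ → ℝ) (p : ℝ × ℝ) : ℝ :=
  ((pu (pv β) p + Real.tan (α p) * (pv α p * pu β p + pv β p * pu α p)) * pu α p -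
    (pu (pv α) p + 2 * Real.tan (α p) * (pv α p * pu α p)) * pu β p) / jac α β p

/-- A conjugate system of one confocal hyperboloid is conjugate on all of them, with the same
coefficients: `x_uv` is the same combination of `x_u` and `x_v` for every `z`. -/
theorem IsChart.mixed_X (h : IsChart U α β) (hU : IsOpen U) (hp : p ∈ U) (hj : jac α β p ≠ 0)
    (hc : pu α p * pv α p = pu β p * pv β p) :
    pu (pv fun q => Q.X z (α q) (β q)) p = mixedU α β p • pu (fun q => Q.X z (α q) (β q)) p +
      mixedV α β p • pv (fun q => Q.X z (α q) (β q)) p := by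
  have e := h.hasPD_X (Q := Q) (z := z) hU hp
  rw [(h.hasPD_pv_X hU hp).u, e.u, e.v]
  have h0 : pv β p * pu β p - pv α p * pu α p = 0 := by linear_combination -hc
  rw [h0, zero_smul, add_zero]
  simp only [smul_add, smul_smul]
  set A := pu (pv α) p + 2 * Real.tan (α p) * (pv α p * pu α p) with hA
  set B := pu (pv β) p + Real.tan (α p) * (pv α p * pu β p + pv β p * pu α p) with hB
  have a1 : A = mixedU α β p * pu α p + mixedV α β p * pv α p := by
    rw [mixedU, mixedV, ← hA, ← hB]
    field_simp
    rw [jac]; ring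
  have b1 : B = mixedU α β p * pu β p + mixedV α β p * pv β p := by
    rw [mixedU, mixedV, ← hA, ← hB]
    field_simp
    rw [jac]; ring
  rw [a1, b1]
  module

end ChartGeometry

/-! ### The hyperbolic angle of a conjugate system -/

/-- `(u, v)` is a conjugate system of the hyperboloid, `u` being the coordinate along which
`dα² - dβ²` is positive. -/
structure IsConjugateChart (U : Set (ℝ × ℝ)) (α β : ℝ × ℝ → ℝ) : Prop extends IsChart U α β where
  jac_ne_zero : ∀ p ∈ U, jac α β p ≠ 0
  conj : ∀ p ∈ U, pu α p * pv α p = pu β p * pv β p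
  pos : ∀ p ∈ U, 0 < pu α p ^ 2 - pu β p ^ 2

theorem IsCommonConjugate.isConjugateChart {Q : OneSheetedHyperboloid} {U : Set (ℝ × ℝ)}
    {α β : ℝ × ℝ → ℝ} {x N : ℝ × ℝ → E3} (h : IsCommonConjugate Q U α β x N) (hU : IsOpen U) :
    IsConjugateChart U α β where
  toIsChart := h.deformation.isChart
  jac_ne_zero := h.deformation.jac_ne_zero
  pos := h.pos
  conj p hp := by
    have h0 := h.conj_quadric p hp
    have hc := h.deformation.isChart.cos_pos p hp
    have hH := Real.sqrt_pos.2 (Q.H_pos (α p) (β p))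
    rw [(h.deformation.isChart.second_form hU hp).2.1, div_eq_zero_iff] at h0
    rcases h0 with h0 | h0
    · linarith
    · exact absurd h0 (by positivity)

section Angle

variable {U : Set (ℝ × ℝ)} {p : ℝ × ℝ} {α β : ℝ × ℝ → ℝ}

theorem sign_mul_sqrt {a t : ℝ} : Real.sign a * √(a ^ 2 * t) = a * √t := by
  rw [Real.sqrt_mul (sq_nonneg a), Real.sqrt_sq_eq_abs, ← mul_assoc]
  congr 1
  rcases lt_trichotomy a 0 with h | h | h
  · rw [Real.sign_of_neg h, abs_of_neg h]; ring
  · simp [h]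
  · rw [Real.sign_of_pos h, abs_of_pos h]; ring

namespace IsConjugateChart

variable (h : IsConjugateChart U α β)
include h

theorem pu_α_ne_zero (hp : p ∈ U) : pu α p ≠ 0 := by
  intro h0
  have := h.pos p hp
  rw [h0] at this
  nlinarith [sq_nonneg (pu β p)]

theorem pv_β_ne_zero (hp : p ∈ U) : pv β p ≠ 0 := by
  intro h0
  have h1 := h.conj p hp
  rw [h0, mul_zero] at h1
  have h2 := (mul_eq_zero.1 h1).resolve_left (h.pu_α_ne_zero hp)
  exact h.jac_ne_zero p hp (by rw [jac, h0, h2]; ring)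

theorem slope_sq_lt_one (hp : p ∈ U) : (pu β p / pu α p) ^ 2 < 1 := by
  have h0 := h.pu_α_ne_zero hp
  rw [div_pow, div_lt_one (by positivity)]
  linarith [h.pos p hp]

theorem slope_mem (hp : p ∈ U) : pu β p / pu α p ∈ Set.Ioo (-1 : ℝ) 1 :=
  Set.mem_Ioo.2 (abs_lt.1 ((sq_lt_one_iff_abs_lt_one _).1 (h.slope_sq_lt_one hp)))

/-- The quotient `tanh θ` is also `α_v / β_v`, by conjugacy. -/
theorem slope_eq (hp : p ∈ U) : pv α p / pv β p = pu β p / pu α p := by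
  rw [div_eq_div_iff (h.pv_β_ne_zero hp) (h.pu_α_ne_zero hp)]
  linear_combination h.conj p hp

theorem lam_eq (hp : p ∈ U) : lam α β p = pu α p * √(1 - (pu β p / pu α p) ^ 2) := by
  have h0 := h.pu_α_ne_zero hp
  have e : pu α p ^ 2 - pu β p ^ 2 = pu α p ^ 2 * (1 - (pu β p / pu α p) ^ 2) := by field_simp
  rw [lam, e, sign_mul_sqrt]

theorem mu_eq (hp : p ∈ U) : mu α β p = pv β p * √(1 - (pu β p / pu α p) ^ 2) := by
  have h0 := h.pv_β_ne_zero hp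
  have e : pv β p ^ 2 - pv α p ^ 2 = pv β p ^ 2 * (1 - (pv α p / pv β p) ^ 2) := by field_simp
  rw [mu, e, sign_mul_sqrt, h.slope_eq hp]

theorem sqrt_pos (hp : p ∈ U) : 0 < √(1 - (pu β p / pu α p) ^ 2) :=
  Real.sqrt_pos.2 (by linarith [h.slope_sq_lt_one hp])

theorem pu_α_eq (hp : p ∈ U) : pu α p = Real.cosh (theta α β p) * lam α β p := by
  rw [theta, Real.cosh_artanh (h.slope_mem hp), h.lam_eq hp]
  have := (h.sqrt_pos hp).ne'
  generalize √(1 - (pu β p / pu α p) ^ 2) = r at this ⊢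
  field_simp

theorem pu_β_eq (hp : p ∈ U) : pu β p = Real.sinh (theta α β p) * lam α β p := by
  rw [theta, Real.sinh_artanh (h.slope_mem hp), h.lam_eq hp]
  have := (h.sqrt_pos hp).ne'
  generalize √(1 - (pu β p / pu α p) ^ 2) = r at this ⊢
  have h0 := h.pu_α_ne_zero hp
  field_simp

theorem pv_β_eq (hp : p ∈ U) : pv β p = Real.cosh (theta α β p) * mu α β p := by
  rw [theta, Real.cosh_artanh (h.slope_mem hp), h.mu_eq hp]
  have := (h.sqrt_pos hp).ne'
  generalize √(1 - (pu β p / pu α p) ^ 2) = r at this ⊢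
  field_simp

theorem pv_α_eq (hp : p ∈ U) : pv α p = Real.sinh (theta α β p) * mu α β p := by
  rw [theta, Real.sinh_artanh (h.slope_mem hp), h.mu_eq hp]
  have := (h.sqrt_pos hp).ne'
  generalize √(1 - (pu β p / pu α p) ^ 2) = r at this ⊢
  have h0 := h.pu_α_ne_zero hp
  field_simp
  linear_combination h.conj p hp

theorem lam_mul_mu (hp : p ∈ U) : lam α β p * mu α β p = jac α β p := by
  rw [jac, h.pu_α_eq hp, h.pu_β_eq hp, h.pv_α_eq hp, h.pv_β_eq hp]
  linear_combination -(lam α β p * mu α β p) * Real.cosh_sq_sub_sinh_sq (theta α β p)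

theorem lam_ne_zero (hp : p ∈ U) : lam α β p ≠ 0 := fun h0 =>
  h.jac_ne_zero p hp (by rw [← h.lam_mul_mu hp, h0, zero_mul])

theorem mu_ne_zero (hp : p ∈ U) : mu α β p ≠ 0 := fun h0 =>
  h.jac_ne_zero p hp (by rw [← h.lam_mul_mu hp, h0, mul_zero])

theorem lam_sq (hp : p ∈ U) : lam α β p ^ 2 = pu α p ^ 2 - pu β p ^ 2 := by
  rw [h.pu_α_eq hp, h.pu_β_eq hp]
  linear_combination -(lam α β p ^ 2) * Real.cosh_sq_sub_sinh_sq (theta α β p)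

theorem mu_sq (hp : p ∈ U) : mu α β p ^ 2 = pv β p ^ 2 - pv α p ^ 2 := by
  rw [h.pv_α_eq hp, h.pv_β_eq hp]
  linear_combination -(mu α β p ^ 2) * Real.cosh_sq_sub_sinh_sq (theta α β p)

theorem contDiffOn_slope (hU : IsOpen U) : ContDiffOn ℝ ∞ (fun p => pu β p / pu α p) U :=
  (contDiffOn_pu h.smooth_β hU).div (contDiffOn_pu h.smooth_α hU) fun _ hp => h.pu_α_ne_zero hp

theorem contDiffOn_sqrt (hU : IsOpen U) :
    ContDiffOn ℝ ∞ (fun p => √(1 - (pu β p / pu α p) ^ 2)) U :=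
  (contDiffOn_const.sub ((h.contDiffOn_slope hU).pow 2)).sqrt fun p hp => by
    have := h.slope_sq_lt_one hp
    intro h0
    linarith

theorem contDiffOn_lam (hU : IsOpen U) : ContDiffOn ℝ ∞ (lam α β) U :=
  ((contDiffOn_pu h.smooth_α hU).mul (h.contDiffOn_sqrt hU)).congr fun _ hp => h.lam_eq hp

theorem contDiffOn_mu (hU : IsOpen U) : ContDiffOn ℝ ∞ (mu α β) U :=
  ((contDiffOn_pv h.smooth_β hU).mul (h.contDiffOn_sqrt hU)).congr fun _ hp => h.mu_eq hp

theorem contDiffOn_theta (hU : IsOpen U) : ContDiffOn ℝ ∞ (theta α β) U := by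
  have hs := h.contDiffOn_slope hU
  have hq : ContDiffOn ℝ ∞ (fun p => (1 + pu β p / pu α p) / (1 - pu β p / pu α p)) U :=
    (contDiffOn_const.add hs).div (contDiffOn_const.sub hs) fun p hp => by
      have := (h.slope_mem hp).2
      linarith
  have hpos : ∀ p ∈ U, 0 < (1 + pu β p / pu α p) / (1 - pu β p / pu α p) := fun p hp => by
    have := h.slope_mem hp
    exact div_pos (by linarith [this.1]) (by linarith [this.2])
  exact (hq.sqrt fun p hp => (hpos p hp).ne').log fun p hp => (Real.sqrt_pos.2 (hpos p hp)).ne'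

/-- The integrability conditions of `dα, dβ`. -/
theorem compatibility (hU : IsOpen U) (hp : p ∈ U) :
    pv (lam α β) p = mu α β p * pu (theta α β) p ∧
    pu (mu α β) p = lam α β p * pv (theta α β) p := by
  have t := HasPD.of_contDiffOn (h.contDiffOn_theta hU) hU hp
  have l := HasPD.of_contDiffOn (h.contDiffOn_lam hU) hU hp
  have m := HasPD.of_contDiffOn (h.contDiffOn_mu hU) hU hp
  have e1 := pv_pu_eq_pu_pv h.smooth_α hU hp
  have e2 := pv_pu_eq_pu_pv h.smooth_β hU hp
  rw [pv_congr hU (fun q hq => h.pu_α_eq hq) hp, pu_congr hU (fun q hq => h.pv_α_eq hq) hp,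
    (t.cosh.mul l).v, (t.sinh.mul m).u] at e1
  rw [pv_congr hU (fun q hq => h.pu_β_eq hq) hp, pu_congr hU (fun q hq => h.pv_β_eq hq) hp,
    (t.sinh.mul l).v, (t.cosh.mul m).u] at e2
  have hcs := Real.cosh_sq_sub_sinh_sq (theta α β p)
  set C := Real.cosh (theta α β p)
  set S := Real.sinh (theta α β p)
  constructor
  · linear_combination C * e1 - S * e2 + (mu α β p * pu (theta α β) p - pv (lam α β) p) * hcs
  · linear_combination S * e1 - C * e2 + (lam α β p * pv (theta α β) p - pu (mu α β) p) * hcs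

end IsConjugateChart

variable {Q : OneSheetedHyperboloid} {s : ℝ}

/-- The system and the modified sinh-Gordon equation follow from the normalization
`μ² - λ² = s H` alone. -/
theorem IsConjugateChart.angleEquations (h : IsConjugateChart U α β) (hU : IsOpen U)
    (hn : ∀ p ∈ U, mu α β p ^ 2 - lam α β p ^ 2 = s * Q.H (α p) (β p)) :
    AngleEquations Q s U α β := by
  have hl : ∀ p ∈ U, pu (lam α β) p = s * (-(1 / 2) * Q.Hα (α p) (β p) * Real.cosh (theta α β p)
      - 1 / 2 * Q.Hβ (α p) (β p) * Real.sinh (theta α β p)) + mu α β p * pv (theta α β) p := by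
    intro p hp
    have l := HasPD.of_contDiffOn (h.contDiffOn_lam hU) hU hp
    have m := HasPD.of_contDiffOn (h.contDiffOn_mu hU) hU hp
    obtain ⟨e, -⟩ := HasPD.unique_of_eqOn hU hp (m.sq.sub l.sq)
      ((HasPD.const s).mul (h.hasPD_H (Q := Q) hU hp)) hn
    rw [(h.compatibility hU hp).2, h.pu_α_eq hp, h.pu_β_eq hp] at e
    apply mul_left_cancel₀ (h.lam_ne_zero hp)
    linear_combination -e / 2
  have hm : ∀ p ∈ U, pv (mu α β) p = s * (1 / 2 * Q.Hα (α p) (β p) * Real.sinh (theta α β p)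
      + 1 / 2 * Q.Hβ (α p) (β p) * Real.cosh (theta α β p)) + lam α β p * pu (theta α β) p := by
    intro p hp
    have l := HasPD.of_contDiffOn (h.contDiffOn_lam hU) hU hp
    have m := HasPD.of_contDiffOn (h.contDiffOn_mu hU) hU hp
    obtain ⟨-, e⟩ := HasPD.unique_of_eqOn hU hp (m.sq.sub l.sq)
      ((HasPD.const s).mul (h.hasPD_H (Q := Q) hU hp)) hn
    rw [(h.compatibility hU hp).1, h.pv_α_eq hp, h.pv_β_eq hp] at e
    apply mul_left_cancel₀ (h.mu_ne_zero hp)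
    linear_combination e / 2
  refine ⟨h.contDiffOn_theta hU, h.contDiffOn_lam hU, h.contDiffOn_mu hU,
    ⟨fun p hp => h.pu_α_eq hp, fun p hp => h.pv_α_eq hp, fun p hp => h.pu_β_eq hp,
      fun p hp => h.pv_β_eq hp, hl, fun p hp => (h.compatibility hU hp).1,
      fun p hp => (h.compatibility hU hp).2, hm, hn⟩, fun p hp => ?_⟩
  have e := pv_pu_eq_pu_pv (h.contDiffOn_lam hU) hU hp
  have t := HasPD.of_contDiffOn (h.contDiffOn_theta hU) hU hp
  have m := HasPD.of_contDiffOn (h.contDiffOn_mu hU) hU hp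
  have tu := hasPD_pu (h.contDiffOn_theta hU) hU hp
  have tv := hasPD_pv (h.contDiffOn_theta hU) hU hp
  have hα := h.hasPD_Hα (Q := Q) hU hp
  have hβ := h.hasPD_Hβ (Q := Q) hU hp
  rw [pv_congr hU hl hp, pu_congr hU (fun q hq => (h.compatibility hU hq).1) hp, (m.mul tu).u,
    (((HasPD.const s).mul ((((HasPD.const (-(1 / 2))).mul hα).mul t.cosh).sub
      (((HasPD.const (1 / 2)).mul hβ).mul t.sinh))).add (m.mul tv)).v,
    (h.compatibility hU hp).2, hm p hp, h.pv_α_eq hp, h.pv_β_eq hp] at e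
  apply mul_left_cancel₀ (h.mu_ne_zero hp)
  linear_combination e

end Angle

/-! ### The tangency configuration -/

namespace OneSheetedHyperboloid

variable (Q : OneSheetedHyperboloid) (z : ℝ) {α₀ β₀ α₁ β₁ : ℝ}

/-- The component of the tangency configuration along `α₀`: it is the derivative in `α₀` of the
left side of the tangency equation. -/
def tA (α₀ α₁ : ℝ) : ℝ :=
  Real.sin α₀ * Real.cos α₁ - Q.r₃ z * Real.cos α₀ * Real.sin α₁

/-- The component of the tangency configuration along `β₀`. -/
def tB (β₀ β₁ : ℝ) : ℝ :=
  -(Q.r₁ z * Real.sin β₀ * Real.cos β₁) + Q.r₂ z * Real.cos β₀ * Real.sin β₁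

/-- The left side of the tangency equation; it is symmetric in the two points. -/
def tangencyForm (α₀ β₀ α₁ β₁ : ℝ) : ℝ :=
  Q.r₁ z * (Real.cos β₀ * Real.cos β₁) + Q.r₂ z * (Real.sin β₀ * Real.sin β₁) -
    Q.r₃ z * (Real.sin α₀ * Real.sin α₁) - Real.cos α₀ * Real.cos α₁

variable {z}

theorem tangencyForm_comm : Q.tangencyForm z α₁ β₁ α₀ β₀ = Q.tangencyForm z α₀ β₀ α₁ β₁ := by
  simp only [tangencyForm]; ring

theorem tangencyForm_eq_zero (h₀ : Real.cos α₀ ≠ 0) (h₁ : Real.cos α₁ ≠ 0)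
    (h : Tangency Q z α₀ β₀ α₁ β₁) : Q.tangencyForm z α₀ β₀ α₁ β₁ = 0 := by
  have k1 := Q.k₁_pos.ne'
  have k2 := Q.k₂_pos.ne'
  have k3 := Q.k₃_pos.ne'
  have h := h.1
  rw [Q.X_eq, Q.X_eq, Q.Nhat_eq, sub_vec3, inner_vec3, r₁_zero, r₂_zero, r₃_zero] at h
  field_simp at h
  rw [tangencyForm]
  apply mul_left_cancel₀ h₀
  linear_combination h + Real.cos α₁ * (Real.sin_sq_add_cos_sq β₀ - Real.sin_sq_add_cos_sq α₀)

/-- The segment of the tangency configuration in the basis of the tangent plane. -/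
theorem X_sub_X (h₀ : Real.cos α₀ ≠ 0) (h₁ : Real.cos α₁ ≠ 0)
    (h : Q.tangencyForm z α₀ β₀ α₁ β₁ = 0) :
    Q.X z α₁ β₁ - Q.X 0 α₀ β₀ =
      (-(Real.cos α₀ / Real.cos α₁ * Q.tA z α₀ α₁)) • Q.Xα 0 α₀ β₀ +
        (Real.cos α₀ / Real.cos α₁ * Q.tB z β₀ β₁) • Q.Xβ 0 α₀ β₀ := by
  rw [tangencyForm] at h
  have eα := Real.sin_sq_add_cos_sq α₀
  have eβ := Real.sin_sq_add_cos_sq β₀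
  rw [Q.X_eq, Q.X_eq, Q.Xα_eq h₀, Q.Xβ_eq, sub_vec3, smul_vec3, smul_vec3, add_vec3, r₁_zero,
    r₂_zero, r₃_zero, tA, tB]
  congr 1
  ext i
  fin_cases i <;> simp <;> field_simp
  · linear_combination Q.k₁ * (Real.cos α₀ * Real.cos β₀ * h -
      Q.r₁ z * Real.cos α₀ * Real.cos β₁ * eβ + Real.cos α₁ * Real.cos β₀ * eα)
  · linear_combination Q.k₂ * (Real.cos α₀ * Real.sin β₀ * h -
      Q.r₂ z * Real.cos α₀ * Real.sin β₁ * eβ + Real.cos α₁ * Real.sin β₀ * eα)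
  · ring

theorem inner_Xα_Nhat (h₀ : Real.cos α₀ ≠ 0) (h₁ : Real.cos α₁ ≠ 0)
    (h : Q.tangencyForm z α₀ β₀ α₁ β₁ = 0) :
    inner ℝ (Q.Xα z α₀ β₀) (Q.Nhat α₁ β₁) = Q.tA z α₀ α₁ / (Real.cos α₀ * Real.cos α₁) := by
  have k1 := Q.k₁_pos.ne'
  have k2 := Q.k₂_pos.ne'
  have k3 := Q.k₃_pos.ne'
  rw [tangencyForm] at h
  rw [Q.Xα_eq h₀, Q.Nhat_eq, inner_vec3, tA]
  field_simp
  linear_combination Real.sin α₀ * h + Q.r₃ z * Real.sin α₁ * Real.sin_sq_add_cos_sq α₀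

theorem inner_Xβ_Nhat :
    inner ℝ (Q.Xβ z α₀ β₀) (Q.Nhat α₁ β₁) = Q.tB z β₀ β₁ / (Real.cos α₀ * Real.cos α₁) := by
  have k1 := Q.k₁_pos.ne'
  have k2 := Q.k₂_pos.ne'
  rw [Q.Xβ_eq, Q.Nhat_eq, inner_vec3, tB]
  field_simp
  ring

theorem k₁_sq_mul (hz : z ≤ 0) : Q.k₁ ^ 2 * Q.r₁ z ^ 2 = Q.k₁ ^ 2 - z := by
  have := Q.a₁_pos.ne'
  rw [Q.r₁_sq hz, Q.k₁_sq]
  field_simp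

theorem k₂_sq_mul (hz : z ≤ 0) : Q.k₂ ^ 2 * Q.r₂ z ^ 2 = Q.k₂ ^ 2 - z := by
  have := Q.a₂_pos.ne'
  rw [Q.r₂_sq hz, Q.k₂_sq]
  field_simp

theorem k₃_sq_mul (hz : Q.a₃ ≤ z) : Q.k₃ ^ 2 * Q.r₃ z ^ 2 = Q.k₃ ^ 2 + z := by
  have := Q.a₃_neg.ne
  rw [Q.r₃_sq hz, Q.k₃_sq]
  field_simp
  ring

/-- In the tangency configuration the differential of the tangency equation at one point has the
form `T_β² - T_α² = -z H` with `H` taken at the other point. -/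
theorem tB_sq_sub_tA_sq (hz : z ≤ 0) (hz' : Q.a₃ ≤ z) (h : Q.tangencyForm z α₀ β₀ α₁ β₁ = 0) :
    Q.tB z β₀ β₁ ^ 2 - Q.tA z α₀ α₁ ^ 2 = -z * Q.H α₁ β₁ := by
  rw [tangencyForm] at h
  have e1 := Q.r₁_sq hz
  have e2 := Q.r₂_sq hz
  have e3 := Q.r₃_sq hz'
  have eα₀ := Real.sin_sq_add_cos_sq α₀
  have eβ₀ := Real.sin_sq_add_cos_sq β₀
  have eα₁ := Real.sin_sq_add_cos_sq α₁
  have eβ₁ := Real.sin_sq_add_cos_sq β₁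
  have key : Q.tB z β₀ β₁ ^ 2 - Q.tA z α₀ α₁ ^ 2 = Q.r₁ z ^ 2 * Real.cos β₁ ^ 2 +
      Q.r₂ z ^ 2 * Real.sin β₁ ^ 2 - Q.r₃ z ^ 2 * Real.sin α₁ ^ 2 - Real.cos α₁ ^ 2 := by
    rw [tA, tB]
    linear_combination (-(Q.r₁ z * (Real.cos β₀ * Real.cos β₁) +
      Q.r₂ z * (Real.sin β₀ * Real.sin β₁) + Q.r₃ z * (Real.sin α₀ * Real.sin α₁) +
      Real.cos α₀ * Real.cos α₁)) * h +
      (Q.r₁ z ^ 2 * Real.cos β₁ ^ 2 + Q.r₂ z ^ 2 * Real.sin β₁ ^ 2) * eβ₀ -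
      (Q.r₃ z ^ 2 * Real.sin α₁ ^ 2 + Real.cos α₁ ^ 2) * eα₀
  rw [key, e1, e2, e3, H]
  linear_combination eβ₁ - eα₁

/-- The induced metric of a confocal hyperboloid differs from that of the hyperboloid by
`z (dα² - dβ²) / cos² α`; this lemma and the two below give the coefficients. -/
theorem inner_Xα_Xα (hz : z ≤ 0) (hz' : Q.a₃ ≤ z) (h₀ : Real.cos α₀ ≠ 0) :
    inner ℝ (Q.Xα z α₀ β₀) (Q.Xα z α₀ β₀) =
      inner ℝ (Q.Xα 0 α₀ β₀) (Q.Xα 0 α₀ β₀) + z / Real.cos α₀ ^ 2 := by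
  have e1 := Q.k₁_sq_mul hz
  have e2 := Q.k₂_sq_mul hz
  have e3 := Q.k₃_sq_mul hz'
  rw [Q.Xα_eq h₀, Q.Xα_eq h₀, inner_vec3, inner_vec3, r₁_zero, r₂_zero, r₃_zero]
  field_simp
  linear_combination Real.cos β₀ ^ 2 * Real.sin α₀ ^ 2 * e1 +
    Real.sin β₀ ^ 2 * Real.sin α₀ ^ 2 * e2 + e3 - z * Real.sin α₀ ^ 2 *
    Real.sin_sq_add_cos_sq β₀ - z * Real.sin_sq_add_cos_sq α₀

theorem inner_Xβ_Xβ (hz : z ≤ 0) (h₀ : Real.cos α₀ ≠ 0) :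
    inner ℝ (Q.Xβ z α₀ β₀) (Q.Xβ z α₀ β₀) =
      inner ℝ (Q.Xβ 0 α₀ β₀) (Q.Xβ 0 α₀ β₀) - z / Real.cos α₀ ^ 2 := by
  have e1 := Q.k₁_sq_mul hz
  have e2 := Q.k₂_sq_mul hz
  rw [Q.Xβ_eq, Q.Xβ_eq, inner_vec3, inner_vec3, r₁_zero, r₂_zero]
  field_simp
  linear_combination Real.sin β₀ ^ 2 * e1 + Real.cos β₀ ^ 2 * e2 - z * Real.sin_sq_add_cos_sq β₀

theorem inner_Xα_Xβ (hz : z ≤ 0) (h₀ : Real.cos α₀ ≠ 0) :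
    inner ℝ (Q.Xα z α₀ β₀) (Q.Xβ z α₀ β₀) = inner ℝ (Q.Xα 0 α₀ β₀) (Q.Xβ 0 α₀ β₀) := by
  have e1 := Q.k₁_sq_mul hz
  have e2 := Q.k₂_sq_mul hz
  rw [Q.Xα_eq h₀, Q.Xβ_eq, Q.Xα_eq h₀, Q.Xβ_eq, inner_vec3, inner_vec3, r₁_zero, r₂_zero]
  field_simp
  linear_combination Real.cos β₀ * Real.sin β₀ * Real.sin α₀ * (e2 - e1)

/-- **Ivory's theorem**: the segments joining corresponding points crosswise are equal. -/
theorem ivory (hz : z ≤ 0) (hz' : Q.a₃ ≤ z) (h₀ : Real.cos α₀ ≠ 0) (h₁ : Real.cos α₁ ≠ 0) :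
    inner ℝ (Q.X z α₁ β₁ - Q.X 0 α₀ β₀) (Q.X z α₁ β₁ - Q.X 0 α₀ β₀) =
      inner ℝ (Q.X z α₀ β₀ - Q.X 0 α₁ β₁) (Q.X z α₀ β₀ - Q.X 0 α₁ β₁) := by
  have e1 := Q.k₁_sq_mul hz
  have e2 := Q.k₂_sq_mul hz
  have e3 := Q.k₃_sq_mul hz'
  simp only [Q.X_eq, sub_vec3, inner_vec3, r₁_zero, r₂_zero, r₃_zero]
  field_simp
  linear_combination
    (Real.cos α₀ ^ 2 * Real.cos β₁ ^ 2 - Real.cos α₁ ^ 2 * Real.cos β₀ ^ 2) * e1 +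
    (Real.cos α₀ ^ 2 * Real.sin β₁ ^ 2 - Real.cos α₁ ^ 2 * Real.sin β₀ ^ 2) * e2 +
    (Real.cos α₀ ^ 2 * Real.sin α₁ ^ 2 - Real.cos α₁ ^ 2 * Real.sin α₀ ^ 2) * e3 -
    z * (Real.cos α₀ ^ 2 * Real.sin_sq_add_cos_sq β₁ -
      Real.cos α₁ ^ 2 * Real.sin_sq_add_cos_sq β₀ - Real.cos α₀ ^ 2 * Real.sin_sq_add_cos_sq α₁ +
      Real.cos α₁ ^ 2 * Real.sin_sq_add_cos_sq α₀)

/-- The derivative of Ivory's theorem in `α₁`. -/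
theorem ivory_α (hz : z ≤ 0) (hz' : Q.a₃ ≤ z) (h₀ : Real.cos α₀ ≠ 0) (h₁ : Real.cos α₁ ≠ 0) :
    inner ℝ (Q.X z α₁ β₁ - Q.X 0 α₀ β₀) (Q.Xα z α₁ β₁) =
      -inner ℝ (Q.X z α₀ β₀ - Q.X 0 α₁ β₁) (Q.Xα 0 α₁ β₁) := by
  have e1 := Q.k₁_sq_mul hz
  have e2 := Q.k₂_sq_mul hz
  have e3 := Q.k₃_sq_mul hz'
  simp only [Q.X_eq, Q.Xα_eq h₁, sub_vec3, inner_vec3, r₁_zero, r₂_zero, r₃_zero]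
  field_simp
  linear_combination Real.cos α₀ * Real.sin α₁ * (Real.cos β₁ ^ 2 * e1 + Real.sin β₁ ^ 2 * e2 + e3
    - z * Real.sin_sq_add_cos_sq β₁)

/-- The derivative of Ivory's theorem in `β₁`. -/
theorem ivory_β (hz : z ≤ 0) (h₀ : Real.cos α₀ ≠ 0) (h₁ : Real.cos α₁ ≠ 0) :
    inner ℝ (Q.X z α₁ β₁ - Q.X 0 α₀ β₀) (Q.Xβ z α₁ β₁) =
      -inner ℝ (Q.X z α₀ β₀ - Q.X 0 α₁ β₁) (Q.Xβ 0 α₁ β₁) := by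
  have e1 := Q.k₁_sq_mul hz
  have e2 := Q.k₂_sq_mul hz
  simp only [Q.X_eq, Q.Xβ_eq, sub_vec3, inner_vec3, r₁_zero, r₂_zero, r₃_zero]
  field_simp
  linear_combination Real.cos α₀ * Real.cos β₁ * Real.sin β₁ * (e2 - e1)

end OneSheetedHyperboloid

/-! ### The Bäcklund transformation as a symmetric relation -/

section Transform

variable {Q : OneSheetedHyperboloid} {z : ℝ} {U : Set (ℝ × ℝ)} {p : ℝ × ℝ}
  {α₀ β₀ α₁ β₁ : ℝ × ℝ → ℝ} {x₀ x₁ x y N : ℝ × ℝ → E3}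

/-- The tangential displacement of a surface `x`, `f x_u + g x_v`, has the same first order
tangential behaviour for all surfaces with the same first fundamental form. -/
theorem SameMetric.inner_displaced (h : SameMetric U x y) (hU : IsOpen U) (hp : p ∈ U)
    {f g : ℝ × ℝ → ℝ} (hf : ContDiffOn ℝ ∞ f U) (hg : ContDiffOn ℝ ∞ g U) {x' y' : ℝ × ℝ → E3}
    (hx : ∀ q ∈ U, x' q = x q + f q • pu x q + g q • pv x q)
    (hy : ∀ q ∈ U, y' q = y q + f q • pu y q + g q • pv y q) :
    (inner ℝ (pu x' p) (pu x p) : ℝ) = inner ℝ (pu y' p) (pu y p) ∧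
    (inner ℝ (pu x' p) (pv x p) : ℝ) = inner ℝ (pu y' p) (pv y p) ∧
    (inner ℝ (pv x' p) (pu x p) : ℝ) = inner ℝ (pv y' p) (pu y p) ∧
    (inner ℝ (pv x' p) (pv x p) : ℝ) = inner ℝ (pv y' p) (pv y p) := by
  obtain ⟨c1, c2, c3, c4, c5, c6⟩ := h.christoffel hU hp
  have F := HasPD.of_contDiffOn hf hU hp
  have G := HasPD.of_contDiffOn hg hU hp
  have dx := (((HasPD.of_contDiffOn h.smooth_left hU hp).add
    (F.smul (hasPD_pu h.smooth_left hU hp))).add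
    (G.smul (hasPD_pv h.smooth_left hU hp))).congr_of_eqOn hU hp hx
  have dy := (((HasPD.of_contDiffOn h.smooth_right hU hp).add
    (F.smul (hasPD_pu h.smooth_right hU hp))).add
    (G.smul (hasPD_pv h.smooth_right hU hp))).congr_of_eqOn hU hp hy
  have vu : (inner ℝ (pv x p) (pu x p) : ℝ) = inner ℝ (pv y p) (pu y p) := by
    rw [real_inner_comm, h.uv p hp, real_inner_comm]
  rw [dx.u, dx.v, dy.u, dy.v]
  simp only [inner_add_left, real_inner_smul_left, c1, c2, c3, c4, c5, c6, h.uu p hp, h.uv p hp,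
    h.vv p hp, vu, and_self]

/-- The normal part of a tangential displacement is given by the second fundamental form. -/
theorem IsUnitNormal.inner_displaced (hN : IsUnitNormal U x N) (hx : ContDiffOn ℝ ∞ x U)
    (hU : IsOpen U) (hp : p ∈ U) {f g : ℝ × ℝ → ℝ} (hf : ContDiffOn ℝ ∞ f U)
    (hg : ContDiffOn ℝ ∞ g U) {x' : ℝ × ℝ → E3}
    (hx' : ∀ q ∈ U, x' q = x q + f q • pu x q + g q • pv x q) :
    inner ℝ (N p) (pu x' p) = f p * h₁₁ x N p + g p * h₁₂ x N p ∧
    inner ℝ (N p) (pv x' p) = f p * h₁₂ x N p + g p * h₂₂ x N p := by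
  have dx := (((HasPD.of_contDiffOn hx hU hp).add
    ((HasPD.of_contDiffOn hf hU hp).smul (hasPD_pu hx hU hp))).add
    ((HasPD.of_contDiffOn hg hU hp).smul (hasPD_pv hx hU hp))).congr_of_eqOn hU hp hx'
  rw [dx.u, dx.v]
  simp only [inner_add_right, real_inner_smul_right, hN.orth_u p hp, hN.orth_v p hp, h₁₁, h₁₂, h₂₂,
    mul_zero, zero_add, and_self]

/-- Component along `x_u` of the segment of the transformation. -/
def segU (Q : OneSheetedHyperboloid) (z : ℝ) (α₀ β₀ α₁ β₁ : ℝ × ℝ → ℝ) (p : ℝ × ℝ) : ℝ :=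
  -(Real.cos (α₀ p) / Real.cos (α₁ p) * (Q.tA z (α₀ p) (α₁ p) * pv β₀ p +
    Q.tB z (β₀ p) (β₁ p) * pv α₀ p) / jac α₀ β₀ p)

/-- Component along `x_v` of the segment of the transformation. -/
def segV (Q : OneSheetedHyperboloid) (z : ℝ) (α₀ β₀ α₁ β₁ : ℝ × ℝ → ℝ) (p : ℝ × ℝ) : ℝ :=
  Real.cos (α₀ p) / Real.cos (α₁ p) * (Q.tA z (α₀ p) (α₁ p) * pu β₀ p +
    Q.tB z (β₀ p) (β₁ p) * pu α₀ p) / jac α₀ β₀ p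

/-- Two deformations, with the points of the hyperboloid in the tangency configuration, such that
`x₁ - x₀` is tangent to `x₀`, with the components of the segment of the configuration. -/
structure IsTransform (Q : OneSheetedHyperboloid) (z : ℝ) (U : Set (ℝ × ℝ))
    (α₀ β₀ : ℝ × ℝ → ℝ) (x₀ : ℝ × ℝ → E3) (α₁ β₁ : ℝ × ℝ → ℝ) (x₁ : ℝ × ℝ → E3) : Prop where
  seed : IsDeformation Q U α₀ β₀ x₀
  leaf : IsDeformation Q U α₁ β₁ x₁
  tangent : ∀ p ∈ U, Q.tangencyForm z (α₀ p) (β₀ p) (α₁ p) (β₁ p) = 0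
  position : ∀ p ∈ U, x₁ p = x₀ p + segU Q z α₀ β₀ α₁ β₁ p • pu x₀ p +
    segV Q z α₀ β₀ α₁ β₁ p • pv x₀ p

theorem IsBacklundTransform.isTransform (h : IsBacklundTransform Q z U α₀ β₀ x₀ α₁ β₁ x₁)
    (h₀ : IsDeformation Q U α₀ β₀ x₀) : IsTransform Q z U α₀ β₀ x₀ α₁ β₁ x₁ := by
  have T : ∀ p ∈ U, Q.tangencyForm z (α₀ p) (β₀ p) (α₁ p) (β₁ p) = 0 := fun p hp =>
    Q.tangencyForm_eq_zero (h₀.isChart.cos_pos p hp).ne' (h.leaf.isChart.cos_pos p hp).ne'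
      (h.tangency p hp)
  refine ⟨h₀, h.leaf, T, fun p hp => ?_⟩
  have c₀ := (h₀.isChart.cos_pos p hp).ne'
  have c₁ := (h.leaf.isChart.cos_pos p hp).ne'
  have j := h₀.jac_ne_zero p hp
  rw [h.position p hp, Q.inner_Xα_Nhat c₀ c₁ (T p hp), Q.inner_Xβ_Nhat, dα, dβ, segU, segV,
    add_assoc]
  congr 1
  simp only [smul_add, smul_sub, smul_smul]
  match_scalars <;> field_simp
  ring

variable (h : IsTransform Q z U α₀ β₀ x₀ α₁ β₁ x₁)
include h

theorem IsTransform.contDiffOn_seg (hU : IsOpen U) :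
    ContDiffOn ℝ ∞ (segU Q z α₀ β₀ α₁ β₁) U ∧ ContDiffOn ℝ ∞ (segV Q z α₀ β₀ α₁ β₁) U := by
  have a0 := h.seed.smooth_α
  have b0 := h.seed.smooth_β
  have a1 := h.leaf.smooth_α
  have b1 := h.leaf.smooth_β
  have a0u := contDiffOn_pu a0 hU
  have a0v := contDiffOn_pv a0 hU
  have b0u := contDiffOn_pu b0 hU
  have b0v := contDiffOn_pv b0 hU
  have hq : ContDiffOn ℝ ∞ (fun p => Real.cos (α₀ p) / Real.cos (α₁ p)) U :=
    a0.cos.div a1.cos fun p hp => (h.leaf.isChart.cos_pos p hp).ne'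
  have hA : ContDiffOn ℝ ∞ (fun p => Q.tA z (α₀ p) (α₁ p)) U :=
    (a0.sin.mul a1.cos).sub ((contDiffOn_const.mul a0.cos).mul a1.sin)
  have hB : ContDiffOn ℝ ∞ (fun p => Q.tB z (β₀ p) (β₁ p)) U :=
    ((contDiffOn_const.mul b0.sin).mul b1.cos).neg.add ((contDiffOn_const.mul b0.cos).mul b1.sin)
  have hj : ContDiffOn ℝ ∞ (jac α₀ β₀) U := (a0u.mul b0v).sub (a0v.mul b0u)
  exact ⟨((hq.mul ((hA.mul b0v).add (hB.mul a0v))).div hj h.seed.jac_ne_zero).neg,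
    (hq.mul ((hA.mul b0u).add (hB.mul a0u))).div hj h.seed.jac_ne_zero⟩

/-- The point of the confocal hyperboloid has the position on the tangent plane of the hyperboloid
that the transform has on the tangent plane of the deformation. -/
theorem IsTransform.model (hU : IsOpen U) (hp : p ∈ U) : Q.X z (α₁ p) (β₁ p) = onQuadric Q α₀ β₀ p +
    segU Q z α₀ β₀ α₁ β₁ p • pu (onQuadric Q α₀ β₀) p +
    segV Q z α₀ β₀ α₁ β₁ p • pv (onQuadric Q α₀ β₀) p := by
  have c₀ := (h.seed.isChart.cos_pos p hp).ne'
  have c₁ := (h.leaf.isChart.cos_pos p hp).ne'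
  have j := h.seed.jac_ne_zero p hp
  have d := h.seed.isChart.hasPD_X (Q := Q) (z := 0) hU hp
  have eu : pu (onQuadric Q α₀ β₀) p = _ := d.u
  have ev : pv (onQuadric Q α₀ β₀) p = _ := d.v
  have e := Q.X_sub_X c₀ c₁ (h.tangent p hp)
  rw [sub_eq_iff_eq_add'] at e
  rw [e, eu, ev, add_assoc, onQuadric, segU, segV]
  congr 1
  have hj : jac α₀ β₀ p = pu α₀ p * pv β₀ p - pv α₀ p * pu β₀ p := rfl
  match_scalars <;> (field_simp; rw [hj]; ring)

/-- Tangential products of the derivatives of the transform with those of the seed. -/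
theorem IsTransform.inner_tangential (hU : IsOpen U) (hp : p ∈ U) :
    (inner ℝ (pu x₁ p) (pu x₀ p) : ℝ) =
      inner ℝ (pu (fun q => Q.X z (α₁ q) (β₁ q)) p) (pu (onQuadric Q α₀ β₀) p) ∧
    (inner ℝ (pu x₁ p) (pv x₀ p) : ℝ) =
      inner ℝ (pu (fun q => Q.X z (α₁ q) (β₁ q)) p) (pv (onQuadric Q α₀ β₀) p) ∧
    (inner ℝ (pv x₁ p) (pu x₀ p) : ℝ) =
      inner ℝ (pv (fun q => Q.X z (α₁ q) (β₁ q)) p) (pu (onQuadric Q α₀ β₀) p) ∧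
    (inner ℝ (pv x₁ p) (pv x₀ p) : ℝ) =
      inner ℝ (pv (fun q => Q.X z (α₁ q) (β₁ q)) p) (pv (onQuadric Q α₀ β₀) p) :=
  h.seed.sameMetric.inner_displaced hU hp (h.contDiffOn_seg hU).1 (h.contDiffOn_seg hU).2
    h.position fun _ hq => h.model hU hq

/-- The differential of the tangency equation. -/
theorem IsTransform.tangent_deriv (hU : IsOpen U) (hp : p ∈ U) :
    Q.tA z (α₀ p) (α₁ p) * pu α₀ p + Q.tB z (β₀ p) (β₁ p) * pu β₀ p +
      Q.tA z (α₁ p) (α₀ p) * pu α₁ p + Q.tB z (β₁ p) (β₀ p) * pu β₁ p = 0 ∧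
    Q.tA z (α₀ p) (α₁ p) * pv α₀ p + Q.tB z (β₀ p) (β₁ p) * pv β₀ p +
      Q.tA z (α₁ p) (α₀ p) * pv α₁ p + Q.tB z (β₁ p) (β₀ p) * pv β₁ p = 0 := by
  have a0 := h.seed.isChart.hasPD_α hU hp
  have b0 := h.seed.isChart.hasPD_β hU hp
  have a1 := h.leaf.isChart.hasPD_α hU hp
  have b1 := h.leaf.isChart.hasPD_β hU hp
  have d := (((((HasPD.const (Q.r₁ z)).mul (b0.cos.mul b1.cos)).add
    ((HasPD.const (Q.r₂ z)).mul (b0.sin.mul b1.sin))).sub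
    ((HasPD.const (Q.r₃ z)).mul (a0.sin.mul a1.sin))).sub (a0.cos.mul a1.cos))
  obtain ⟨e1, e2⟩ := HasPD.unique_of_eqOn hU hp d (HasPD.const 0) h.tangent
  simp only [OneSheetedHyperboloid.tA, OneSheetedHyperboloid.tB]
  constructor
  · linear_combination e1
  · linear_combination e2

/-- Components of the derivatives of the confocal point along the unit normal. -/
theorem IsTransform.inner_normal (hU : IsOpen U) (hp : p ∈ U) :
    inner ℝ (quadricNormal Q α₀ β₀ p) (pu (fun q => Q.X z (α₁ q) (β₁ q)) p) =
      (Q.tA z (α₁ p) (α₀ p) * pu α₁ p + Q.tB z (β₁ p) (β₀ p) * pu β₁ p) /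
        (√(Q.H (α₀ p) (β₀ p)) * Real.cos (α₁ p)) ∧
    inner ℝ (quadricNormal Q α₀ β₀ p) (pv (fun q => Q.X z (α₁ q) (β₁ q)) p) =
      (Q.tA z (α₁ p) (α₀ p) * pv α₁ p + Q.tB z (β₁ p) (β₀ p) * pv β₁ p) /
        (√(Q.H (α₀ p) (β₀ p)) * Real.cos (α₁ p)) := by
  have c₀ := h.seed.isChart.cos_pos p hp
  have c₁ := (h.leaf.isChart.cos_pos p hp).ne'
  have hH := (Real.sqrt_pos.2 (Q.H_pos (α₀ p) (β₀ p))).ne'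
  have d := h.leaf.isChart.hasPD_X (Q := Q) (z := z) hU hp
  have T := h.tangent p hp
  rw [← Q.tangencyForm_comm] at T
  rw [d.u, d.v, quadricNormal, Q.N₀_eq c₀]
  simp only [inner_add_right, real_inner_smul_left, real_inner_smul_right,
    real_inner_comm (Q.Xβ _ _ _) (Q.Nhat _ _), real_inner_comm (Q.Xα _ _ _) (Q.Nhat _ _),
    Q.inner_Xβ_Nhat, Q.inner_Xα_Nhat c₁ c₀.ne' T]
  have := c₀.ne'
  constructor <;> field_simp

/-- The metric of the hyperboloid minus that of its confocal, plus the square of the component of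
the confocal point along the normal of the seed, is the square of a single linear form; here `(a,
b)` and `(a', b')` are values of `(dα₁, dβ₁)`. -/
theorem IsTransform.metric_X_add_sq (hz : z ≤ 0) (hz' : Q.a₃ ≤ z) (hp : p ∈ U) (a b a' b' : ℝ) :
    inner ℝ (a • Q.Xα 0 (α₁ p) (β₁ p) + b • Q.Xβ 0 (α₁ p) (β₁ p))
      (a' • Q.Xα 0 (α₁ p) (β₁ p) + b' • Q.Xβ 0 (α₁ p) (β₁ p)) -
    inner ℝ (a • Q.Xα z (α₁ p) (β₁ p) + b • Q.Xβ z (α₁ p) (β₁ p))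
      (a' • Q.Xα z (α₁ p) (β₁ p) + b' • Q.Xβ z (α₁ p) (β₁ p)) +
    (Q.tA z (α₁ p) (α₀ p) * a + Q.tB z (β₁ p) (β₀ p) * b) /
      (√(Q.H (α₀ p) (β₀ p)) * Real.cos (α₁ p)) *
    ((Q.tA z (α₁ p) (α₀ p) * a' + Q.tB z (β₁ p) (β₀ p) * b') /
      (√(Q.H (α₀ p) (β₀ p)) * Real.cos (α₁ p))) =
    (Q.tB z (β₁ p) (β₀ p) * a + Q.tA z (α₁ p) (α₀ p) * b) /
      (√(Q.H (α₀ p) (β₀ p)) * Real.cos (α₁ p)) *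
    ((Q.tB z (β₁ p) (β₀ p) * a' + Q.tA z (α₁ p) (α₀ p) * b') /
      (√(Q.H (α₀ p) (β₀ p)) * Real.cos (α₁ p))) := by
  have c₁ := (h.leaf.isChart.cos_pos p hp).ne'
  have hH := (Real.sqrt_pos.2 (Q.H_pos (α₀ p) (β₀ p))).ne'
  have hH2 := Real.sq_sqrt (Q.H_pos (α₀ p) (β₀ p)).le
  have T := h.tangent p hp
  rw [← Q.tangencyForm_comm] at T
  have key := Q.tB_sq_sub_tA_sq hz hz' T
  rw [← hH2] at key
  simp only [inner_add_left, inner_add_right, real_inner_smul_left, real_inner_smul_right,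
    real_inner_comm (Q.Xα _ _ _) (Q.Xβ _ _ _), Q.inner_Xα_Xα hz hz' c₁, Q.inner_Xβ_Xβ hz c₁,
    Q.inner_Xα_Xβ hz c₁]
  field_simp
  linear_combination (b * b' - a * a') * key

/-- The component of the differential of the transform along the normal of the seed is, up to one
sign common to both derivatives, that of the confocal point with `dα₁` and `dβ₁` exchanged. It is
found from the metrics, the tangential components being known. -/
theorem IsTransform.inner_normal_mul (hN : IsUnitNormal U x₀ N) (hU : IsOpen U) (hz : z ≤ 0)
    (hz' : Q.a₃ ≤ z) (hp : p ∈ U) :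
    inner ℝ (N p) (pu x₁ p) * inner ℝ (N p) (pu x₁ p) =
      (Q.tB z (β₁ p) (β₀ p) * pu α₁ p + Q.tA z (α₁ p) (α₀ p) * pu β₁ p) /
        (√(Q.H (α₀ p) (β₀ p)) * Real.cos (α₁ p)) *
      ((Q.tB z (β₁ p) (β₀ p) * pu α₁ p + Q.tA z (α₁ p) (α₀ p) * pu β₁ p) /
        (√(Q.H (α₀ p) (β₀ p)) * Real.cos (α₁ p))) ∧
    inner ℝ (N p) (pu x₁ p) * inner ℝ (N p) (pv x₁ p) =
      (Q.tB z (β₁ p) (β₀ p) * pu α₁ p + Q.tA z (α₁ p) (α₀ p) * pu β₁ p) /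
        (√(Q.H (α₀ p) (β₀ p)) * Real.cos (α₁ p)) *
      ((Q.tB z (β₁ p) (β₀ p) * pv α₁ p + Q.tA z (α₁ p) (α₀ p) * pv β₁ p) /
        (√(Q.H (α₀ p) (β₀ p)) * Real.cos (α₁ p))) := by
  obtain ⟨t1, t2, t3, t4⟩ := h.inner_tangential hU hp
  obtain ⟨n1, n2⟩ := h.inner_normal hU hp
  have sm := h.seed.sameMetric
  have ry := h.seed.isChart.isRegular (Q := Q) hU h.seed.jac_ne_zero
  have M := h.seed.isChart.isUnitNormal (Q := Q) hU
  have fx := fun w w' => inner_eq_frame (hN.norm_eq_one p hp) (hN.orth_u p hp) (hN.orth_v p hp)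
    (sm.isRegular ry p hp) w w'
  have fy := fun w w' => inner_eq_frame (M.norm_eq_one p hp) (M.orth_u p hp) (M.orth_v p hp)
    (ry p hp) w w'
  have d := h.leaf.isChart.hasPD_X (Q := Q) (z := z) hU hp
  have d0 := h.leaf.isChart.hasPD_X (Q := Q) (z := 0) hU hp
  have du : pu (onQuadric Q α₁ β₁) p = _ := d0.u
  have dv : pv (onQuadric Q α₁ β₁) p = _ := d0.v
  constructor
  · have e1 := fx (pu x₁ p) (pu x₁ p)
    have e2 := fy (pu (fun q => Q.X z (α₁ q) (β₁ q)) p) (pu (fun q => Q.X z (α₁ q) (β₁ q)) p)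
    rw [h.leaf.metric_uu p hp, t1, t2, sm.uu p hp, sm.uv p hp, sm.vv p hp, du] at e1
    rw [n1, d.u] at e2
    rw [d.u] at e1
    rw [← h.metric_X_add_sq hz hz' hp]
    linarith
  · have e1 := fx (pu x₁ p) (pv x₁ p)
    have e2 := fy (pu (fun q => Q.X z (α₁ q) (β₁ q)) p) (pv (fun q => Q.X z (α₁ q) (β₁ q)) p)
    rw [h.leaf.metric_uv p hp, t1, t2, t3, t4, sm.uu p hp, sm.uv p hp, sm.vv p hp, du, dv] at e1
    rw [n1, n2, d.u, d.v] at e2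
    rw [d.u, d.v] at e1
    rw [← h.metric_X_add_sq hz hz' hp]
    linarith

/-- By Ivory's theorem the seed is obtained from the transform in the same way. -/
theorem IsTransform.symm (hU : IsOpen U) (hz : z ≤ 0) (hz' : Q.a₃ ≤ z) :
    IsTransform Q z U α₁ β₁ x₁ α₀ β₀ x₀ := by
  have T : ∀ p ∈ U, Q.tangencyForm z (α₁ p) (β₁ p) (α₀ p) (β₀ p) = 0 := fun p hp => by
    rw [Q.tangencyForm_comm]; exact h.tangent p hp
  refine ⟨h.leaf, h.seed, T, fun p hp => ?_⟩
  have c₀ := (h.seed.isChart.cos_pos p hp).ne'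
  have c₁ := (h.leaf.isChart.cos_pos p hp).ne'
  obtain ⟨t1, t2, t3, t4⟩ := h.inner_tangential hU hp
  have m := h.model hU hp
  have j := h.leaf.jac_ne_zero p hp
  have d0 := h.leaf.isChart.hasPD_X (Q := Q) (z := 0) hU hp
  have d := h.leaf.isChart.hasPD_X (Q := Q) (z := z) hU hp
  have du : pu (onQuadric Q α₁ β₁) p = _ := d0.u
  have dv : pv (onQuadric Q α₁ β₁) p = _ := d0.v
  have m₁ : Q.X z (α₀ p) (β₀ p) - Q.X 0 (α₁ p) (β₁ p) =
      segU Q z α₁ β₁ α₀ β₀ p • pu (onQuadric Q α₁ β₁) p +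
      segV Q z α₁ β₁ α₀ β₀ p • pv (onQuadric Q α₁ β₁) p := by
    rw [Q.X_sub_X c₁ c₀ (T p hp), du, dv, segU, segV]
    have hj : jac α₁ β₁ p = pu α₁ p * pv β₁ p - pv α₁ p * pu β₁ p := rfl
    match_scalars <;> (field_simp; rw [hj]; ring)
  have iv := Q.ivory hz hz' c₀ c₁ (β₀ := β₀ p) (β₁ := β₁ p)
  have ia := Q.ivory_α hz hz' c₀ c₁ (β₀ := β₀ p) (β₁ := β₁ p)
  have ib := Q.ivory_β hz c₀ c₁ (β₀ := β₀ p) (β₁ := β₁ p)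
  have m₀ : Q.X z (α₁ p) (β₁ p) - Q.X 0 (α₀ p) (β₀ p) =
      segU Q z α₀ β₀ α₁ β₁ p • pu (onQuadric Q α₀ β₀) p +
      segV Q z α₀ β₀ α₁ β₁ p • pv (onQuadric Q α₀ β₀) p := by
    rw [m, onQuadric, add_assoc, add_sub_cancel_left]
  set V := Q.X z (α₁ p) (β₁ p) - Q.X 0 (α₀ p) (β₀ p)
  set V₁ := Q.X z (α₀ p) (β₀ p) - Q.X 0 (α₁ p) (β₁ p)
  set W := segU Q z α₀ β₀ α₁ β₁ p • pu x₀ p + segV Q z α₀ β₀ α₁ β₁ p • pv x₀ p with hW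
  set W₁ := segU Q z α₁ β₁ α₀ β₀ p • pu x₁ p + segV Q z α₁ β₁ α₀ β₀ p • pv x₁ p with hW₁
  have hx : x₁ p = x₀ p + W := by rw [h.position p hp, hW, add_assoc]
  -- products of the segment with the derivatives of the transform
  have wu : inner ℝ W (pu x₁ p) = -inner ℝ V₁ (pu (onQuadric Q α₁ β₁) p) := by
    have e1 : inner ℝ W (pu x₁ p) = inner ℝ V (pu (fun q => Q.X z (α₁ q) (β₁ q)) p) := by
      rw [real_inner_comm _ W, real_inner_comm _ V, hW, m₀]
      simp only [inner_add_right, real_inner_smul_right, t1, t2]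
    rw [e1, d.u, du]
    simp only [inner_add_right, real_inner_smul_right, ia, ib]
    ring
  have wv : inner ℝ W (pv x₁ p) = -inner ℝ V₁ (pv (onQuadric Q α₁ β₁) p) := by
    have e1 : inner ℝ W (pv x₁ p) = inner ℝ V (pv (fun q => Q.X z (α₁ q) (β₁ q)) p) := by
      rw [real_inner_comm _ W, real_inner_comm _ V, hW, m₀]
      simp only [inner_add_right, real_inner_smul_right, t3, t4]
    rw [e1, d.v, dv]
    simp only [inner_add_right, real_inner_smul_right, ia, ib]
    ring
  have sm₀ := h.seed.sameMetric
  have sm₁ := h.leaf.sameMetric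
  have ww : inner ℝ W W = inner ℝ V V := by
    rw [hW, m₀]
    simp only [inner_add_left, inner_add_right, real_inner_smul_left, real_inner_smul_right,
      real_inner_comm (pu x₀ p) (pv x₀ p), real_inner_comm (pu (onQuadric Q α₀ β₀) p) (pv _ p),
      sm₀.uu p hp, sm₀.uv p hp, sm₀.vv p hp]
  have w1w1 : inner ℝ W₁ W₁ = inner ℝ V₁ V₁ := by
    rw [hW₁, m₁]
    simp only [inner_add_left, inner_add_right, real_inner_smul_left, real_inner_smul_right,
      real_inner_comm (pu x₁ p) (pv x₁ p), real_inner_comm (pu (onQuadric Q α₁ β₁) p) (pv _ p),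
      sm₁.uu p hp, sm₁.uv p hp, sm₁.vv p hp]
  have ww1 : inner ℝ W W₁ = -inner ℝ V₁ V₁ := by
    conv_rhs => rw [m₁]
    rw [hW₁]
    simp only [inner_add_right, real_inner_smul_right, wu, wv]
    rw [m₁]
    ring
  have z0 : inner ℝ (W + W₁) (W + W₁) = 0 := by
    rw [real_inner_add_add_self, ww, w1w1, ww1, iv]
    ring
  have z1 : W + W₁ = 0 := inner_self_eq_zero.1 z0
  rw [hx, add_assoc, add_assoc, ← hW₁, z1, add_zero]

end Transform

/-! ### Unit normals -/

/-- The vector product in space. -/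
def cross (a b : E3) : E3 :=
  !₂[a 1 * b 2 - a 2 * b 1, a 2 * b 0 - a 0 * b 2, a 0 * b 1 - a 1 * b 0]

theorem inner_E3 (a b : E3) : inner ℝ a b = a 0 * b 0 + a 1 * b 1 + a 2 * b 2 := by
  simp [PiLp.inner_apply, Fin.sum_univ_three, mul_comm]

theorem inner_cross_left (a b : E3) : inner ℝ (cross a b) a = (0 : ℝ) := by
  rw [inner_E3]; simp [cross]; ring

theorem inner_cross_right (a b : E3) : inner ℝ (cross a b) b = (0 : ℝ) := by
  rw [inner_E3]; simp [cross]; ring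

theorem inner_cross_self (a b : E3) : inner ℝ (cross a b) (cross a b) =
    inner ℝ a a * inner ℝ b b - inner ℝ a b ^ 2 := by
  simp only [inner_E3]; simp [cross]; ring

section Normal

variable {U : Set (ℝ × ℝ)} {p : ℝ × ℝ} {x N : ℝ × ℝ → E3}

theorem exists_isUnitNormal (hx : ContDiffOn ℝ ∞ x U) (hU : IsOpen U) (hr : IsRegular U x) :
    ∃ N, IsUnitNormal U x N := by
  have hu := contDiffOn_pu hx hU
  have hv := contDiffOn_pv hx hU
  have hui : ∀ i, ContDiffOn ℝ ∞ (fun p => pu x p i) U := contDiffOn_euclidean.1 hu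
  have hvi : ∀ i, ContDiffOn ℝ ∞ (fun p => pv x p i) U := contDiffOn_euclidean.1 hv
  have hc : ContDiffOn ℝ ∞ (fun p => cross (pu x p) (pv x p)) U :=
    contDiffOn_vec3 (((hui 1).mul (hvi 2)).sub ((hui 2).mul (hvi 1)))
      (((hui 2).mul (hvi 0)).sub ((hui 0).mul (hvi 2)))
      (((hui 0).mul (hvi 1)).sub ((hui 1).mul (hvi 0)))
  have h0 : ∀ p ∈ U, cross (pu x p) (pv x p) ≠ 0 := fun p hp h0 => by
    have := inner_cross_self (pu x p) (pv x p)
    rw [h0, inner_zero_left] at this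
    exact hr p hp this.symm
  refine ⟨fun p => ‖cross (pu x p) (pv x p)‖⁻¹ • cross (pu x p) (pv x p),
    ((hc.norm ℝ h0).inv fun p hp => norm_ne_zero_iff.2 (h0 p hp)).smul hc, fun p hp => ?_,
    fun p hp => ?_, fun p hp => ?_⟩
  · rw [norm_smul, norm_inv, norm_norm, inv_mul_cancel₀ (norm_ne_zero_iff.2 (h0 p hp))]
  · rw [real_inner_smul_left, inner_cross_left, mul_zero]
  · rw [real_inner_smul_left, inner_cross_right, mul_zero]

theorem IsUnitNormal.smul {σ : ℝ} (hN : IsUnitNormal U x N) (hσ : σ = 1 ∨ σ = -1) :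
    IsUnitNormal U x fun p => σ • N p where
  smooth := hN.smooth.const_smul σ
  norm_eq_one p hp := by
    rw [norm_smul, hN.norm_eq_one p hp]
    rcases hσ with rfl | rfl <;> simp
  orth_u p hp := by rw [real_inner_smul_left, hN.orth_u p hp, mul_zero]
  orth_v p hp := by rw [real_inner_smul_left, hN.orth_v p hp, mul_zero]

theorem form_smul (σ : ℝ) : h₁₁ x (fun p => σ • N p) p = σ * h₁₁ x N p ∧
    h₁₂ x (fun p => σ • N p) p = σ * h₁₂ x N p ∧ h₂₂ x (fun p => σ • N p) p = σ * h₂₂ x N p := by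
  simp only [h₁₁, h₁₂, h₂₂, real_inner_smul_left, and_self]

theorem IsUnitNormal.contDiffOn_form (hN : IsUnitNormal U x N) (hx : ContDiffOn ℝ ∞ x U)
    (hU : IsOpen U) : ContDiffOn ℝ ∞ (h₁₁ x N) U ∧ ContDiffOn ℝ ∞ (h₂₂ x N) U :=
  ⟨hN.smooth.inner ℝ (contDiffOn_pu (contDiffOn_pu hx hU) hU),
    hN.smooth.inner ℝ (contDiffOn_pv (contDiffOn_pv hx hU) hU)⟩

end Normal

/-! ### The transform of an isothermic-conjugate system -/

section Leaf

variable {Q : OneSheetedHyperboloid} {z : ℝ} {U : Set (ℝ × ℝ)} {p : ℝ × ℝ}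
  {α₀ β₀ α₁ β₁ : ℝ × ℝ → ℝ} {x₀ x₁ N₀ N₁ : ℝ × ℝ → E3}

/-- The component of the tangency configuration along `u`, up to the factor `λ₀`. -/
def legU (Q : OneSheetedHyperboloid) (z : ℝ) (α₀ β₀ α₁ β₁ : ℝ × ℝ → ℝ) (p : ℝ × ℝ) : ℝ :=
  Q.tA z (α₀ p) (α₁ p) * Real.cosh (theta α₀ β₀ p) +
    Q.tB z (β₀ p) (β₁ p) * Real.sinh (theta α₀ β₀ p)

/-- The component of the tangency configuration along `v`, up to the factor `μ₀`. -/
def legV (Q : OneSheetedHyperboloid) (z : ℝ) (α₀ β₀ α₁ β₁ : ℝ × ℝ → ℝ) (p : ℝ × ℝ) : ℝ :=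
  Q.tA z (α₀ p) (α₁ p) * Real.sinh (theta α₀ β₀ p) +
    Q.tB z (β₀ p) (β₁ p) * Real.cosh (theta α₀ β₀ p)

theorem segU_eq (h : IsConjugateChart U α₀ β₀) (hp : p ∈ U) : segU Q z α₀ β₀ α₁ β₁ p =
    -(Real.cos (α₀ p) / Real.cos (α₁ p) * legU Q z α₀ β₀ α₁ β₁ p / lam α₀ β₀ p) := by
  rw [segU, legU, ← h.lam_mul_mu hp, h.pv_α_eq hp, h.pv_β_eq hp]
  have := h.lam_ne_zero hp
  have := h.mu_ne_zero hp
  field_simp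

theorem segV_eq (h : IsConjugateChart U α₀ β₀) (hp : p ∈ U) : segV Q z α₀ β₀ α₁ β₁ p =
    Real.cos (α₀ p) / Real.cos (α₁ p) * legV Q z α₀ β₀ α₁ β₁ p / mu α₀ β₀ p := by
  rw [segV, legV, ← h.lam_mul_mu hp, h.pu_α_eq hp, h.pu_β_eq hp]
  have := h.lam_ne_zero hp
  have := h.mu_ne_zero hp
  field_simp

/-- The hyperbolic rotation by `θ₀` preserves `T_β² - T_α²`. -/
theorem legV_sq_sub_legU_sq (hz : z ≤ 0) (hz' : Q.a₃ ≤ z)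
    (h : Q.tangencyForm z (α₀ p) (β₀ p) (α₁ p) (β₁ p) = 0) :
    legV Q z α₀ β₀ α₁ β₁ p ^ 2 - legU Q z α₀ β₀ α₁ β₁ p ^ 2 = -z * Q.H (α₁ p) (β₁ p) := by
  rw [legU, legV, ← Q.tB_sq_sub_tA_sq hz hz' h]
  linear_combination (Q.tB z (β₀ p) (β₁ p) ^ 2 - Q.tA z (α₀ p) (α₁ p) ^ 2) *
    Real.cosh_sq_sub_sinh_sq (theta α₀ β₀ p)

variable (h : IsTransform Q z U α₀ β₀ x₀ α₁ β₁ x₁) (hI : IsIsothermicConjugate Q 1 U α₀ β₀ x₀ N₀)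
  (hU : IsOpen U)
include h hI hU

/-- Along the normal of the seed the transform moves by the second fundamental form of the seed,
which is explicit in an isothermic-conjugate system. -/
theorem IsTransform.inner_normal_eq (hp : p ∈ U) :
    inner ℝ (N₀ p) (pu x₁ p) = -(mu α₀ β₀ p * legU Q z α₀ β₀ α₁ β₁ p /
      (√(Q.H (α₀ p) (β₀ p)) * Real.cos (α₁ p))) ∧
    inner ℝ (N₀ p) (pv x₁ p) = -(lam α₀ β₀ p * legV Q z α₀ β₀ α₁ β₁ p /
      (√(Q.H (α₀ p) (β₀ p)) * Real.cos (α₁ p))) := by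
  have hc := hI.common.isConjugateChart hU
  obtain ⟨e1, e2⟩ := hI.common.normal.inner_displaced h.seed.smooth_x hU hp
    (h.contDiffOn_seg hU).1 (h.contDiffOn_seg hU).2 h.position
  have c₀ := (h.seed.isChart.cos_pos p hp).ne'
  have c₁ := (h.leaf.isChart.cos_pos p hp).ne'
  have hH := (Real.sqrt_pos.2 (Q.H_pos (α₀ p) (β₀ p))).ne'
  have l0 := hc.lam_ne_zero hp
  have m0 := hc.mu_ne_zero hp
  rw [e1, e2, hI.common.conj_x p hp, hI.form_uu p hp, hI.form_vv p hp, segU_eq hc hp,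
    segV_eq hc hp]
  constructor <;> field_simp <;> ring

/-- The differential of the tangency equation, with the part of the seed in terms of the legs. -/
theorem IsTransform.leaf_tangent (hp : p ∈ U) :
    Q.tA z (α₁ p) (α₀ p) * pu α₁ p + Q.tB z (β₁ p) (β₀ p) * pu β₁ p =
      -(lam α₀ β₀ p * legU Q z α₀ β₀ α₁ β₁ p) ∧
    Q.tA z (α₁ p) (α₀ p) * pv α₁ p + Q.tB z (β₁ p) (β₀ p) * pv β₁ p =
      -(mu α₀ β₀ p * legV Q z α₀ β₀ α₁ β₁ p) := by
  have hc := hI.common.isConjugateChart hU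
  obtain ⟨e1, e2⟩ := h.tangent_deriv hU hp
  rw [hc.pu_α_eq hp, hc.pu_β_eq hp] at e1
  rw [hc.pv_α_eq hp, hc.pv_β_eq hp] at e2
  rw [legU, legV]
  constructor
  · linear_combination e1
  · linear_combination e2

/-- The two expressions of the component of `dx₁` along the normal of the seed agree up to sign. -/
theorem IsTransform.leaf_normal (hz : z ≤ 0) (hz' : Q.a₃ ≤ z) (hp : p ∈ U) :
    (Q.tB z (β₁ p) (β₀ p) * pu α₁ p + Q.tA z (α₁ p) (α₀ p) * pu β₁ p) ^ 2 =
      (mu α₀ β₀ p * legU Q z α₀ β₀ α₁ β₁ p) ^ 2 ∧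
    (Q.tB z (β₁ p) (β₀ p) * pu α₁ p + Q.tA z (α₁ p) (α₀ p) * pu β₁ p) *
      (Q.tB z (β₁ p) (β₀ p) * pv α₁ p + Q.tA z (α₁ p) (α₀ p) * pv β₁ p) =
      mu α₀ β₀ p * legU Q z α₀ β₀ α₁ β₁ p * (lam α₀ β₀ p * legV Q z α₀ β₀ α₁ β₁ p) := by
  obtain ⟨e1, e2⟩ := h.inner_normal_mul hI.common.normal hU hz hz' hp
  obtain ⟨n1, n2⟩ := h.inner_normal_eq hI hU hp
  have c₁ := (h.leaf.isChart.cos_pos p hp).ne'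
  have hH := (Real.sqrt_pos.2 (Q.H_pos (α₀ p) (β₀ p))).ne'
  rw [n1] at e1
  rw [n1, n2] at e2
  have hne := mul_ne_zero hH c₁
  constructor
  · rw [← neg_div, div_mul_div_comm, div_mul_div_comm, div_left_inj' (mul_ne_zero hne hne)] at e1
    linear_combination -e1
  · rw [← neg_div, ← neg_div, div_mul_div_comm, div_mul_div_comm,
      div_left_inj' (mul_ne_zero hne hne)] at e2
    linear_combination -e2

/-- A vanishing leg would make `dα₁` and `dβ₁` dependent. -/
theorem IsTransform.leg_ne_zero (hz : z < 0) (hz' : Q.a₃ ≤ z) (hp : p ∈ U) :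
    legU Q z α₀ β₀ α₁ β₁ p ≠ 0 ∧ legV Q z α₀ β₀ α₁ β₁ p ≠ 0 := by
  have hc := hI.common.isConjugateChart hU
  obtain ⟨t1, t2⟩ := h.leaf_tangent hI hU hp
  obtain ⟨s1, s2⟩ := h.leaf_normal hI hU hz.le hz' hp
  have T := h.tangent p hp
  rw [← Q.tangencyForm_comm] at T
  have key := Q.tB_sq_sub_tA_sq hz.le hz' T
  have hm : Q.tB z (β₁ p) (β₀ p) ^ 2 - Q.tA z (α₁ p) (α₀ p) ^ 2 ≠ 0 := by
    rw [key]
    exact mul_ne_zero (neg_ne_zero.2 hz.ne) (Q.H_pos _ _).ne'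
  have aux : ∀ a b : ℝ, Q.tB z (β₁ p) (β₀ p) * a + Q.tA z (α₁ p) (α₀ p) * b = 0 →
      Q.tA z (α₁ p) (α₀ p) * a + Q.tB z (β₁ p) (β₀ p) * b = 0 → a = 0 ∧ b = 0 := by
    intro a b e1 e2
    constructor
    · apply mul_left_cancel₀ hm
      linear_combination Q.tB z (β₁ p) (β₀ p) * e1 - Q.tA z (α₁ p) (α₀ p) * e2
    · apply mul_left_cancel₀ hm
      linear_combination Q.tB z (β₁ p) (β₀ p) * e2 - Q.tA z (α₁ p) (α₀ p) * e1
  have hP : legU Q z α₀ β₀ α₁ β₁ p ≠ 0 := by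
    intro h0
    rw [h0, mul_zero, neg_zero] at t1
    rw [h0, mul_zero, zero_pow two_ne_zero] at s1
    obtain ⟨e1, e2⟩ := aux _ _ (pow_eq_zero_iff two_ne_zero |>.1 s1) t1
    exact h.leaf.jac_ne_zero p hp (by rw [jac, e1, e2]; ring)
  refine ⟨hP, fun h0 => ?_⟩
  rw [h0, mul_zero, neg_zero] at t2
  rw [h0, mul_zero, mul_zero] at s2
  have hs : Q.tB z (β₁ p) (β₀ p) * pu α₁ p + Q.tA z (α₁ p) (α₀ p) * pu β₁ p ≠ 0 := by
    intro h1
    rw [h1, zero_pow two_ne_zero] at s1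
    exact mul_ne_zero (hc.mu_ne_zero hp) hP (pow_eq_zero_iff two_ne_zero |>.1 s1.symm)
  obtain ⟨e1, e2⟩ := aux _ _ ((mul_eq_zero.1 s2).resolve_left hs) t2
  exact h.leaf.jac_ne_zero p hp (by rw [jac, e1, e2]; ring)

/-- The values of `dα₁² - dβ₁²` follow by subtracting the squares of `leaf_tangent` from those of
`leaf_normal`. -/
theorem IsTransform.leaf_metric (hz : z < 0) (hz' : Q.a₃ ≤ z) (hp : p ∈ U) :
    -z * (pu α₁ p ^ 2 - pu β₁ p ^ 2) = legU Q z α₀ β₀ α₁ β₁ p ^ 2 ∧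
    pu α₁ p * pv α₁ p = pu β₁ p * pv β₁ p := by
  obtain ⟨t1, t2⟩ := h.leaf_tangent hI hU hp
  obtain ⟨s1, s2⟩ := h.leaf_normal hI hU hz.le hz' hp
  have T := h.tangent p hp
  rw [← Q.tangencyForm_comm] at T
  have key := Q.tB_sq_sub_tA_sq hz.le hz' T
  have hH := (Q.H_pos (α₀ p) (β₀ p)).ne'
  have hn := hI.normalized p hp
  constructor
  · apply mul_left_cancel₀ hH
    have t1' := congrArg (· ^ 2) t1
    linear_combination s1 - t1' - (pu α₁ p ^ 2 - pu β₁ p ^ 2) * key +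
      legU Q z α₀ β₀ α₁ β₁ p ^ 2 * hn
  · have t12 := congrArg₂ (· * ·) t1 t2
    apply mul_left_cancel₀ (mul_ne_zero (neg_ne_zero.2 hz.ne) hH)
    linear_combination s2 - t12 - (pu α₁ p * pv α₁ p - pu β₁ p * pv β₁ p) * key

/-- The system `(u, v)` is conjugate on the hyperboloid of the transform. -/
theorem IsTransform.isConjugateChart (hz : z < 0) (hz' : Q.a₃ ≤ z) : IsConjugateChart U α₁ β₁ where
  toIsChart := h.leaf.isChart
  jac_ne_zero := h.leaf.jac_ne_zero
  conj p hp := (h.leaf_metric hI hU hz hz' hp).2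
  pos p hp := by
    have e := (h.leaf_metric hI hU hz hz' hp).1
    have := (h.leg_ne_zero hI hU hz hz' hp).1
    have hpos : 0 < -z * (pu α₁ p ^ 2 - pu β₁ p ^ 2) := by rw [e]; positivity
    exact pos_of_mul_pos_right hpos (by linarith)

/-- The system `(u, v)` is conjugate on the transform. The deviation of the mixed derivative from
the combination valid on all confocal hyperboloids has no component tangent to the seed and none
tangent to the transform, while the normal of the seed is not normal to the transform. -/
theorem IsTransform.mixed (hz : z < 0) (hz' : Q.a₃ ≤ z) (hp : p ∈ U) :
    pu (pv x₁) p = mixedU α₁ β₁ p • pu x₁ p + mixedV α₁ β₁ p • pv x₁ p := by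
  have hc₀ := hI.common.isConjugateChart hU
  have hc₁ := h.isConjugateChart hI hU hz hz'
  have sm := h.seed.sameMetric
  have ry := h.seed.isChart.isRegular (Q := Q) hU h.seed.jac_ne_zero
  have hX := hc₀.mixed_X (Q := Q) (z := 0) hU hp (hc₀.jac_ne_zero p hp) (hc₀.conj p hp)
  have hx := sm.mixed hU ry hI.common.normal hp (hI.common.conj_x p hp) hX
  have hZ := hc₁.mixed_X (Q := Q) (z := z) hU hp (hc₁.jac_ne_zero p hp) (hc₁.conj p hp)
  have hX₁ : pu (pv (onQuadric Q α₁ β₁)) p = _ :=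
    hc₁.mixed_X (Q := Q) (z := 0) hU hp (hc₁.jac_ne_zero p hp) (hc₁.conj p hp)
  obtain ⟨t1, t2, t3, t4⟩ := h.inner_tangential hU hp
  have smZ := hc₁.contDiffOn_X (Q := Q) (z := z)
  have smX := hc₀.contDiffOn_X (Q := Q) (z := 0)
  -- differentiate the tangential products along the other coordinate
  obtain ⟨-, d1⟩ := HasPD.unique_of_eqOn hU hp
    ((hasPD_pu h.leaf.smooth_x hU hp).inner (hasPD_pu h.seed.smooth_x hU hp))
    ((hasPD_pu smZ hU hp).inner (hasPD_pu smX hU hp)) fun q hq => (h.inner_tangential hU hq).1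
  obtain ⟨d2, -⟩ := HasPD.unique_of_eqOn hU hp
    ((hasPD_pv h.leaf.smooth_x hU hp).inner (hasPD_pv h.seed.smooth_x hU hp))
    ((hasPD_pv smZ hU hp).inner (hasPD_pv smX hU hp)) fun q hq => (h.inner_tangential hU hq).2.2.2
  set Z : ℝ × ℝ → E3 := fun q => Q.X z (α₁ q) (β₁ q)
  change (_ : ℝ) = inner ℝ _ (pu (onQuadric Q α₀ β₀) p) + _ at d1
  change (_ : ℝ) = inner ℝ _ (pv (onQuadric Q α₀ β₀) p) + _ at d2
  change _ = _ • pu (onQuadric Q α₀ β₀) p + _ • pv (onQuadric Q α₀ β₀) p at hX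
  rw [hx, hX] at d1 d2
  simp only [inner_add_right, real_inner_smul_right, t1, t2, t3, t4, hZ] at d1 d2
  set c := pu (pv x₁) p - (mixedU α₁ β₁ p • pu x₁ p + mixedV α₁ β₁ p • pv x₁ p) with hcdef
  have cu : inner ℝ c (pu x₀ p) = 0 := by
    simp only [inner_add_left, real_inner_smul_left] at d1
    rw [hcdef]
    simp only [inner_sub_left, inner_add_left, real_inner_smul_left, t1, t3]
    linear_combination d1
  have cv : inner ℝ c (pv x₀ p) = 0 := by
    simp only [inner_add_left, real_inner_smul_left] at d2
    rw [hcdef]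
    simp only [inner_sub_left, inner_add_left, real_inner_smul_left, t2, t4]
    linear_combination d2
  have hN := hI.common.normal
  have nn : inner ℝ (N₀ p) (N₀ p) = (1 : ℝ) := by
    rw [real_inner_self_eq_norm_sq, hN.norm_eq_one p hp]; norm_num
  have ec : c = inner ℝ (N₀ p) c • N₀ p := by
    apply eq_of_inner_frame (hN.norm_eq_one p hp) (hN.orth_u p hp) (hN.orth_v p hp)
      (sm.isRegular ry p hp)
    · rw [cu, real_inner_smul_left, hN.orth_u p hp, mul_zero]
    · rw [cv, real_inner_smul_left, hN.orth_v p hp, mul_zero]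
    · rw [real_inner_smul_left, nn, mul_one, real_inner_comm]
  have cx : inner ℝ c (pu x₁ p) = 0 := by
    have s1 := h.leaf.sameMetric
    obtain ⟨-, -, e, -⟩ := s1.christoffel hU hp
    rw [hcdef]
    simp only [inner_sub_left, inner_add_left, real_inner_smul_left, e, hX₁, s1.uu p hp,
      real_inner_comm (pu x₁ p) (pv x₁ p), s1.uv p hp]
    change _ * inner ℝ (pu (onQuadric Q α₁ β₁) p) (pu (onQuadric Q α₁ β₁) p) +
      _ * inner ℝ (pv (onQuadric Q α₁ β₁) p) (pu (onQuadric Q α₁ β₁) p) - _ = _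
    rw [real_inner_comm (pu (onQuadric Q α₁ β₁) p) (pv (onQuadric Q α₁ β₁) p)]
    ring
  have hn : inner ℝ (N₀ p) (pu x₁ p) ≠ 0 := by
    rw [(h.inner_normal_eq hI hU hp).1]
    exact neg_ne_zero.2 (div_ne_zero
      (mul_ne_zero (hc₀.mu_ne_zero hp) (h.leg_ne_zero hI hU hz hz' hp).1)
      (mul_ne_zero (Real.sqrt_pos.2 (Q.H_pos _ _)).ne' (h.leaf.isChart.cos_pos p hp).ne'))
  rw [ec, real_inner_smul_left] at cx
  rw [(mul_eq_zero.1 cx).resolve_right hn, zero_smul] at ec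
  exact sub_eq_zero.1 ec

end Leaf

/-! ### The angle of the transform -/

section LeafAngle

variable {Q : OneSheetedHyperboloid} {z : ℝ} {U : Set (ℝ × ℝ)} {p : ℝ × ℝ}
  {α₀ β₀ α₁ β₁ : ℝ × ℝ → ℝ} {x₀ x₁ N₀ N₁ : ℝ × ℝ → E3}

theorem contDiffOn_tA (h₀ : IsChart U α₀ β₀) (h₁ : IsChart U α₁ β₁) :
    ContDiffOn ℝ ∞ (fun p => Q.tA z (α₀ p) (α₁ p)) U :=
  (h₀.smooth_α.sin.mul h₁.smooth_α.cos).sub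
    ((contDiffOn_const.mul h₀.smooth_α.cos).mul h₁.smooth_α.sin)

theorem contDiffOn_tB (h₀ : IsChart U α₀ β₀) (h₁ : IsChart U α₁ β₁) :
    ContDiffOn ℝ ∞ (fun p => Q.tB z (β₀ p) (β₁ p)) U :=
  ((contDiffOn_const.mul h₀.smooth_β.sin).mul h₁.smooth_β.cos).neg.add
    ((contDiffOn_const.mul h₀.smooth_β.cos).mul h₁.smooth_β.sin)

theorem contDiffOn_legU (hU : IsOpen U) (h₀ : IsConjugateChart U α₀ β₀) (h₁ : IsChart U α₁ β₁) :
    ContDiffOn ℝ ∞ (legU Q z α₀ β₀ α₁ β₁) U :=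
  ((contDiffOn_tA h₀.toIsChart h₁).mul (h₀.contDiffOn_theta hU).cosh).add
    ((contDiffOn_tB h₀.toIsChart h₁).mul (h₀.contDiffOn_theta hU).sinh)

/-- The relations between the angles, `λ` and `μ` of two deformations related by the
transformation, with the signs of the ruling family and of the leaf. -/
structure LeafRelations (Q : OneSheetedHyperboloid) (z ε ε' : ℝ) (α₀ β₀ α₁ β₁ : ℝ × ℝ → ℝ)
    (p : ℝ × ℝ) : Prop where
  ruling : Q.tB z (β₁ p) (β₀ p) * pu α₁ p + Q.tA z (α₁ p) (α₀ p) * pu β₁ p =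
    ε * (mu α₀ β₀ p * legU Q z α₀ β₀ α₁ β₁ p)
  ruling' : Q.tB z (β₁ p) (β₀ p) * pv α₁ p + Q.tA z (α₁ p) (α₀ p) * pv β₁ p =
    ε * (lam α₀ β₀ p * legV Q z α₀ β₀ α₁ β₁ p)
  legU : legU Q z α₀ β₀ α₁ β₁ p = ε' * √(-z) * lam α₁ β₁ p
  legV : legV Q z α₀ β₀ α₁ β₁ p = -(ε * ε' * √(-z) * mu α₁ β₁ p)
  legU' : QuadricDeformation.legU Q z α₁ β₁ α₀ β₀ p = -(ε' * √(-z) * lam α₀ β₀ p)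
  legV' : QuadricDeformation.legV Q z α₁ β₁ α₀ β₀ p = ε * ε' * √(-z) * mu α₀ β₀ p

section

variable (h : IsTransform Q z U α₀ β₀ x₀ α₁ β₁ x₁) (hI : IsIsothermicConjugate Q 1 U α₀ β₀ x₀ N₀)
  (hU : IsOpen U)
include h hI hU

/-- The functions whose squares are known have a constant sign on a connected set. The sign `ε`
compares the two expressions of the normal component of `dx₁`, and `ε'` compares `√(-z) λ₁` with a
leg. -/
theorem IsTransform.exists_leafRelations (hz : z < 0) (hz' : Q.a₃ ≤ z) (hc : IsPreconnected U) :
    ∃ ε ε' : ℝ, (ε = 1 ∨ ε = -1) ∧ (ε' = 1 ∨ ε' = -1) ∧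
      ∀ p ∈ U, LeafRelations Q z ε ε' α₀ β₀ α₁ β₁ p := by
  have hc₀ := hI.common.isConjugateChart hU
  have hc₁ := h.isConjugateChart hI hU hz hz'
  have hk : 0 < √(-z) := Real.sqrt_pos.2 (neg_pos.2 hz)
  have hk2 : √(-z) ^ 2 = -z := Real.sq_sqrt (neg_pos.2 hz).le
  have cP := contDiffOn_legU (Q := Q) (z := z) hU hc₀ hc₁.toIsChart
  have P0 : ∀ p ∈ U, legU Q z α₀ β₀ α₁ β₁ p ≠ 0 := fun p hp => (h.leg_ne_zero hI hU hz hz' hp).1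
  obtain ⟨ε, hε, He⟩ := exists_sign_of_sq_eq_one hc
    (f := fun p => (Q.tB z (β₁ p) (β₀ p) * pu α₁ p + Q.tA z (α₁ p) (α₀ p) * pu β₁ p) /
      (mu α₀ β₀ p * legU Q z α₀ β₀ α₁ β₁ p))
    (((((contDiffOn_tB hc₁.toIsChart hc₀.toIsChart).mul (contDiffOn_pu hc₁.smooth_α hU)).add
      ((contDiffOn_tA hc₁.toIsChart hc₀.toIsChart).mul (contDiffOn_pu hc₁.smooth_β hU))).div
      ((hc₀.contDiffOn_mu hU).mul cP)
      fun p hp => mul_ne_zero (hc₀.mu_ne_zero hp) (P0 p hp)).continuousOn)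
    (fun p hp => by
      have m0 := mul_ne_zero (hc₀.mu_ne_zero hp) (P0 p hp)
      rw [div_pow, (h.leaf_normal hI hU hz.le hz' hp).1, div_self (pow_ne_zero 2 m0)])
  obtain ⟨ε', hε', He'⟩ := exists_sign_of_sq_eq_one hc
    (f := fun p => √(-z) * lam α₁ β₁ p / legU Q z α₀ β₀ α₁ β₁ p)
    (((contDiffOn_const.mul (hc₁.contDiffOn_lam hU)).div cP P0).continuousOn)
    (fun p hp => by
      have m0 := P0 p hp
      rw [div_pow, mul_pow, hk2, hc₁.lam_sq hp, (h.leaf_metric hI hU hz hz' hp).1,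
        div_self (pow_ne_zero 2 m0)])
  have hε2 : ε * ε = 1 := by rcases hε with rfl | rfl <;> norm_num
  have hε2' : ε' * ε' = 1 := by rcases hε' with rfl | rfl <;> norm_num
  refine ⟨ε, ε', hε, hε', fun p hp => ?_⟩
  have m0 := mul_ne_zero (hc₀.mu_ne_zero hp) (P0 p hp)
  have e1 : Q.tB z (β₁ p) (β₀ p) * pu α₁ p + Q.tA z (α₁ p) (α₀ p) * pu β₁ p =
      ε * (mu α₀ β₀ p * legU Q z α₀ β₀ α₁ β₁ p) := (div_eq_iff m0).1 (He p hp)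
  have e2 : Q.tB z (β₁ p) (β₀ p) * pv α₁ p + Q.tA z (α₁ p) (α₀ p) * pv β₁ p =
      ε * (lam α₀ β₀ p * legV Q z α₀ β₀ α₁ β₁ p) := by
    have s := (h.leaf_normal hI hU hz.le hz' hp).2
    rw [e1] at s
    apply mul_left_cancel₀ m0
    linear_combination ε * s - mu α₀ β₀ p * legU Q z α₀ β₀ α₁ β₁ p *
      (Q.tB z (β₁ p) (β₀ p) * pv α₁ p + Q.tA z (α₁ p) (α₀ p) * pv β₁ p) * hε2
  have e3 : legU Q z α₀ β₀ α₁ β₁ p = ε' * √(-z) * lam α₁ β₁ p := by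
    have := (div_eq_iff (P0 p hp)).1 (He' p hp)
    linear_combination (-ε') * this - legU Q z α₀ β₀ α₁ β₁ p * hε2'
  obtain ⟨t1, t2⟩ := h.leaf_tangent hI hU hp
  have l1 := hc₁.lam_ne_zero hp
  have m1 := hc₁.mu_ne_zero hp
  -- in terms of the angle of the leaf the four relations determine its two legs
  have f1 : legV Q z α₁ β₁ α₀ β₀ p = ε * ε' * √(-z) * mu α₀ β₀ p := by
    rw [hc₁.pu_α_eq hp, hc₁.pu_β_eq hp, e3] at e1
    apply mul_left_cancel₀ l1
    rw [legV]
    linear_combination e1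
  have f2 : legU Q z α₁ β₁ α₀ β₀ p = -(ε' * √(-z) * lam α₀ β₀ p) := by
    rw [hc₁.pu_α_eq hp, hc₁.pu_β_eq hp, e3] at t1
    apply mul_left_cancel₀ l1
    rw [legU]
    linear_combination t1
  refine ⟨e1, e2, e3, ?_, f2, f1⟩
  rw [hc₁.pv_α_eq hp, hc₁.pv_β_eq hp] at t2
  rw [legV] at f1
  apply mul_left_cancel₀ (hc₀.mu_ne_zero hp)
  linear_combination t2 - mu α₁ β₁ p * f1

end

theorem LeafRelations.normalized {ε ε' : ℝ} (hε : ε = 1 ∨ ε = -1) (hε' : ε' = 1 ∨ ε' = -1)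
    (r : LeafRelations Q z ε ε' α₀ β₀ α₁ β₁ p) (hz : z < 0) (hz' : Q.a₃ ≤ z)
    (h : Q.tangencyForm z (α₀ p) (β₀ p) (α₁ p) (β₁ p) = 0) :
    mu α₁ β₁ p ^ 2 - lam α₁ β₁ p ^ 2 = 1 * Q.H (α₁ p) (β₁ p) := by
  have hk2 : √(-z) ^ 2 = -z := Real.sq_sqrt (neg_pos.2 hz).le
  have hε2 : ε ^ 2 = 1 := by rcases hε with rfl | rfl <;> norm_num
  have hε2' : ε' ^ 2 = 1 := by rcases hε' with rfl | rfl <;> norm_num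
  have e := legV_sq_sub_legU_sq hz.le hz' h
  rw [r.legU, r.legV, neg_sq, mul_pow, mul_pow, mul_pow, mul_pow, mul_pow, hk2, hε2, hε2'] at e
  apply mul_left_cancel₀ (neg_ne_zero.2 hz.ne)
  linear_combination e

theorem algebraicRelations_of_leaf {ε ε' : ℝ}
    (r : ∀ p ∈ U, LeafRelations Q z ε ε' α₀ β₀ α₁ β₁ p) :
    AlgebraicRelations Q z ε ε' U α₀ β₀ α₁ β₁ ∧ AlgebraicRelations Q z ε (-ε') U α₁ β₁ α₀ β₀ := by
  constructor
  · intro p hp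
    have e1 := (r p hp).legU
    have e2 := (r p hp).legV
    rw [legU, OneSheetedHyperboloid.tA, OneSheetedHyperboloid.tB] at e1
    rw [legV, OneSheetedHyperboloid.tA, OneSheetedHyperboloid.tB] at e2
    have hcs := Real.cosh_sq_sub_sinh_sq (theta α₀ β₀ p)
    constructor
    · linear_combination Real.cosh (theta α₀ β₀ p) * e1 - Real.sinh (theta α₀ β₀ p) * e2 -
        (Real.sin (α₀ p) * Real.cos (α₁ p) - Q.r₃ z * Real.cos (α₀ p) * Real.sin (α₁ p)) * hcs
    · linear_combination Real.cosh (theta α₀ β₀ p) * e2 - Real.sinh (theta α₀ β₀ p) * e1 -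
        (-(Q.r₁ z * Real.sin (β₀ p) * Real.cos (β₁ p)) +
          Q.r₂ z * Real.cos (β₀ p) * Real.sin (β₁ p)) * hcs
  · intro p hp
    have e1 := (r p hp).legU'
    have e2 := (r p hp).legV'
    rw [legU, OneSheetedHyperboloid.tA, OneSheetedHyperboloid.tB] at e1
    rw [legV, OneSheetedHyperboloid.tA, OneSheetedHyperboloid.tB] at e2
    have hcs := Real.cosh_sq_sub_sinh_sq (theta α₁ β₁ p)
    constructor
    · linear_combination Real.cosh (theta α₁ β₁ p) * e1 - Real.sinh (theta α₁ β₁ p) * e2 -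
        (Real.sin (α₁ p) * Real.cos (α₀ p) - Q.r₃ z * Real.cos (α₁ p) * Real.sin (α₀ p)) * hcs
    · linear_combination Real.cosh (theta α₁ β₁ p) * e2 - Real.sinh (theta α₁ β₁ p) * e1 -
        (-(Q.r₁ z * Real.sin (β₁ p) * Real.cos (β₀ p)) +
          Q.r₂ z * Real.cos (β₁ p) * Real.sin (β₀ p)) * hcs

/-- The first-order relations between the angles: the derivatives of `legU` in `v` and of `legV`
in `u`, where the integrability conditions of both deformations apply. -/
theorem backlundRelations_of_leaf {ε ε' : ℝ} (hε : ε = 1 ∨ ε = -1) (hε' : ε' = 1 ∨ ε' = -1)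
    (hU : IsOpen U) (hz : z < 0) (h₀ : IsConjugateChart U α₀ β₀) (h₁ : IsConjugateChart U α₁ β₁)
    (hT : ∀ p ∈ U, Q.tangencyForm z (α₀ p) (β₀ p) (α₁ p) (β₁ p) = 0)
    (r : ∀ p ∈ U, LeafRelations Q z ε ε' α₀ β₀ α₁ β₁ p) :
    BacklundRelations Q z ε ε' U α₀ β₀ (theta α₀ β₀) α₁ β₁ (theta α₁ β₁) := by
  intro p hp
  have hk : √(-z) ≠ 0 := (Real.sqrt_pos.2 (neg_pos.2 hz)).ne'
  have hε2 : ε * ε = 1 := by rcases hε with rfl | rfl <;> norm_num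
  have hε2' : ε' * ε' = 1 := by rcases hε' with rfl | rfl <;> norm_num
  have a0 := h₀.hasPD_α hU hp
  have b0 := h₀.hasPD_β hU hp
  have a1 := h₁.hasPD_α hU hp
  have b1 := h₁.hasPD_β hU hp
  have t := HasPD.of_contDiffOn (h₀.contDiffOn_theta hU) hU hp
  have l := HasPD.of_contDiffOn (h₁.contDiffOn_lam hU) hU hp
  have m := HasPD.of_contDiffOn (h₁.contDiffOn_mu hU) hU hp
  have A := (a0.sin.mul a1.cos).sub (((HasPD.const (Q.r₃ z)).mul a0.cos).mul a1.sin)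
  have B := (((HasPD.const (Q.r₁ z)).mul b0.sin).mul b1.cos).neg.add
    (((HasPD.const (Q.r₂ z)).mul b0.cos).mul b1.sin)
  obtain ⟨-, e1⟩ := HasPD.unique_of_eqOn hU hp ((A.mul t.cosh).add (B.mul t.sinh))
    ((HasPD.const (ε' * √(-z))).mul l) fun q hq => (r q hq).legU
  obtain ⟨e2, -⟩ := HasPD.unique_of_eqOn hU hp ((A.mul t.sinh).add (B.mul t.cosh))
    ((HasPD.const (ε * ε' * √(-z))).mul m).neg fun q hq => (r q hq).legV
  have rU := (r p hp).legU
  have rV := (r p hp).legV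
  have T := hT p hp
  rw [legU, OneSheetedHyperboloid.tA, OneSheetedHyperboloid.tB] at rU
  rw [legV, OneSheetedHyperboloid.tA, OneSheetedHyperboloid.tB] at rV
  rw [OneSheetedHyperboloid.tangencyForm] at T
  rw [(h₁.compatibility hU hp).1, h₀.pv_α_eq hp, h₀.pv_β_eq hp, h₁.pv_α_eq hp, h₁.pv_β_eq hp] at e1
  rw [(h₁.compatibility hU hp).2, h₀.pu_α_eq hp, h₀.pu_β_eq hp, h₁.pu_α_eq hp, h₁.pu_β_eq hp] at e2
  constructor
  · rw [div_mul_eq_mul_div, eq_div_iff hk]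
    apply mul_left_cancel₀ (h₁.lam_ne_zero hp)
    linear_combination ε' * e2 - ε' * pu (theta α₀ β₀) p * rU -
      lam α₁ β₁ p * √(-z) * (pu (theta α₀ β₀) p + ε * pv (theta α₁ β₁) p) * hε2' +
      ε' * lam α₀ β₀ p * Real.cosh (theta α₀ β₀ p) * Real.sinh (theta α₀ β₀ p) * T
  · rw [div_mul_eq_mul_div, eq_div_iff hk]
    apply mul_left_cancel₀ (h₁.mu_ne_zero hp)
    linear_combination (-(ε * ε')) * e1 + ε * ε' * pv (theta α₀ β₀) p * rV -
      mu α₁ β₁ p * √(-z) * (ε ^ 2 * pv (theta α₀ β₀) p + ε * pu (theta α₁ β₁) p) * hε2' -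
      mu α₁ β₁ p * √(-z) * pv (theta α₀ β₀) p * hε2 -
      ε * ε' * mu α₀ β₀ p * Real.cosh (theta α₀ β₀ p) * Real.sinh (theta α₀ β₀ p) * T

/-- The square of the first coefficient of the second fundamental form determines it up to a
constant sign, and the Gauss equation then gives the last coefficient. -/
theorem IsCommonConjugate.exists_sign_isIsothermicConjugate {s : ℝ} {x N : ℝ × ℝ → E3}
    (h : IsCommonConjugate Q U α₁ β₁ x N) (hU : IsOpen U) (hc : IsPreconnected U)
    (h11 : ∀ p ∈ U, h₁₁ x N p ^ 2 = (lam α₁ β₁ p * mu α₁ β₁ p /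
      (Real.cos (α₁ p) * √(Q.H (α₁ p) (β₁ p)))) ^ 2)
    (hn : ∀ p ∈ U, mu α₁ β₁ p ^ 2 - lam α₁ β₁ p ^ 2 = s * Q.H (α₁ p) (β₁ p)) :
    ∃ σ : ℝ, (σ = 1 ∨ σ = -1) ∧ IsIsothermicConjugate Q s U α₁ β₁ x (fun p => σ • N p) := by
  have hc₁ := h.isConjugateChart hU
  have hN := h.normal
  have sm := h.deformation.sameMetric
  have ry := hc₁.isRegular (Q := Q) hU h.deformation.jac_ne_zero
  have D0 : ∀ p ∈ U, Real.cos (α₁ p) * √(Q.H (α₁ p) (β₁ p)) ≠ 0 := fun p hp =>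
    mul_ne_zero (hc₁.cos_pos p hp).ne' (Real.sqrt_pos.2 (Q.H_pos _ _)).ne'
  have L0 : ∀ p ∈ U, lam α₁ β₁ p * mu α₁ β₁ p /
      (Real.cos (α₁ p) * √(Q.H (α₁ p) (β₁ p))) ≠ 0 := fun p hp =>
    div_ne_zero (mul_ne_zero (hc₁.lam_ne_zero hp) (hc₁.mu_ne_zero hp)) (D0 p hp)
  obtain ⟨σ, hσ, hs⟩ := exists_sign_of_sq_eq_one hc
    (f := fun p => h₁₁ x N p / (lam α₁ β₁ p * mu α₁ β₁ p /
      (Real.cos (α₁ p) * √(Q.H (α₁ p) (β₁ p)))))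
    ((hN.contDiffOn_form h.deformation.smooth_x hU).1.continuousOn.div
      (((hc₁.contDiffOn_lam hU).continuousOn.mul (hc₁.contDiffOn_mu hU).continuousOn).div
        (hc₁.smooth_α.cos.continuousOn.mul (ContinuousOn.sqrt fun p hp =>
          (hc₁.hasPD_H (Q := Q) hU hp).diff.continuousAt.continuousWithinAt)) D0) L0)
    fun p hp => by rw [div_pow, h11 p hp, div_self (pow_ne_zero 2 (L0 p hp))]
  have hσ2 : σ * σ = 1 := by rcases hσ with rfl | rfl <;> norm_num
  have f11 : ∀ p ∈ U, σ * h₁₁ x N p = lam α₁ β₁ p * mu α₁ β₁ p /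
      (Real.cos (α₁ p) * √(Q.H (α₁ p) (β₁ p))) := fun p hp => by
    rw [(div_eq_iff (L0 p hp)).1 (hs p hp), ← mul_assoc, hσ2, one_mul]
  refine ⟨σ, hσ, ⟨h.deformation, hN.smul hσ, h.conj_quadric, fun p hp => ?_, h.pos⟩,
    fun p hp => ?_, fun p hp => ?_, hn⟩
  · rw [(form_smul σ).2.1, h.conj_x p hp, mul_zero]
  · rw [(form_smul σ).1, f11 p hp]
  · rw [(form_smul σ).2.2]
    have g := sm.gauss hU ry hN (hc₁.isUnitNormal hU) hp
    obtain ⟨q1, q2, q3⟩ := hc₁.second_form (Q := Q) hU hp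
    rw [q1, q2, q3, h.conj_x p hp, hc₁.conj p hp, ← hc₁.lam_sq hp, ← hc₁.mu_sq hp] at g
    apply mul_left_cancel₀ (L0 p hp)
    have f := f11 p hp
    rw [← f]
    have e : σ * h₁₁ x N p * (σ * h₂₂ x N p) = h₁₁ x N p * h₂₂ x N p := by
      linear_combination h₁₁ x N p * h₂₂ x N p * hσ2
    rw [e, f]
    linear_combination g

/-- The transformation is symmetric, so the second fundamental form of the transform can be read off
from the normal component of the differential of the seed along the transform. -/
theorem IsTransform.exists_isIsothermicConjugate (h : IsTransform Q z U α₀ β₀ x₀ α₁ β₁ x₁)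
    (hI : IsIsothermicConjugate Q 1 U α₀ β₀ x₀ N₀) (hU : IsOpen U) (hz : z < 0) (hz' : Q.a₃ ≤ z)
    (hc : IsPreconnected U) {ε ε' : ℝ} (hε : ε = 1 ∨ ε = -1) (hε' : ε' = 1 ∨ ε' = -1)
    (r : ∀ p ∈ U, LeafRelations Q z ε ε' α₀ β₀ α₁ β₁ p) :
    ∃ N₁ : ℝ × ℝ → E3, IsIsothermicConjugate Q 1 U α₁ β₁ x₁ N₁ := by
  have hc₀ := hI.common.isConjugateChart hU
  have hc₁ := h.isConjugateChart hI hU hz hz'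
  have sm := h.leaf.sameMetric
  have ry := hc₁.isRegular (Q := Q) hU h.leaf.jac_ne_zero
  obtain ⟨N, hN⟩ := exists_isUnitNormal h.leaf.smooth_x hU (sm.isRegular ry)
  have h12 : ∀ p ∈ U, h₁₂ x₁ N p = 0 := fun p hp => by
    rw [h₁₂, h.mixed hI hU hz hz' hp, inner_add_right, real_inner_smul_right,
      real_inner_smul_right, hN.orth_u p hp, hN.orth_v p hp, mul_zero, mul_zero, add_zero]
  have hk : √(-z) ≠ 0 := (Real.sqrt_pos.2 (neg_pos.2 hz)).ne'
  have hε2 : ε ^ 2 = 1 := by rcases hε with rfl | rfl <;> norm_num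
  have hε2' : ε' ^ 2 = 1 := by rcases hε' with rfl | rfl <;> norm_num
  have hs := h.symm hU hz.le hz'
  -- the square of the form, from the symmetry of the transformation
  have h11 : ∀ p ∈ U, h₁₁ x₁ N p ^ 2 = (lam α₁ β₁ p * mu α₁ β₁ p /
      (Real.cos (α₁ p) * √(Q.H (α₁ p) (β₁ p)))) ^ 2 := fun p hp => by
    have e1 := (hN.inner_displaced h.leaf.smooth_x hU hp (hs.contDiffOn_seg hU).1
      (hs.contDiffOn_seg hU).2 hs.position).1
    have e2 := (hs.inner_normal_mul hN hU hz.le hz' hp).1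
    have rV := (r p hp).legV
    rw [legV] at rV
    have e3 : Q.tB z (β₀ p) (β₁ p) * pu α₀ p + Q.tA z (α₀ p) (α₁ p) * pu β₀ p =
        -(lam α₀ β₀ p * (ε * ε' * √(-z) * mu α₁ β₁ p)) := by
      rw [hc₀.pu_α_eq hp, hc₀.pu_β_eq hp]
      linear_combination lam α₀ β₀ p * rV
    rw [e1, h12 p hp, segU_eq hc₁ hp, (r p hp).legU', e3] at e2
    have c₀ := (hc₀.cos_pos p hp).ne'
    have c₁ := (hc₁.cos_pos p hp).ne'
    have hH := (Real.sqrt_pos.2 (Q.H_pos (α₁ p) (β₁ p))).ne'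
    have l0 := hc₀.lam_ne_zero hp
    have l1 := hc₁.lam_ne_zero hp
    have hk' : ε' * √(-z) * lam α₀ β₀ p ≠ 0 :=
      mul_ne_zero (mul_ne_zero (by rintro rfl; norm_num at hε2') hk) l0
    have x0 : Real.cos (α₁ p) * (ε' * √(-z) * lam α₀ β₀ p) / (Real.cos (α₀ p) * lam α₁ β₁ p) ≠ 0 :=
      div_ne_zero (mul_ne_zero c₁ hk') (mul_ne_zero c₀ l1)
    have e4 : Real.cos (α₁ p) * (ε' * √(-z) * lam α₀ β₀ p) / (Real.cos (α₀ p) * lam α₁ β₁ p) *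
        (lam α₁ β₁ p * mu α₁ β₁ p / (Real.cos (α₁ p) * √(Q.H (α₁ p) (β₁ p)))) =
        ε' * √(-z) * lam α₀ β₀ p * mu α₁ β₁ p / (√(Q.H (α₁ p) (β₁ p)) * Real.cos (α₀ p)) := by
      field_simp
    apply mul_left_cancel₀ (pow_ne_zero 2 x0)
    rw [← mul_pow, ← mul_pow, e4]
    linear_combination e2 + (ε' * √(-z) * lam α₀ β₀ p * mu α₁ β₁ p /
      (√(Q.H (α₁ p) (β₁ p)) * Real.cos (α₀ p))) ^ 2 * hε2
  obtain ⟨σ, -, hσ⟩ := IsCommonConjugate.exists_sign_isIsothermicConjugate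
    ⟨h.leaf, hN, fun p hp => by rw [(hc₁.second_form hU hp).2.1, hc₁.conj p hp, sub_self, zero_div],
      h12, hc₁.pos⟩ hU hc h11 fun p hp => (r p hp).normalized hε hε' hz hz' (h.tangent p hp)
  exact ⟨_, hσ⟩

end LeafAngle

/-! ### The Bäcklund transformation -/

section TransformTheorem

variable {Q : OneSheetedHyperboloid} {z : ℝ} {U : Set (ℝ × ℝ)}
  {α₀ β₀ α₁ β₁ : ℝ × ℝ → ℝ} {x₀ x₁ N₀ : ℝ × ℝ → E3}

/-- The segment joining corresponding points is tangent to the seed, so `⟨N₀, x₁ - x₀⟩ = 0`;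
differentiating this reduces the sign of the ruling family to `LeafRelations.ruling`. -/
theorem IsTransform.rulingSign (h : IsTransform Q z U α₀ β₀ x₀ α₁ β₁ x₁)
    (hI : IsIsothermicConjugate Q 1 U α₀ β₀ x₀ N₀) (hU : IsOpen U) {ε ε' : ℝ}
    (hε : ε = 1 ∨ ε = -1) (r : ∀ p ∈ U, LeafRelations Q z ε ε' α₀ β₀ α₁ β₁ p) :
    RulingSign Q z ε U α₀ β₀ x₀ N₀ α₁ β₁ x₁ := by
  intro p hp
  have hε2 : ε * ε = 1 := by rcases hε with rfl | rfl <;> norm_num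
  have hN := hI.common.normal
  have dN := HasPD.of_contDiffOn hN.smooth hU hp
  have dx₀ := HasPD.of_contDiffOn h.seed.smooth_x hU hp
  have dx₁ := HasPD.of_contDiffOn h.leaf.smooth_x hU hp
  obtain ⟨e1, e2⟩ := HasPD.unique_of_eqOn hU hp (dN.inner (dx₁.sub dx₀)) (HasPD.const 0)
    fun q hq => by
      rw [h.position q hq, add_assoc, add_sub_cancel_left, inner_add_right, real_inner_smul_right,
        real_inner_smul_right, hN.orth_u q hq, hN.orth_v q hq, mul_zero, mul_zero, add_zero]
  rw [inner_sub_right (N₀ p), hN.orth_u p hp] at e1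
  rw [inner_sub_right (N₀ p), hN.orth_v p hp] at e2
  obtain ⟨n1, n2⟩ := h.inner_normal_eq hI hU hp
  rw [n1] at e1
  rw [n2] at e2
  have c₀ := h.seed.isChart.cos_pos p hp
  have c₁ := (h.leaf.isChart.cos_pos p hp).ne'
  have hH := (Real.sqrt_pos.2 (Q.H_pos (α₀ p) (β₀ p))).ne'
  have T := h.tangent p hp
  rw [← Q.tangencyForm_comm] at T
  -- the right-hand sides of the two equations
  have key : ∀ a b : ℝ, inner ℝ (quadricNormal Q α₀ β₀ p)
      (a • Q.Xβ z (α₁ p) (β₁ p) + b • Q.Xα z (α₁ p) (β₁ p)) =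
      (Q.tB z (β₁ p) (β₀ p) * a + Q.tA z (α₁ p) (α₀ p) * b) /
        (√(Q.H (α₀ p) (β₀ p)) * Real.cos (α₁ p)) := fun a b => by
    rw [quadricNormal, Q.N₀_eq c₀]
    simp only [inner_add_right, real_inner_smul_left, real_inner_smul_right,
      real_inner_comm (Q.Xβ _ _ _) (Q.Nhat _ _), real_inner_comm (Q.Xα _ _ _) (Q.Nhat _ _),
      Q.inner_Xβ_Nhat, Q.inner_Xα_Nhat c₁ c₀.ne' T]
    have := c₀.ne'
    field_simp
  rw [key, key, (r p hp).ruling, (r p hp).ruling']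
  constructor
  · linear_combination e1 - mu α₀ β₀ p * legU Q z α₀ β₀ α₁ β₁ p /
      (√(Q.H (α₀ p) (β₀ p)) * Real.cos (α₁ p)) * hε2
  · linear_combination e2 - lam α₀ β₀ p * legV Q z α₀ β₀ α₁ β₁ p /
      (√(Q.H (α₀ p) (β₀ p)) * Real.cos (α₁ p)) * hε2

theorem IsBacklundTransform.isothermicConjugate (hz' : Q.a₃ < z) (hz : z < 0) (hU : IsOpen U)
    (hc : IsPreconnected U) (hI : IsIsothermicConjugate Q 1 U α₀ β₀ x₀ N₀)
    (hB : IsBacklundTransform Q z U α₀ β₀ x₀ α₁ β₁ x₁) :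
    (∃ N₁ : ℝ × ℝ → E3, IsIsothermicConjugate Q 1 U α₁ β₁ x₁ N₁) ∧
      AngleEquations Q 1 U α₁ β₁ ∧
      ∃ ε ε' : ℝ, (ε = 1 ∨ ε = -1) ∧ (ε' = 1 ∨ ε' = -1) ∧
        RulingSign Q z ε U α₀ β₀ x₀ N₀ α₁ β₁ x₁ ∧
        AlgebraicRelations Q z ε ε' U α₀ β₀ α₁ β₁ ∧
        AlgebraicRelations Q z ε (-ε') U α₁ β₁ α₀ β₀ ∧
        BacklundRelations Q z ε ε' U α₀ β₀ (theta α₀ β₀) α₁ β₁ (theta α₁ β₁) := by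
  have h := hB.isTransform hI.common.deformation
  obtain ⟨ε, ε', hε, hε', r⟩ := h.exists_leafRelations hI hU hz hz'.le hc
  obtain ⟨N₁, h₁⟩ := h.exists_isIsothermicConjugate hI hU hz hz'.le hc hε hε' r
  obtain ⟨a, a'⟩ := algebraicRelations_of_leaf r
  exact ⟨⟨N₁, h₁⟩, (h₁.common.isConjugateChart hU).angleEquations hU h₁.normalized, ε, ε', hε, hε',
    h.rulingSign hI hU hε r, a, a', backlundRelations_of_leaf hε hε' hU hz
      (hI.common.isConjugateChart hU) (h₁.common.isConjugateChart hU) h.tangent r⟩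

end TransformTheorem

/-! ### Two functions of a single variable -/

section Separation

variable {Q : OneSheetedHyperboloid} {U : Set (ℝ × ℝ)} {p : ℝ × ℝ} {α β : ℝ × ℝ → ℝ}
  {x N : ℝ × ℝ → E3}

/-- The derivatives of `α_u² - β_u²` in `v` and of `β_v² - α_v²` in `u`, halved, in terms of the
coefficients of the mixed derivative. -/
theorem IsConjugateChart.mixed_mul (h : IsConjugateChart U α β) (hp : p ∈ U) :
    pu α p * pu (pv α) p - pu β p * pu (pv β) p =
      (mixedU α β p - Real.tan (α p) * pv α p) * (pu α p ^ 2 - pu β p ^ 2) ∧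
    pv β p * pu (pv β) p - pv α p * pu (pv α) p =
      (mixedV α β p - Real.tan (α p) * pu α p) * (pv β p ^ 2 - pv α p ^ 2) := by
  have hj := h.jac_ne_zero p hp
  have c := h.conj p hp
  constructor
  · rw [mixedU]
    field_simp
    rw [jac]
    linear_combination (pu α p * pu (pv β) p - pu β p * pu (pv α) p) * c
  · rw [mixedV]
    field_simp
    rw [jac]
    linear_combination (pv α p * pu (pv β) p - pv β p * pu (pv α) p) * c

/-- The difference of the squares of `h₁₁` for `x` and for the quadric, measured by the `u`-part of
the second fundamental form of the quadric; by the Codazzi equations it depends on `u` alone. -/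
def separationU (Q : OneSheetedHyperboloid) (α β : ℝ × ℝ → ℝ) (x N : ℝ × ℝ → E3) (p : ℝ × ℝ) : ℝ :=
  (h₁₁ x N p ^ 2 - h₁₁ (onQuadric Q α β) (quadricNormal Q α β) p ^ 2) * Real.cos (α p) ^ 2 /
    (pu α p ^ 2 - pu β p ^ 2)

/-- The difference of the squares of `h₂₂` for `x` and for the quadric, measured by the `v`-part of
the second fundamental form of the quadric; by the Codazzi equations it depends on `v` alone. -/
def separationV (Q : OneSheetedHyperboloid) (α β : ℝ × ℝ → ℝ) (x N : ℝ × ℝ → E3) (p : ℝ × ℝ) : ℝ :=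
  (h₂₂ x N p ^ 2 - h₂₂ (onQuadric Q α β) (quadricNormal Q α β) p ^ 2) * Real.cos (α p) ^ 2 /
    (pv β p ^ 2 - pv α p ^ 2)

theorem IsConjugateChart.pv_sq_pos (h : IsConjugateChart U α β) (hp : p ∈ U) :
    0 < pv β p ^ 2 - pv α p ^ 2 := by
  rw [← h.mu_sq hp]
  have := h.mu_ne_zero hp
  positivity

variable (h : IsCommonConjugate Q U α β x N) (hU : IsOpen U)
include h hU

theorem IsCommonConjugate.contDiffOn_separation : ContDiffOn ℝ ∞ (separationU Q α β x N) U ∧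
    ContDiffOn ℝ ∞ (separationV Q α β x N) U := by
  have hc := h.isConjugateChart hU
  have hM := hc.isUnitNormal (Q := Q) hU
  obtain ⟨a1, a2⟩ := h.normal.contDiffOn_form h.deformation.smooth_x hU
  obtain ⟨b1, b2⟩ := hM.contDiffOn_form hc.contDiffOn_X hU
  have au := contDiffOn_pu hc.smooth_α hU
  have av := contDiffOn_pv hc.smooth_α hU
  have bu := contDiffOn_pu hc.smooth_β hU
  have bv := contDiffOn_pv hc.smooth_β hU
  exact ⟨(((a1.pow 2).sub (b1.pow 2)).mul (hc.smooth_α.cos.pow 2)).div ((au.pow 2).sub (bu.pow 2))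
      fun p hp => (h.pos p hp).ne',
    (((a2.pow 2).sub (b2.pow 2)).mul (hc.smooth_α.cos.pow 2)).div ((bv.pow 2).sub (av.pow 2))
      fun p hp => (hc.pv_sq_pos hp).ne'⟩

/-- The Codazzi equations of `x` and of the quadric have the same coefficients, and the Gauss
equation cancels the terms with both principal coefficients. -/
theorem IsCommonConjugate.separation_deriv_eq_zero (hp : p ∈ U) :
    pv (separationU Q α β x N) p = 0 ∧ pu (separationV Q α β x N) p = 0 := by
  have hc := h.isConjugateChart hU
  have hM := hc.isUnitNormal (Q := Q) hU
  have sm := h.deformation.sameMetric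
  have ry := hc.isRegular (Q := Q) hU h.deformation.jac_ne_zero
  obtain ⟨a1, a2⟩ := h.normal.contDiffOn_form h.deformation.smooth_x hU
  obtain ⟨b1, b2⟩ := hM.contDiffOn_form hc.contDiffOn_X hU
  have hab := hc.mixed_X (Q := Q) (z := 0) hU hp (hc.jac_ne_zero p hp) (hc.conj p hp)
  obtain ⟨y1, y2⟩ := hM.codazzi hc.contDiffOn_X hU ry hp h.conj_quadric hab
  obtain ⟨x1, x2⟩ := h.normal.codazzi h.deformation.smooth_x hU (sm.isRegular ry) hp h.conj_x
    (sm.mixed hU ry h.normal hp (h.conj_x p hp) hab)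
  obtain ⟨c1, c2, c3, c4, c5, c6⟩ := sm.christoffel hU hp
  have g := sm.gauss hU ry h.normal hM hp
  rw [h.conj_x p hp, h.conj_quadric p hp] at g
  rw [sm.uu p hp, sm.uv p hp, sm.vv p hp] at x1 x2
  rw [c1, c2] at x1
  rw [c5, c6] at x2
  obtain ⟨m1, m2⟩ := hc.mixed_mul hp
  have a := hc.hasPD_α hU hp
  have au := hasPD_pu hc.smooth_α hU hp
  have av := hasPD_pv hc.smooth_α hU hp
  have bu := hasPD_pu hc.smooth_β hU hp
  have bv := hasPD_pv hc.smooth_β hU hp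
  have c₀ := (hc.cos_pos p hp).ne'
  have htan : Real.tan (α p) * Real.cos (α p) = Real.sin (α p) := Real.tan_mul_cos c₀
  have k1 := (((HasPD.of_contDiffOn a1 hU hp).sq.sub (HasPD.of_contDiffOn b1 hU hp).sq).mul
    a.cos.sq).div (au.sq.sub bu.sq) (h.pos p hp).ne'
  have k2 := (((HasPD.of_contDiffOn a2 hU hp).sq.sub (HasPD.of_contDiffOn b2 hU hp).sq).mul
    a.cos.sq).div (bv.sq.sub av.sq) (hc.pv_sq_pos hp).ne'
  have e1 : pv (separationU Q α β x N) p = _ := k1.v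
  have e2 : pu (separationV Q α β x N) p = _ := k2.u
  rw [e1, e2, x1, x2, y1, y2, ← htan]
  constructor
  · rw [div_eq_zero_iff]
    left
    generalize gramForm _ _ _ _ _ _ _ = Γ
    linear_combination (-2) * Γ * Real.cos (α p) ^ 2 * (pu α p ^ 2 - pu β p ^ 2) * g -
      2 * (h₁₁ x N p ^ 2 - h₁₁ (onQuadric Q α β) (quadricNormal Q α β) p ^ 2) *
        Real.cos (α p) ^ 2 * m1
  · rw [div_eq_zero_iff]
    left
    generalize gramForm _ _ _ _ _ _ _ = Γ
    linear_combination (-2) * Γ * Real.cos (α p) ^ 2 * (pv β p ^ 2 - pv α p ^ 2) * g -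
      2 * (h₂₂ x N p ^ 2 - h₂₂ (onQuadric Q α β) (quadricNormal Q α β) p ^ 2) *
        Real.cos (α p) ^ 2 * m2

end Separation

/-! ### Change of one variable -/

/-- A smooth positive density `w` on an interval is normalized by a change of variable: the inverse
of a primitive of `w`. -/
theorem exists_reparametrization {I : Set ℝ} (hI : IsOpen I) (hI' : I.OrdConnected) {w : ℝ → ℝ}
    (hw : ContDiffOn ℝ ∞ w I) (hpos : ∀ t ∈ I, 0 < w t) {c : ℝ} (hc : c ∈ I) :
    ∃ (I' : Set ℝ) (f : ℝ → ℝ), IsOpen I' ∧ I'.OrdConnected ∧ Set.BijOn f I' I ∧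
      ContDiffOn ℝ ∞ f I' ∧ ∀ t ∈ I', w (f t) * deriv f t = 1 := by
  set F : ℝ → ℝ := fun t => ∫ r in c..t, w r with hF
  have hd : ∀ t ∈ I, HasDerivAt F (w t) t := fun t ht => by
    have hsub : Set.uIcc c t ⊆ I := hI'.uIcc_subset hc ht
    exact intervalIntegral.integral_hasDerivAt_right (hw.continuousOn.mono hsub).intervalIntegrable
      (hw.continuousOn.stronglyMeasurableAtFilter hI t ht)
      (hw.continuousOn.continuousAt (hI.mem_nhds ht))
  have hFs : ContDiffOn ℝ ∞ F I := (contDiffOn_infty_iff_deriv_of_isOpen hI).2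
    ⟨fun t ht => (hd t ht).differentiableAt.differentiableWithinAt,
      hw.congr fun t ht => (hd t ht).deriv⟩
  have hmono : StrictMonoOn F I := strictMonoOn_of_deriv_pos hI'.convex hFs.continuousOn
    fun t ht => by
      rw [hI.interior_eq] at ht
      rw [(hd t ht).deriv]; exact hpos t ht
  have hinv : ∀ t ∈ I, Function.invFunOn F I (F t) = t := fun t ht =>
    hmono.injOn.leftInvOn_invFunOn ht
  -- the inverse is locally the one of the inverse function theorem
  have hloc : ∀ t ∈ I, ∃ g : ℝ → ℝ, ContDiffAt ℝ ∞ g (F t) ∧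
      ∀ᶠ y in nhds (F t), g y ∈ I ∧ F (g y) = y := fun t ht => by
    have hc : ContDiffAt ℝ ∞ F t := hFs.contDiffAt (hI.mem_nhds ht)
    have hF' : HasFDerivAt F ((ContinuousLinearEquiv.unitsEquivAut ℝ
        (Units.mk0 (w t) (hpos t ht).ne') : ℝ ≃L[ℝ] ℝ) : ℝ →L[ℝ] ℝ) t := by
      have e : ((ContinuousLinearEquiv.unitsEquivAut ℝ (Units.mk0 (w t) (hpos t ht).ne') :
          ℝ ≃L[ℝ] ℝ) : ℝ →L[ℝ] ℝ) = ContinuousLinearMap.toSpanSingleton ℝ (w t) := by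
        ext; simp
      rw [e]
      exact (hd t ht).hasFDerivAt
    have hn : (∞ : WithTop ℕ∞) ≠ 0 := by simp
    have hs := hc.hasStrictFDerivAt' hF' hn
    refine ⟨hc.localInverse hF' hn, hc.to_localInverse hF' hn, ?_⟩
    have hg : ContinuousAt (hc.localInverse hF' hn) (F t) :=
      (hc.to_localInverse hF' hn).continuousAt
    have h0 : hc.localInverse hF' hn (F t) = t := hc.localInverse_apply_image hF' hn
    filter_upwards [hg.preimage_mem_nhds (by rw [h0]; exact hI.mem_nhds ht),
      hs.eventually_right_inverse] with y h1 h2 using ⟨h1, h2⟩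
  have hO : IsOpen (F '' I) := isOpen_iff_mem_nhds.2 <| by
    rintro _ ⟨t, ht, rfl⟩
    obtain ⟨g, -, hg⟩ := hloc t ht
    filter_upwards [hg] with y hy using ⟨g y, hy⟩
  have hS : ContDiffOn ℝ ∞ (Function.invFunOn F I) (F '' I) := by
    rintro _ ⟨t, ht, rfl⟩
    obtain ⟨g, hgs, hg⟩ := hloc t ht
    refine (hgs.congr_of_eventuallyEq ?_).contDiffWithinAt
    filter_upwards [hg] with y hy
    rw [← hinv (g y) hy.1, hy.2]
  refine ⟨F '' I, Function.invFunOn F I, hO,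
    (hI'.isPreconnected.image F hFs.continuousOn).ordConnected, ?_, hS, ?_⟩
  · exact ⟨fun y hy => Function.invFunOn_mem hy, Set.LeftInvOn.injOn (f₁' := F)
      fun y hy => Function.invFunOn_eq hy, fun t ht => ⟨F t, ⟨t, ht, rfl⟩, hinv t ht⟩⟩
  · rintro _ ⟨t, ht, rfl⟩
    have hd1 : HasDerivAt (Function.invFunOn F I) _ (F t) := ((hS.contDiffAt
      (hO.mem_nhds ⟨t, ht, rfl⟩)).differentiableAt (by simp)).hasDerivAt
    have hd2 : HasDerivAt F (w t) (Function.invFunOn F I (F t)) := by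
      rw [hinv t ht]; exact hd t ht
    rw [hinv t ht]
    refine (hd2.comp (F t) hd1).unique ((hasDerivAt_id (F t)).congr_of_eventuallyEq ?_)
    filter_upwards [hO.mem_nhds ⟨t, ht, rfl⟩] with y hy using Function.invFunOn_eq hy

section Reparametrization

variable {E : Type*} [NormedAddCommGroup E] [NormedSpace ℝ E] {f g : ℝ → ℝ} {I J I' J' : Set ℝ}
  {p : ℝ × ℝ} {k : ℝ × ℝ → E} {a b : E}

theorem HasPD.prodMap {f' g' : ℝ} (h : HasPD k a b (f p.1, g p.2)) (hf : HasDerivAt f f' p.1)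
    (hg : HasDerivAt g g' p.2) : HasPD (fun q => k (f q.1, g q.2)) (f' • a) (g' • b) p := by
  have hm : HasFDerivAt (fun q : ℝ × ℝ => (f q.1, g q.2)) _ p :=
    (hf.hasFDerivAt.comp p hasFDerivAt_fst).prodMk (hg.hasFDerivAt.comp p hasFDerivAt_snd)
  have hk : HasFDerivAt (fun q : ℝ × ℝ => k (f q.1, g q.2)) _ p :=
    h.diff.hasFDerivAt.comp p hm
  refine ⟨hk.differentiableAt, ?_, ?_⟩
  · rw [pu, hk.fderiv, ← h.u, pu, ← map_smul]
    simp
  · rw [pv, hk.fderiv, ← h.v, pv, ← map_smul]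
    simp

theorem contDiffOn_reparam (hf : ContDiffOn ℝ ∞ f I') (hg : ContDiffOn ℝ ∞ g J')
    (mf : Set.MapsTo f I' I) (mg : Set.MapsTo g J' J) (hk : ContDiffOn ℝ ∞ k (I ×ˢ J)) :
    ContDiffOn ℝ ∞ (fun q => k (f q.1, g q.2)) (I' ×ˢ J') :=
  hk.comp ((hf.comp contDiffOn_fst fun _ hq => hq.1).prodMk
    (hg.comp contDiffOn_snd fun _ hq => hq.2)) fun _ hq => ⟨mf hq.1, mg hq.2⟩

variable (hI : IsOpen I) (hJ : IsOpen J) (hI' : IsOpen I') (hJ' : IsOpen J')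
  (hf : ContDiffOn ℝ ∞ f I') (hg : ContDiffOn ℝ ∞ g J')
  (mf : Set.MapsTo f I' I) (mg : Set.MapsTo g J' J)
include hI hJ hI' hJ' hf hg mf mg

theorem hasPD_reparam (hk : ContDiffOn ℝ ∞ k (I ×ˢ J)) (hp : p ∈ I' ×ˢ J') :
    HasPD (fun q => k (f q.1, g q.2)) (deriv f p.1 • pu k (f p.1, g p.2))
      (deriv g p.2 • pv k (f p.1, g p.2)) p :=
  (HasPD.of_contDiffOn hk (hI.prod hJ) ⟨mf hp.1, mg hp.2⟩).prodMap
    ((hf.contDiffAt (hI'.mem_nhds hp.1)).differentiableAt (by simp)).hasDerivAt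
    ((hg.contDiffAt (hJ'.mem_nhds hp.2)).differentiableAt (by simp)).hasDerivAt

/-- The second fundamental form is a tensor: the terms with second derivatives of the change of
coordinates are tangential. -/
theorem IsUnitNormal.form_reparam {x N : ℝ × ℝ → E3} (hN : IsUnitNormal (I ×ˢ J) x N)
    (hx : ContDiffOn ℝ ∞ x (I ×ˢ J)) (hp : p ∈ I' ×ˢ J') :
    h₁₁ (fun q => x (f q.1, g q.2)) (fun q => N (f q.1, g q.2)) p =
      deriv f p.1 ^ 2 * h₁₁ x N (f p.1, g p.2) ∧
    h₁₂ (fun q => x (f q.1, g q.2)) (fun q => N (f q.1, g q.2)) p =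
      deriv f p.1 * deriv g p.2 * h₁₂ x N (f p.1, g p.2) ∧
    h₂₂ (fun q => x (f q.1, g q.2)) (fun q => N (f q.1, g q.2)) p =
      deriv g p.2 ^ 2 * h₂₂ x N (f p.1, g p.2) := by
  have hO := hI.prod hJ
  have hO' := hI'.prod hJ'
  have d : ∀ q ∈ I' ×ˢ J', _ := fun q hq => hasPD_reparam hI hJ hI' hJ' hf hg mf mg hx hq
  have du := hasPD_reparam hI hJ hI' hJ' hf hg mf mg (contDiffOn_pu hx hO) hp
  have dv := hasPD_reparam hI hJ hI' hJ' hf hg mf mg (contDiffOn_pv hx hO) hp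
  have f2 : HasDerivAt (deriv f) _ p.1 := (((hf.deriv_of_isOpen (m := ∞) hI' le_rfl).contDiffAt
    (hI'.mem_nhds hp.1)).differentiableAt (by simp)).hasDerivAt
  have g2 : HasDerivAt (deriv g) _ p.2 := (((hg.deriv_of_isOpen (m := ∞) hJ' le_rfl).contDiffAt
    (hJ'.mem_nhds hp.2)).differentiableAt (by simp)).hasDerivAt
  have h1 : HasPD (fun q : ℝ × ℝ => q.1) 1 0 p :=
    ⟨differentiableAt_fst, by simp [pu, fderiv_fst], by simp [pv, fderiv_fst]⟩
  have h2 : HasPD (fun q : ℝ × ℝ => q.2) 0 1 p :=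
    ⟨differentiableAt_snd, by simp [pu, fderiv_snd], by simp [pv, fderiv_snd]⟩
  have e1 := ((h1.comp f2).smul du).congr_of_eqOn hO' hp fun q hq => (d q hq).u
  have e2 := ((h2.comp g2).smul dv).congr_of_eqOn hO' hp fun q hq => (d q hq).v
  have n1 := hN.orth_u _ (Set.mk_mem_prod (mf hp.1) (mg hp.2))
  have n2 := hN.orth_v _ (Set.mk_mem_prod (mf hp.1) (mg hp.2))
  simp only [h₁₁, h₁₂, h₂₂]
  rw [e1.u, e2.u, e2.v]
  simp only [inner_add_right, real_inner_smul_right, n1, n2]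
  refine ⟨?_, ?_, ?_⟩ <;> simp <;> ring

theorem IsCommonConjugate.reparam {Q : OneSheetedHyperboloid} {α β : ℝ × ℝ → ℝ}
    {x N : ℝ × ℝ → E3} (h : IsCommonConjugate Q (I ×ˢ J) α β x N)
    (pf : ∀ t ∈ I', 0 < deriv f t) (pg : ∀ t ∈ J', 0 < deriv g t) :
    IsCommonConjugate Q (I' ×ˢ J') (fun p => α (f p.1, g p.2)) (fun p => β (f p.1, g p.2))
      (fun p => x (f p.1, g p.2)) (fun p => N (f p.1, g p.2)) := by
  have hc := h.isConjugateChart (hI.prod hJ)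
  have hM := hc.isUnitNormal (Q := Q) (hI.prod hJ)
  have mem : ∀ p ∈ I' ×ˢ J', (f p.1, g p.2) ∈ I ×ˢ J := fun p hp => ⟨mf hp.1, mg hp.2⟩
  have da : ∀ p ∈ I' ×ˢ J', _ := fun p hp =>
    hasPD_reparam hI hJ hI' hJ' hf hg mf mg hc.smooth_α hp
  have db : ∀ p ∈ I' ×ˢ J', _ := fun p hp =>
    hasPD_reparam hI hJ hI' hJ' hf hg mf mg hc.smooth_β hp
  have dx : ∀ p ∈ I' ×ˢ J', _ := fun p hp =>
    hasPD_reparam hI hJ hI' hJ' hf hg mf mg h.deformation.smooth_x hp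
  have dy : ∀ p ∈ I' ×ˢ J', HasPD (onQuadric Q (fun p => α (f p.1, g p.2))
      fun p => β (f p.1, g p.2)) _ _ p := fun p hp =>
    hasPD_reparam hI hJ hI' hJ' hf hg mf mg (hc.contDiffOn_X (Q := Q) (z := 0)) hp
  refine ⟨⟨contDiffOn_reparam hf hg mf mg hc.smooth_α, contDiffOn_reparam hf hg mf mg hc.smooth_β,
    contDiffOn_reparam hf hg mf mg h.deformation.smooth_x,
    fun p hp => h.deformation.chart _ (mem p hp), fun p hp => ?_, fun p hp => ?_, fun p hp => ?_,
    fun p hp => ?_⟩, ⟨contDiffOn_reparam hf hg mf mg h.normal.smooth,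
    fun p hp => h.normal.norm_eq_one _ (mem p hp), fun p hp => ?_, fun p hp => ?_⟩,
    fun p hp => ?_, fun p hp => ?_, fun p hp => ?_⟩
  · have j := h.deformation.jac_ne_zero _ (mem p hp)
    rw [jac, (da p hp).u, (da p hp).v, (db p hp).u, (db p hp).v]
    have := mul_ne_zero (mul_ne_zero (pf _ hp.1).ne' (pg _ hp.2).ne') j
    rw [jac] at this
    simp only [smul_eq_mul]
    convert this using 1
    ring
  · rw [(dx p hp).u, (dy p hp).u]
    simp only [real_inner_smul_left, real_inner_smul_right]
    rw [h.deformation.metric_uu _ (mem p hp)]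
    rfl
  · rw [(dx p hp).u, (dy p hp).u, (dx p hp).v, (dy p hp).v]
    simp only [real_inner_smul_left, real_inner_smul_right]
    rw [h.deformation.metric_uv _ (mem p hp)]
    rfl
  · rw [(dx p hp).v, (dy p hp).v]
    simp only [real_inner_smul_left, real_inner_smul_right]
    rw [h.deformation.metric_vv _ (mem p hp)]
    rfl
  · rw [(dx p hp).u, real_inner_smul_right, h.normal.orth_u _ (mem p hp), mul_zero]
  · rw [(dx p hp).v, real_inner_smul_right, h.normal.orth_v _ (mem p hp), mul_zero]
  · refine (hM.form_reparam hI hJ hI' hJ' hf hg mf mg hc.contDiffOn_X hp).2.1.trans ?_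
    rw [h.conj_quadric _ (mem p hp), mul_zero]
  · rw [(h.normal.form_reparam hI hJ hI' hJ' hf hg mf mg h.deformation.smooth_x hp).2.1,
      h.conj_x _ (mem p hp), mul_zero]
  · rw [(da p hp).u, (db p hp).u, smul_eq_mul, smul_eq_mul, mul_pow, mul_pow, ← mul_sub]
    exact mul_pos (pow_pos (pf _ hp.1) 2) (h.pos _ (mem p hp))

end Reparametrization

/-! ### Normalization of a common conjugate system -/

section Normalization

theorem eq_of_pv_eq_zero {I J : Set ℝ} (hI : IsOpen I) (hJ : IsOpen J) (hJ' : J.OrdConnected)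
    {k : ℝ × ℝ → ℝ} (hk : ContDiffOn ℝ ∞ k (I ×ˢ J)) (h : ∀ p ∈ I ×ˢ J, pv k p = 0) {u v v' : ℝ}
    (hu : u ∈ I) (hv : v ∈ J) (hv' : v' ∈ J) : k (u, v) = k (u, v') := by
  have d : ∀ t ∈ J, HasDerivAt (fun t => k (u, t)) 0 t := fun t ht => by
    rw [← h (u, t) ⟨hu, ht⟩]
    exact (differentiableAt_of_contDiffOn hk (hI.prod hJ)
      (Set.mk_mem_prod hu ht)).hasFDerivAt.comp_hasDerivAt t
      ((hasDerivAt_const t u).prodMk (hasDerivAt_id t))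
  exact hJ.is_const_of_deriv_eq_zero hJ'.isPreconnected
    (fun t ht => (d t ht).differentiableAt.differentiableWithinAt)
    (fun t ht => (d t ht).deriv) hv hv'

theorem eq_of_pu_eq_zero {I J : Set ℝ} (hI : IsOpen I) (hJ : IsOpen J) (hI' : I.OrdConnected)
    {k : ℝ × ℝ → ℝ} (hk : ContDiffOn ℝ ∞ k (I ×ˢ J)) (h : ∀ p ∈ I ×ˢ J, pu k p = 0) {u u' v : ℝ}
    (hu : u ∈ I) (hu' : u' ∈ I) (hv : v ∈ J) : k (u, v) = k (u', v) := by
  have d : ∀ t ∈ I, HasDerivAt (fun t => k (t, v)) 0 t := fun t ht => by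
    rw [← h (t, v) ⟨ht, hv⟩]
    exact (differentiableAt_of_contDiffOn hk (hI.prod hJ)
      (Set.mk_mem_prod ht hv)).hasFDerivAt.comp_hasDerivAt t
      ((hasDerivAt_id t).prodMk (hasDerivAt_const t v))
  exact hI.is_const_of_deriv_eq_zero hI'.isPreconnected
    (fun t ht => (d t ht).differentiableAt.differentiableWithinAt)
    (fun t ht => (d t ht).deriv) hu hu'

/-- A function without zeros on a connected set has a constant sign. -/
theorem exists_sign_mul_pos {U : Set (ℝ × ℝ)} (hU : IsPreconnected U) {d : ℝ × ℝ → ℝ}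
    (hd : ContinuousOn d U) (h0 : ∀ p ∈ U, d p ≠ 0) :
    ∃ s : ℝ, (s = 1 ∨ s = -1) ∧ ∀ p ∈ U, 0 < s * d p := by
  obtain ⟨s, hs, h⟩ := exists_sign_of_sq_eq_one hU (f := fun p => d p / |d p|)
    (hd.div hd.abs fun p hp => abs_ne_zero.2 (h0 p hp)) fun p hp => by
      rw [div_pow, sq_abs, div_self (pow_ne_zero 2 (h0 p hp))]
  refine ⟨s, hs, fun p hp => ?_⟩
  rw [← h p hp, div_mul_eq_mul_div, ← pow_two, ← sq_abs, pow_two, mul_self_div_self]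
  exact abs_pos.2 (h0 p hp)

/-- The Gauss equation `h k = -L M / D²`, with `D² = c² H`, determines `h` when the two separated
functions are normalized to `± 1`; here `L`, `M` are the values of `λ²` and `μ²` before the change
of variables, whose derivatives have the squares `a` and `b`. -/
theorem normalization_identities {s h k L M H c D a b : ℝ} (hs : s = 1 ∨ s = -1) (hL : 0 < L)
    (hM : 0 < M) (hH : 0 < H) (hc : 0 < c) (hD : D ^ 2 = c ^ 2 * H)
    (hg : h * k = L / D * -(M / D))
    (ha : a * (s * ((h ^ 2 - (L / D) ^ 2) * c ^ 2 / L)) = 1)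
    (hb : b * -(s * ((k ^ 2 - (-(M / D)) ^ 2) * c ^ 2 / M)) = 1) :
    b * M - a * L = s * H ∧ (a * h) ^ 2 = a * L * (b * M) / D ^ 2 := by
  have hs2 : s * s = 1 := by rcases hs with rfl | rfl <;> norm_num
  have D0 : D ≠ 0 := fun h0 => by
    rw [h0] at hD
    have : 0 < c ^ 2 * H := by positivity
    linarith [hD]
  have c0 := hc.ne'
  have g : h * k * D ^ 2 = -(L * M) := by rw [hg]; field_simp
  have a1 : a * s * (h ^ 2 * D ^ 2 - L ^ 2) = L * H := by
    field_simp at ha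
    apply mul_left_cancel₀ (pow_ne_zero 2 c0)
    linear_combination ha + L * hD
  have b1 : b * s * (k ^ 2 * D ^ 2 - M ^ 2) = -(M * H) := by
    field_simp at hb
    apply mul_left_cancel₀ (pow_ne_zero 2 c0)
    linear_combination -hb - M * hD
  have a2 : a * (h ^ 2 * D ^ 2) = a * L ^ 2 + s * (L * H) := by
    linear_combination s * a1 - a * (h ^ 2 * D ^ 2 - L ^ 2) * hs2
  have b2 : b * (k ^ 2 * D ^ 2) = b * M ^ 2 - s * (M * H) := by
    linear_combination s * b1 - b * (k ^ 2 * D ^ 2 - M ^ 2) * hs2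
  have n : b * M - a * L = s * H := by
    have e : a * (h ^ 2 * D ^ 2) * (b * (k ^ 2 * D ^ 2)) = a * b * (L * M) ^ 2 := by
      linear_combination a * b * (h * k * D ^ 2 - L * M) * g
    rw [a2, b2] at e
    apply mul_left_cancel₀ (mul_pos (mul_pos hL hM) hH).ne'
    linear_combination s * e - (L * M * H * (b * M - a * L) - s * L * M * H ^ 2) * hs2
  refine ⟨n, ?_⟩
  rw [eq_div_iff (pow_ne_zero 2 D0)]
  linear_combination a * a2 - a * L * n

/-- The changes of variables make the two separated functions equal to `s` and `-s`, where `s` is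
the constant sign of `h̃₁₁² - h̄₁₁²`. -/
theorem IsCommonConjugate.exists_isothermicConjugate {Q : OneSheetedHyperboloid} {I J : Set ℝ}
    {α β : ℝ × ℝ → ℝ} {x N : ℝ × ℝ → E3} (hI : IsOpen I) (hI' : I.OrdConnected) (hJ : IsOpen J)
    (hJ' : J.OrdConnected) (h : IsCommonConjugate Q (I ×ˢ J) α β x N)
    (hne : ∀ p ∈ I ×ˢ J,
      h₁₁ x N p ^ 2 ≠ h₁₁ (onQuadric Q α β) (quadricNormal Q α β) p ^ 2) :
    ∃ (s σ : ℝ) (I' J' : Set ℝ) (f g : ℝ → ℝ),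
      (s = 1 ∨ s = -1) ∧ (σ = 1 ∨ σ = -1) ∧
      IsOpen I' ∧ I'.OrdConnected ∧ IsOpen J' ∧ J'.OrdConnected ∧
      Set.BijOn f I' I ∧ ContDiffOn ℝ ∞ f I' ∧ (∀ t ∈ I', 0 < deriv f t) ∧
      Set.BijOn g J' J ∧ ContDiffOn ℝ ∞ g J' ∧ (∀ t ∈ J', 0 < deriv g t) ∧
      (s = 1 → ∀ p ∈ I ×ˢ J,
        h₁₁ (onQuadric Q α β) (quadricNormal Q α β) p ^ 2 < h₁₁ x N p ^ 2) ∧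
      (s = -1 → ∀ p ∈ I ×ˢ J,
        h₁₁ x N p ^ 2 < h₁₁ (onQuadric Q α β) (quadricNormal Q α β) p ^ 2) ∧
      IsIsothermicConjugate Q s (I' ×ˢ J')
        (fun p => α (f p.1, g p.2)) (fun p => β (f p.1, g p.2))
        (fun p => x (f p.1, g p.2)) (fun p => σ • N (f p.1, g p.2)) := by
  have hO := hI.prod hJ
  have hP := hI'.isPreconnected.prod hJ'.isPreconnected
  -- on the empty set there is nothing to normalize, and the identity changes of variables do
  rcases (I ×ˢ J).eq_empty_or_nonempty with he | ⟨⟨u₀, v₀⟩, hu₀ : u₀ ∈ I, hv₀ : v₀ ∈ J⟩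
  · obtain ⟨σ, hσ, hs⟩ := h.exists_sign_isIsothermicConjugate (s := 1) hO hP
      (fun p hp => by simp [he] at hp) fun p hp => by simp [he] at hp
    exact ⟨1, σ, I, J, id, id, Or.inl rfl, hσ, hI, hI', hJ, hJ', Set.bijOn_id I, contDiffOn_id,
      fun t _ => by simp, Set.bijOn_id J, contDiffOn_id, fun t _ => by simp,
      fun _ p hp => by simp [he] at hp, fun _ p hp => by simp [he] at hp, hs⟩
  have hc := h.isConjugateChart hO
  have hM := hc.isUnitNormal (Q := Q) hO
  have sm := h.deformation.sameMetric
  have ry := hc.isRegular (Q := Q) hO h.deformation.jac_ne_zero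
  obtain ⟨s, hs, hsd⟩ := exists_sign_mul_pos hP
    (d := fun p => h₁₁ x N p ^ 2 - h₁₁ (onQuadric Q α β) (quadricNormal Q α β) p ^ 2)
    (((h.normal.contDiffOn_form h.deformation.smooth_x hO).1.continuousOn.pow 2).sub
      ((hM.contDiffOn_form hc.contDiffOn_X hO).1.continuousOn.pow 2))
    fun p hp => sub_ne_zero.2 (hne p hp)
  have hgauss : ∀ p ∈ I ×ˢ J, h₁₁ x N p * h₂₂ x N p =
      h₁₁ (onQuadric Q α β) (quadricNormal Q α β) p *
        h₂₂ (onQuadric Q α β) (quadricNormal Q α β) p := fun p hp => by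
    have := sm.gauss hO ry h.normal hM hp
    rw [h.conj_x p hp, h.conj_quadric p hp] at this
    linear_combination this
  have hD : ∀ p ∈ I ×ˢ J, 0 < Real.cos (α p) * √(Q.H (α p) (β p)) := fun p hp =>
    mul_pos (hc.cos_pos p hp) (Real.sqrt_pos.2 (Q.H_pos _ _))
  -- the two functions of one variable have the signs `s` and `-s`
  have posU : ∀ p ∈ I ×ˢ J, 0 < s * separationU Q α β x N p := fun p hp => by
    have e : s * separationU Q α β x N p = s * (h₁₁ x N p ^ 2 -
        h₁₁ (onQuadric Q α β) (quadricNormal Q α β) p ^ 2) *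
        (Real.cos (α p) ^ 2 / (pu α p ^ 2 - pu β p ^ 2)) := by rw [separationU]; ring
    rw [e]
    exact mul_pos (hsd p hp) (div_pos (pow_pos (hc.cos_pos p hp) 2) (h.pos p hp))
  have posV : ∀ p ∈ I ×ˢ J, 0 < -(s * separationV Q α β x N p) := fun p hp => by
    have e : -(s * separationV Q α β x N p) = -(s * (h₂₂ x N p ^ 2 -
        h₂₂ (onQuadric Q α β) (quadricNormal Q α β) p ^ 2)) *
        (Real.cos (α p) ^ 2 / (pv β p ^ 2 - pv α p ^ 2)) := by rw [separationV]; ring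
    rw [e]
    refine mul_pos ?_ (div_pos (pow_pos (hc.cos_pos p hp) 2) (hc.pv_sq_pos hp))
    obtain ⟨q1, -, q3⟩ := hc.second_form (Q := Q) hO hp
    have y1 : 0 < h₁₁ (onQuadric Q α β) (quadricNormal Q α β) p := by
      rw [q1]; exact div_pos (h.pos p hp) (hD p hp)
    have y2 : h₂₂ (onQuadric Q α β) (quadricNormal Q α β) p < 0 := by
      rw [q3]; exact neg_neg_of_pos (div_pos (hc.pv_sq_pos hp) (hD p hp))
    have g := hgauss p hp
    have k0 : h₂₂ x N p ≠ 0 := fun h0 => by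
      rw [h0, mul_zero] at g
      exact (mul_neg_of_pos_of_neg y1 y2).ne g.symm
    have d := hsd p hp
    generalize h₁₁ (onQuadric Q α β) (quadricNormal Q α β) p = a at *
    generalize h₂₂ (onQuadric Q α β) (quadricNormal Q α β) p = b at *
    have e2 : a ^ 2 * -(s * (h₂₂ x N p ^ 2 - b ^ 2)) =
        h₂₂ x N p ^ 2 * (s * (h₁₁ x N p ^ 2 - a ^ 2)) := by
      linear_combination (-s) * (h₁₁ x N p * h₂₂ x N p + a * b) * g
    refine pos_of_mul_pos_right ?_ (sq_nonneg a)
    rw [e2]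
    exact mul_pos (by positivity) d
  obtain ⟨cU, cV⟩ := h.contDiffOn_separation hO
  have kU : ∀ p ∈ I ×ˢ J, separationU Q α β x N (p.1, v₀) = separationU Q α β x N p :=
    fun p hp => eq_of_pv_eq_zero hI hJ hJ' cU
      (fun q hq => (h.separation_deriv_eq_zero hO hq).1) hp.1 hv₀ hp.2
  have kV : ∀ p ∈ I ×ˢ J, separationV Q α β x N (u₀, p.2) = separationV Q α β x N p :=
    fun p hp => eq_of_pu_eq_zero hI hJ hI' cV
      (fun q hq => (h.separation_deriv_eq_zero hO hq).2) hu₀ hp.1 hp.2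
  obtain ⟨I', f, hIo, hIc, hfb, hf, hf1⟩ := exists_reparametrization hI hI'
    (w := fun t => √(s * separationU Q α β x N (t, v₀)))
    ((contDiffOn_const.mul (cU.comp (contDiffOn_id.prodMk contDiffOn_const)
      fun t ht => ⟨ht, hv₀⟩)).sqrt fun t ht => (posU (t, v₀) ⟨ht, hv₀⟩).ne')
    (fun t ht => Real.sqrt_pos.2 (posU (t, v₀) ⟨ht, hv₀⟩)) hu₀
  obtain ⟨J', g, hJo, hJc, hgb, hg, hg1⟩ := exists_reparametrization hJ hJ'
    (w := fun t => √(-(s * separationV Q α β x N (u₀, t))))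
    ((contDiffOn_const.mul (cV.comp (contDiffOn_const.prodMk contDiffOn_id)
      fun t ht => ⟨hu₀, ht⟩)).neg.sqrt fun t ht => (posV (u₀, t) ⟨hu₀, ht⟩).ne')
    (fun t ht => Real.sqrt_pos.2 (posV (u₀, t) ⟨hu₀, ht⟩)) hv₀
  have pf : ∀ t ∈ I', 0 < deriv f t := fun t ht =>
    pos_of_mul_pos_right (by rw [hf1 t ht]; exact one_pos) (Real.sqrt_nonneg _)
  have pg : ∀ t ∈ J', 0 < deriv g t := fun t ht =>
    pos_of_mul_pos_right (by rw [hg1 t ht]; exact one_pos) (Real.sqrt_nonneg _)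
  have hr := h.reparam hI hJ hIo hJo hf hg hfb.mapsTo hgb.mapsTo pf pg
  have hcr := hr.isConjugateChart (hIo.prod hJo)
  have key : ∀ p ∈ I' ×ˢ J', _ := fun p hp => by
    have hq : (f p.1, g p.2) ∈ I ×ˢ J := ⟨hfb.mapsTo hp.1, hgb.mapsTo hp.2⟩
    obtain ⟨q1, -, q3⟩ := hc.second_form (Q := Q) hO hq
    have hG := hgauss _ hq
    rw [q1, q3] at hG
    have eU := congrArg (· ^ 2) (hf1 p.1 hp.1)
    have eV := congrArg (· ^ 2) (hg1 p.2 hp.2)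
    simp only [mul_pow, one_pow] at eU eV
    rw [kU _ hq, Real.sq_sqrt (posU _ hq).le, mul_comm, separationU, q1] at eU
    rw [kV _ hq, Real.sq_sqrt (posV _ hq).le, mul_comm, separationV, q3] at eV
    exact normalization_identities hs (h.pos _ hq) (hc.pv_sq_pos hq) (Q.H_pos _ _)
      (hc.cos_pos _ hq) (by rw [mul_pow, Real.sq_sqrt (Q.H_pos _ _).le]) hG eU eV
  have sq : ∀ p ∈ I' ×ˢ J', lam (fun p => α (f p.1, g p.2)) (fun p => β (f p.1, g p.2)) p ^ 2 =
        deriv f p.1 ^ 2 * (pu α (f p.1, g p.2) ^ 2 - pu β (f p.1, g p.2) ^ 2) ∧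
      mu (fun p => α (f p.1, g p.2)) (fun p => β (f p.1, g p.2)) p ^ 2 =
        deriv g p.2 ^ 2 * (pv β (f p.1, g p.2) ^ 2 - pv α (f p.1, g p.2) ^ 2) := fun p hp => by
    have da := hasPD_reparam hI hJ hIo hJo hf hg hfb.mapsTo hgb.mapsTo hc.smooth_α hp
    have db := hasPD_reparam hI hJ hIo hJo hf hg hfb.mapsTo hgb.mapsTo hc.smooth_β hp
    rw [hcr.lam_sq hp, hcr.mu_sq hp, da.u, da.v, db.u, db.v]
    simp only [smul_eq_mul]
    constructor <;> ring
  obtain ⟨σ, hσ, hfin⟩ := hr.exists_sign_isIsothermicConjugate (s := s) (hIo.prod hJo)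
    (hIc.isPreconnected.prod hJc.isPreconnected)
    (fun p hp => by
      rw [(h.normal.form_reparam hI hJ hIo hJo hf hg hfb.mapsTo hgb.mapsTo
        h.deformation.smooth_x hp).1, (key p hp).2, div_pow, mul_pow (lam _ _ p),
        (sq p hp).1, (sq p hp).2])
    fun p hp => by rw [(sq p hp).1, (sq p hp).2, (key p hp).1]
  refine ⟨s, σ, I', J', f, g, hs, hσ, hIo, hIc, hJo, hJc, hfb, hf, pf, hgb, hg, pg, ?_, ?_, hfin⟩
  · rintro rfl p hp
    linarith [hsd p hp]
  · rintro rfl p hp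
    linarith [hsd p hp]

end Normalization

end QuadricDeformation

end

open QuadricDeformation

theorem mainTheorem5 (Q : OneSheetedHyperboloid) :
    -- a common conjugate system becomes isothermic-conjugate by changing `u` and `v` separately
    (∀ (I J : Set ℝ) (α β : ℝ × ℝ → ℝ) (x N : ℝ × ℝ → E3),
      IsOpen I → I.OrdConnected → IsOpen J → J.OrdConnected →
      IsCommonConjugate Q (I ×ˢ J) α β x N →
      (∀ p ∈ I ×ˢ J, h₁₁ x N p ^ 2 ≠ h₁₁ (onQuadric Q α β) (quadricNormal Q α β) p ^ 2) →
      ∃ (s σ : ℝ) (I' J' : Set ℝ) (f g : ℝ → ℝ),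
        (s = 1 ∨ s = -1) ∧ (σ = 1 ∨ σ = -1) ∧
        IsOpen I' ∧ I'.OrdConnected ∧ IsOpen J' ∧ J'.OrdConnected ∧
        Set.BijOn f I' I ∧ ContDiffOn ℝ ∞ f I' ∧ (∀ t ∈ I', 0 < deriv f t) ∧
        Set.BijOn g J' J ∧ ContDiffOn ℝ ∞ g J' ∧ (∀ t ∈ J', 0 < deriv g t) ∧
        (s = 1 → ∀ p ∈ I ×ˢ J,
          h₁₁ (onQuadric Q α β) (quadricNormal Q α β) p ^ 2 < h₁₁ x N p ^ 2) ∧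
        (s = -1 → ∀ p ∈ I ×ˢ J,
          h₁₁ x N p ^ 2 < h₁₁ (onQuadric Q α β) (quadricNormal Q α β) p ^ 2) ∧
        IsIsothermicConjugate Q s (I' ×ˢ J')
          (fun p => α (f p.1, g p.2)) (fun p => β (f p.1, g p.2))
          (fun p => x (f p.1, g p.2)) (fun p => σ • N (f p.1, g p.2))) ∧
    -- in the isothermic-conjugate system the angle satisfies the system and the equation
    (∀ (s : ℝ) (U : Set (ℝ × ℝ)) (α β : ℝ × ℝ → ℝ) (x N : ℝ × ℝ → E3),
      (s = 1 ∨ s = -1) → IsOpen U →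
      IsIsothermicConjugate Q s U α β x N → AngleEquations Q s U α β) ∧
    -- the Bäcklund transformation for `z < 0`
    (∀ (z : ℝ) (U : Set (ℝ × ℝ)) (α₀ β₀ : ℝ × ℝ → ℝ) (x₀ N₀ : ℝ × ℝ → E3)
      (α₁ β₁ : ℝ × ℝ → ℝ) (x₁ : ℝ × ℝ → E3),
      Q.a₃ < z → z < 0 → IsOpen U → IsPreconnected U →
      IsIsothermicConjugate Q 1 U α₀ β₀ x₀ N₀ →
      IsBacklundTransform Q z U α₀ β₀ x₀ α₁ β₁ x₁ →
      (∃ N₁ : ℝ × ℝ → E3, IsIsothermicConjugate Q 1 U α₁ β₁ x₁ N₁) ∧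
      AngleEquations Q 1 U α₁ β₁ ∧
      ∃ ε ε' : ℝ, (ε = 1 ∨ ε = -1) ∧ (ε' = 1 ∨ ε' = -1) ∧
        RulingSign Q z ε U α₀ β₀ x₀ N₀ α₁ β₁ x₁ ∧
        AlgebraicRelations Q z ε ε' U α₀ β₀ α₁ β₁ ∧
        AlgebraicRelations Q z ε (-ε') U α₁ β₁ α₀ β₀ ∧
        BacklundRelations Q z ε ε' U α₀ β₀ (theta α₀ β₀) α₁ β₁ (theta α₁ β₁)) := by
  exact ⟨fun I J α β x N hI hI' hJ hJ' h hne => h.exists_isothermicConjugate hI hI' hJ hJ' hne,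
    fun s U α β x N _ hU h => (h.common.isConjugateChart hU).angleEquations hU h.normalized,
    fun z U α₀ β₀ x₀ N₀ α₁ β₁ x₁ hz' hz hU hc hI hB => hB.isothermicConjugate hz' hz hU hc hI⟩
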